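/- **Theorem (hardness of All-Nearest Neighbors).** Work with deterministic algorithms on a random access machine over the natural numbers with logarithmic cost (each step costs one plus the bit lengths of the numbers and addresses involved). *Orthogonal Vectors* ($\mathbf{OV}$): given $n$ vectors $v_1,\dots,v_n\in\{0,1\}^d$, decide whether there are $i,j$ with $\langle v_i,v_j\rangle=0$. The *Orthogonal Vectors Conjecture* (OVC): for every $\varepsilon>0$ there is a $c\ge 1$ such that $\mathbf{OV}$ on instances of dimension $d=\lfloor c\log_2 n\rfloor$ cannot be solved in $O(n^{2-\varepsilon})$ time. *All-Nearest Neighbors in $\ell_2$*: given a set of $n$ points $x_1,\dots,x_n\in\mathbb{R}^d$, report for every $i$ an index $j\ne i$ such that $\|x_i-x_j\|_2\le\|x_i-x_k\|_2$ for all $k\neq i$. Assume OVC. Then All-Nearest Neighbors in $\ell_2$ in $\omega(\log n)$ dimensions requires $n^{2-o(1)}$ time, even when restricted to sets of vectors with entries in $\{-1,0,1\}$. That is, for every $\varepsilon>0$: 1. there is a $c\ge 1$ such that no algorithm solves All-Nearest Neighbors in $O(n^{2-\varepsilon})$ time on all sets of $n$ points in $\{-1,0,1\}^{d}$, $d=\lfloor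 c\log_2 n\rfloor$, for all sufficiently large $n$; 2. consequently, for every function $f:\mathbb N\to\mathbb N$ with $f(n)=\omega(\log n)$, no algorithm solves All-Nearest Neighbors in $O(n^{2-\varepsilon})$ time on all sets of $n$ points in $\{-1,0,1\}^d$ with $d\le f(n)$, for all sufficiently large $n$. -/

import Mathlib

open Filter Asymptotics

/-! ### Random access machines with logarithmic cost

The machine has registers and an unbounded random-access memory, both holding natural numbers of
arbitrary size. A program mentions finitely many registers; its control flow is given by sequencing,
branching and loops. Each step is charged one unit plus the bit lengths (`Nat.size`) of all the
numbers it handles, including the memory addresses it uses. -/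

/-- Registers and memory of a random access machine. -/
structure RAMState where
  reg : ℕ → ℕ
  mem : ℕ → ℕ

/-- The arithmetic operations on natural numbers: addition, truncated subtraction, multiplication,
and division rounded down. -/
inductive ArithOp where
  | add
  | sub
  | mul
  | div

def ArithOp.eval : ArithOp → ℕ → ℕ → ℕ
  | .add, x, y => x + y
  | .sub, x, y => x - y
  | .mul, x, y => x * y
  | .div, x, y => x / y

/-- Programs. The arguments `r`, `a`, `b` are names of registers. -/
inductive RAMProg where
  /-- `r := k` for a fixed number `k` -/
  | const (r k : ℕ)
  /-- `r := a o b` -/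
  | arith (o : ArithOp) (r a b : ℕ)
  /-- `r := mem[a]` -/
  | load (r a : ℕ)
  /-- `mem[a] := b` -/
  | store (a b : ℕ)
  /-- first `p`, then `q` -/
  | seq (p q : RAMProg)
  /-- `p` if register `r` is nonzero, else `q` -/
  | cond (r : ℕ) (p q : RAMProg)
  /-- repeat `p` as long as register `r` is nonzero -/
  | loop (r : ℕ) (p : RAMProg)

def RAMState.setReg (s : RAMState) (r x : ℕ) : RAMState :=
  { s with reg := Function.update s.reg r x }

def RAMState.setMem (s : RAMState) (a x : ℕ) : RAMState :=
  { s with mem := Function.update s.mem a x }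

/-- `RAMExec p s t s'`: started in state `s`, the program `p` halts in state `s'`, and the total
(logarithmic) cost of the run is `t`. -/
inductive RAMExec : RAMProg → RAMState → ℕ → RAMState → Prop where
  | const (r k : ℕ) (s : RAMState) :
      RAMExec (.const r k) s (1 + k.size) (s.setReg r k)
  | arith (o : ArithOp) (r a b : ℕ) (s : RAMState) :
      RAMExec (.arith o r a b) s (1 + (s.reg a).size + (s.reg b).size)
        (s.setReg r (o.eval (s.reg a) (s.reg b)))
  | load (r a : ℕ) (s : RAMState) :
      RAMExec (.load r a) s (1 + (s.reg a).size + (s.mem (s.reg a)).size)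
        (s.setReg r (s.mem (s.reg a)))
  | store (a b : ℕ) (s : RAMState) :
      RAMExec (.store a b) s (1 + (s.reg a).size + (s.reg b).size)
        (s.setMem (s.reg a) (s.reg b))
  | seq {p q : RAMProg} {s s' s'' : RAMState} {t t' : ℕ} :
      RAMExec p s t s' → RAMExec q s' t' s'' → RAMExec (.seq p q) s (t + t') s''
  | cond_true {r : ℕ} {p q : RAMProg} {s s' : RAMState} {t : ℕ} :
      s.reg r ≠ 0 → RAMExec p s t s' → RAMExec (.cond r p q) s (1 + (s.reg r).size + t) s'
  | cond_false {r : ℕ} {p q : RAMProg} {s s' : RAMState} {t : ℕ} :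
      s.reg r = 0 → RAMExec q s t s' → RAMExec (.cond r p q) s (1 + (s.reg r).size + t) s'
  | loop_stop {r : ℕ} {p : RAMProg} {s : RAMState} :
      s.reg r = 0 → RAMExec (.loop r p) s (1 + (s.reg r).size) s
  | loop_step {r : ℕ} {p : RAMProg} {s s' s'' : RAMState} {t t' : ℕ} :
      s.reg r ≠ 0 → RAMExec p s t s' → RAMExec (.loop r p) s' t' s'' →
      RAMExec (.loop r p) s (1 + (s.reg r).size + t + t') s''

/-- The initial state on an `n × d` table of natural numbers: the memory holds `n`, `d`, and then
the table row by row (entry `(i, j)` in cell `2 + d * i + j`); every other cell and every register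
is `0`. -/
def tableInput (n d : ℕ) (a : Fin n → Fin d → ℕ) : RAMState where
  reg := fun _ => 0
  mem
    | 0 => n
    | 1 => d
    | q + 2 =>
      if h : q < n * d then
        a (finProdFinEquiv.symm ⟨q, h⟩).1 (finProdFinEquiv.symm ⟨q, h⟩).2
      else 0

/-! ### Orthogonal Vectors -/

/-- The dimension `c log n`, rounded down to an integer. -/
noncomputable def logDim (c : ℝ) (n : ℕ) : ℕ := ⌊c * Real.logb 2 n⌋₊

/-- Some two of the vectors (in `{0,1}^d`) have inner product `0`. -/
def HasOrthogonalPair {n d : ℕ} (v : Fin n → Fin d → ℕ) : Prop :=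
  ∃ i j, ∑ k, v i k * v j k = 0

/-- Some program decides, in time `O(n^(2-ε))`, whether among `n` given vectors in `{0,1}^d`,
`d = dim n`, there is an orthogonal pair; it accepts by a nonzero number in register `0`. -/
def OVSolvable (dim : ℕ → ℕ) (ε : ℝ) : Prop :=
  ∃ (P : RAMProg) (C : ℝ), ∀ n : ℕ, 1 ≤ n →
    ∀ v : Fin n → Fin (dim n) → ℕ, (∀ i k, v i k = 0 ∨ v i k = 1) →
      ∃ (t : ℕ) (s : RAMState), RAMExec P (tableInput n (dim n) v) t s ∧
        (t : ℝ) ≤ C * (n : ℝ) ^ (2 - ε) ∧ (s.reg 0 ≠ 0 ↔ HasOrthogonalPair v)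

/-- The Orthogonal Vectors Conjecture. -/
def OrthogonalVectorsConjecture : Prop :=
  ∀ ε : ℝ, 0 < ε → ∃ c : ℝ, 1 ≤ c ∧ ¬ OVSolvable (logDim c) ε

/-! ### All-Nearest Neighbors -/

/-- An integer vector as a point of Euclidean space (with the `ℓ₂` metric). -/
noncomputable def euclPoint {d : ℕ} (y : Fin d → ℤ) : EuclideanSpace ℝ (Fin d) :=
  WithLp.toLp 2 fun k => (y k : ℝ)

/-- For each `i`, `out i` is the index of a point nearest to `x i` among the other points. -/
def IsAllNearestNeighbors {n d : ℕ} (x : Fin n → Fin d → ℤ) (out : ℕ → ℕ) : Prop :=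
  ∀ i : Fin n, ∃ j : Fin n, out i = j ∧ j ≠ i ∧
    ∀ k : Fin n, k ≠ i →
      dist (euclPoint (x i)) (euclPoint (x j)) ≤ dist (euclPoint (x i)) (euclPoint (x k))

/-- Some program solves All-Nearest Neighbors in `ℓ₂` in time `O(n^(2-ε))` on all sets of `n`
points in `{-1,0,1}^d`, for all sufficiently large `n` and all `d` with `D n d`. The entries
`-1, 0, 1` are stored as the numbers `0, 1, 2`; on halting, the memory cell `i` has to contain the
index of a nearest neighbor of the `i`-th point, for `i = 0, …, n - 1`. -/
def ANNSolvable (D : ℕ → ℕ → Prop) (ε : ℝ) : Prop :=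
  ∃ (P : RAMProg) (C : ℝ) (N : ℕ), ∀ n d : ℕ, N ≤ n → D n d →
    ∀ x : Fin n → Fin d → ℤ, (∀ i k, x i k = -1 ∨ x i k = 0 ∨ x i k = 1) →
      Function.Injective x →
      ∃ (t : ℕ) (s : RAMState),
        RAMExec P (tableInput n d fun i k => (x i k + 1).toNat) t s ∧
        (t : ℝ) ≤ C * (n : ℝ) ^ (2 - ε) ∧ IsAllNearestNeighbors x s.mem

/-! Cut the n vectors into blocks of s = 2^k, where 2^(48k) equals n up to a constant factor. For
blocks (a_i) and (b_j) form 2s points: (1 - a_i, a_i, w_i, 0, 0) of the first kind and (1, 1 - 2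
b_j, 0, bits of the index, 0) of the second kind, where w_i is a codeword and the bits of words and
indices are written as ±1. A pair of bits a, b contributes 1 + 4ab to the squared distance, so
points of different kinds have squared distance K + 4⟨a_i, b_j⟩ with K independent of i and j
(`sqDistOf_pointEntry_of_lt_of_le`).

The codewords have length 24k and mutual distance above 8k, and every bit is repeated D times, with
D proportional to c. This puts points of the first kind at squared distance greater than K from each
other (`le_sqDistOf_pointEntry`, `five_mul_add_lt`). Hence if a_i is orthogonal to some b_j, its
nearest neighbor is of the second kind and carries a vector orthogonal to a_i
(`orthogonal_of_nearest`), and one inner product per i suffices to notice it. Codewords and indices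
also make the points distinct, even if the vectors are not.

Greedy search through all words of length 24k finds at least 2^k codewords
(`two_pow_le_of_covering`, `codeLoop_run`). It takes about 2^(48k) steps, which is linear in n up to
logarithmic factors; this is where 48 comes from. A solver that saves a factor s^δ on each of about
(n/s)^2 pairs of blocks saves about n^(δ/48) in total; half of the exponent pays for the
polylogarithmic overhead, leaving n^(2 - δ/96) (`blocks_cost_le`).

The reduction is carried out as an actual machine program. Expressions are written as terms,
compiled with a verified cost bound (`RAMTerm.compile_run`). The given solver may address any cell,
so for pair number c it is confined to the cells base + c + a * M, with M the number of pairs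
(`RAMProg.embed_run`). Each call thus finds fresh zeros and cannot damage the input or the code. -/

/-! ### Total correctness with a cost bound -/

/-- Started in `s`, the program `p` halts at cost at most `B` in a state satisfying `Q`. -/
def RAMRun (p : RAMProg) (s : RAMState) (B : ℕ) (Q : RAMState → Prop) : Prop :=
  ∃ t s', RAMExec p s t s' ∧ t ≤ B ∧ Q s'

theorem RAMExec.loop_of_eq_zero {r : ℕ} {p : RAMProg} {s : RAMState} (h : s.reg r = 0) :
    RAMExec (.loop r p) s (1 + (s.reg r).size) s := by
  constructor
  exact h

namespace RAMRun

theorem mono {p : RAMProg} {s : RAMState} {B B' : ℕ} {Q Q' : RAMState → Prop}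
    (h : RAMRun p s B Q) (hB : B ≤ B') (hQ : ∀ s', Q s' → Q' s') : RAMRun p s B' Q' := by
  obtain ⟨t, s', h1, h2, h3⟩ := h
  exact ⟨t, s', h1, h2.trans hB, hQ _ h3⟩

theorem seq {p q : RAMProg} {s : RAMState} {B B' : ℕ} {Q R : RAMState → Prop}
    (hp : RAMRun p s B R) (hq : ∀ s', R s' → RAMRun q s' B' Q) :
    RAMRun (.seq p q) s (B + B') Q := by
  obtain ⟨t, s', h1, h2, h3⟩ := hp
  obtain ⟨t', s'', h1', h2', h3'⟩ := hq s' h3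
  exact ⟨_, _, .seq h1 h1', by omega, h3'⟩

theorem const {r k : ℕ} {s : RAMState} {B : ℕ} {Q : RAMState → Prop}
    (hB : 1 + k.size ≤ B) (hQ : Q (s.setReg r k)) : RAMRun (.const r k) s B Q :=
  ⟨_, _, .const r k s, hB, hQ⟩

theorem arith {o : ArithOp} {r a b : ℕ} {s : RAMState} {B : ℕ} {Q : RAMState → Prop}
    (hB : 1 + (s.reg a).size + (s.reg b).size ≤ B)
    (hQ : Q (s.setReg r (o.eval (s.reg a) (s.reg b)))) : RAMRun (.arith o r a b) s B Q :=
  ⟨_, _, .arith o r a b s, hB, hQ⟩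

theorem load {r a : ℕ} {s : RAMState} {B : ℕ} {Q : RAMState → Prop}
    (hB : 1 + (s.reg a).size + (s.mem (s.reg a)).size ≤ B)
    (hQ : Q (s.setReg r (s.mem (s.reg a)))) : RAMRun (.load r a) s B Q :=
  ⟨_, _, .load r a s, hB, hQ⟩

theorem store {a b : ℕ} {s : RAMState} {B : ℕ} {Q : RAMState → Prop}
    (hB : 1 + (s.reg a).size + (s.reg b).size ≤ B)
    (hQ : Q (s.setMem (s.reg a) (s.reg b))) : RAMRun (.store a b) s B Q :=
  ⟨_, _, .store a b s, hB, hQ⟩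

/-- A loop whose test register counts down to zero. -/
theorem loop {r : ℕ} {p : RAMProg} {B S : ℕ} {I : ℕ → RAMState → Prop}
    (hr : ∀ j s, I j s → s.reg r = j)
    (hstep : ∀ j s, j.succ.size ≤ S → I (j + 1) s → RAMRun p s B (I j)) (n : ℕ) :
    ∀ s, n.size ≤ S → I n s → RAMRun (.loop r p) s (n * (B + 1 + S) + 1) (I 0) := by
  induction n with
  | zero =>
    intro s _ hI
    have h0 := hr 0 s hI
    exact ⟨_, _, .loop_of_eq_zero h0, by simp [h0], hI⟩
  | succ n ih =>
    intro s hS hI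
    have h0 := hr _ s hI
    obtain ⟨t, s', h1, h2, h3⟩ := hstep n s hS hI
    obtain ⟨t', s'', h1', h2', h3'⟩ := ih s' ((Nat.size_le_size (Nat.le_succ n)).trans hS) h3
    refine ⟨_, _, .loop_step (by omega) h1 h1', ?_, h3'⟩
    rw [h0, Nat.succ_mul]
    have : (n + 1).size ≤ S := hS
    omega

end RAMRun

/-! ### Bit lengths of sums and products. -/

theorem Nat.size_add_le (a b : ℕ) : (a + b).size ≤ a.size + b.size := by
  rcases Nat.eq_zero_or_pos a with rfl | ha
  · simp
  rcases Nat.eq_zero_or_pos b with rfl | hb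
  · simp
  have h1 := Nat.size_pos.2 ha
  have h2 := Nat.size_pos.2 hb
  rw [Nat.size_le]
  -- x + y ≤ xy holds for x, y ≥ 2, which is why the zero cases were split off.
  calc a + b < 2 ^ a.size + 2 ^ b.size := Nat.add_lt_add (Nat.lt_size_self a) (Nat.lt_size_self b)
    _ ≤ 2 ^ (a.size + b.size) := by
      rw [pow_add]
      have e1 : 2 ^ 1 ≤ 2 ^ a.size := Nat.pow_le_pow_right (by norm_num) h1
      have e2 : 2 ^ 1 ≤ 2 ^ b.size := Nat.pow_le_pow_right (by norm_num) h2
      nlinarith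

theorem Nat.size_mul_le (a b : ℕ) : (a * b).size ≤ a.size + b.size := by
  rw [Nat.size_le, pow_add]
  exact Nat.mul_lt_mul'' (Nat.lt_size_self a) (Nat.lt_size_self b)

theorem ArithOp.size_eval_le (o : ArithOp) (a b : ℕ) : (o.eval a b).size ≤ a.size + b.size := by
  cases o with
  | add => exact Nat.size_add_le a b
  | sub => exact (Nat.size_le_size (Nat.sub_le a b)).trans (Nat.le_add_right _ _)
  | mul => exact Nat.size_mul_le a b
  | div => exact (Nat.size_le_size (Nat.div_le_self a b)).trans (Nat.le_add_right _ _)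

theorem Nat.size_self_le (a : ℕ) : a.size ≤ a := Nat.size_le.2 Nat.lt_two_pow_self

theorem Nat.size_sum_le {n B : ℕ} {f : ℕ → ℕ} (hf : ∀ i < n, (f i).size ≤ B) :
    (∑ i ∈ Finset.range n, f i).size ≤ n.size + B := by
  rcases Nat.eq_zero_or_pos n with rfl | hn
  · simp
  rw [Nat.size_le, pow_add]
  calc ∑ i ∈ Finset.range n, f i ≤ ∑ i ∈ Finset.range n, 2 ^ B :=
        Finset.sum_le_sum fun i hi =>
          (Nat.size_le.1 (hf i (Finset.mem_range.1 hi))).le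
    _ = n * 2 ^ B := by simp
    _ < _ := Nat.mul_lt_mul_of_pos_right (Nat.lt_size_self n) (by positivity)

/-! ### Terms

Terms over the variables `0, …, 31` (registers); the registers from `32` on hold intermediate
results. -/

inductive RAMTerm where
  | var (r : ℕ)
  | const (k : ℕ)
  | op (o : ArithOp) (a b : RAMTerm)
  | load (a : RAMTerm)
  | ite (c a b : RAMTerm)
  | pow2 (a : RAMTerm)
  /-- the sum of `b` over all values of `x` below `a`; `big` tells which of two bounds `a` obeys -/
  | sum (x : ℕ) (big : Bool) (a b : RAMTerm)

namespace RAMTerm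

def eval (mem : ℕ → ℕ) : RAMTerm → (ℕ → ℕ) → ℕ
  | var r, reg => reg r
  | const k, _ => k
  | op o a b, reg => o.eval (a.eval mem reg) (b.eval mem reg)
  | load a, reg => mem (a.eval mem reg)
  | ite c a b, reg => if c.eval mem reg ≠ 0 then a.eval mem reg else b.eval mem reg
  | pow2 a, reg => 2 ^ a.eval mem reg
  | sum x _ a b, reg =>
    ∑ i ∈ Finset.range (a.eval mem reg), b.eval mem (Function.update reg x i)

/-- The numbers met in evaluating a term are small: at most `W` bits in memory, exponents and
small ranges at most `W`, big ranges at most `N`. -/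
def Ok (W N : ℕ) (mem : ℕ → ℕ) : RAMTerm → (ℕ → ℕ) → Prop
  | var r, _ => r < 32
  | const _, _ => True
  | op _ a b, reg => a.Ok W N mem reg ∧ b.Ok W N mem reg
  | load a, reg => a.Ok W N mem reg ∧ (mem (a.eval mem reg)).size ≤ W
  | ite c a b, reg => c.Ok W N mem reg ∧
      (c.eval mem reg ≠ 0 → a.Ok W N mem reg) ∧ (c.eval mem reg = 0 → b.Ok W N mem reg)
  | pow2 a, reg => a.Ok W N mem reg ∧ a.eval mem reg ≤ W
  | sum x big a b, reg => x < 32 ∧ a.Ok W N mem reg ∧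
      a.eval mem reg ≤ (if big then N else W) ∧
      ∀ i < a.eval mem reg, b.Ok W N mem (Function.update reg x i)

/-- The value of a term has at most `width * (W + 1)` bits. -/
def width : RAMTerm → ℕ
  | var _ => 1
  | const k => k.size
  | op _ a b => a.width + b.width
  | load _ => 1
  | ite _ a b => a.width + b.width
  | pow2 _ => 1
  | sum _ _ _ b => 1 + b.width

/-- The result is left in register `τ`, and all registers from `τ` on are scratch space. A sum keeps
the rounds left in `τ`, the partial sum in `τ + 1` and the old value of its variable in `τ + 2`,
from where it is restored. -/
def compile : RAMTerm → ℕ → RAMProg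
  | var r, τ => .seq (.const τ 0) (.arith .add τ r τ)
  | const k, τ => .const τ k
  | op o a b, τ => .seq (a.compile τ) (.seq (b.compile (τ + 1)) (.arith o τ τ (τ + 1)))
  | load a, τ => .seq (a.compile τ) (.load τ τ)
  | ite c a b, τ => .seq (c.compile τ) (.cond τ (a.compile τ) (b.compile τ))
  | pow2 a, τ =>
    .seq (a.compile τ) (.seq (.const (τ + 1) 1) (.seq
      (.loop τ (.seq (.arith .add (τ + 1) (τ + 1) (τ + 1))
        (.seq (.const (τ + 2) 1) (.arith .sub τ τ (τ + 2)))))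
      (.seq (.const τ 0) (.arith .add τ τ (τ + 1)))))
  | sum x _ a b, τ =>
    .seq (a.compile τ) (.seq (.const (τ + 2) 0) (.seq (.arith .add (τ + 2) x (τ + 2))
      (.seq (.const (τ + 1) 0) (.seq (.const x 0) (.seq
        (.loop τ (.seq (b.compile (τ + 3)) (.seq (.arith .add (τ + 1) (τ + 1) (τ + 3))
          (.seq (.const (τ + 3) 1) (.seq (.arith .add x x (τ + 3)) (.arith .sub τ τ (τ + 3)))))))
        (.seq (.const x 0) (.seq (.arith .add x x (τ + 2))
          (.seq (.const τ 0) (.arith .add τ τ (τ + 1))))))))))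

/-- Follows `compile`, with the bit lengths of intermediate results replaced by `width * (W + 1)`.
Both branches of a conditional are charged, so that the bound depends on the term only. -/
def cost (W N : ℕ) : RAMTerm → ℕ
  | var _ => W + 2
  | const k => 1 + k.size
  | op _ a b => a.cost W N + (b.cost W N + (1 + a.width * (W + 1) + b.width * (W + 1)))
  | load a => a.cost W N + (1 + a.width * (W + 1) + W)
  | ite c a b => c.cost W N + (1 + c.width * (W + 1) + (a.cost W N + b.cost W N))
  | pow2 a => a.cost W N + (2 + (W * (2 * W + W + 9 + 1 + W) + 1 + (1 + (1 + (W + 1)))))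
  | sum _ big a b => a.cost W N + (1 + (1 + W + (1 + (1 +
      ((if big then N else W) * (b.cost W N + (1 + (1 + b.width) * (W + 1) + b.width * (W + 1)) +
        2 * W + 6 + 1 + W) + 1 + (1 + (1 + W + (1 + (1 + (1 + b.width) * (W + 1))))))))))

/-- An operation at most adds up bit lengths, and a sum adds the bit length of its range, at most
`W` even for big ranges. So the width does not depend on `W` or `N`, and costs stay polynomial in
`W`. -/
theorem size_eval_le {W N : ℕ} {mem : ℕ → ℕ} (hN : N.size ≤ W) (e : RAMTerm) :
    ∀ reg : ℕ → ℕ, (∀ r < 32, (reg r).size ≤ W) → e.Ok W N mem reg →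
      (e.eval mem reg).size ≤ e.width * (W + 1) := by
  induction e with
  | var r =>
    intro reg hr h
    simpa [width, eval] using (hr r h).trans (Nat.le_succ W)
  | const k =>
    intro reg _ _
    simp only [eval, width]
    exact Nat.le_mul_of_pos_right _ (by omega)
  | op o a b iha ihb =>
    intro reg hr h
    have := o.size_eval_le (a.eval mem reg) (b.eval mem reg)
    have := iha reg hr h.1
    have := ihb reg hr h.2
    simp only [eval, width, add_mul]
    omega
  | load a iha =>
    intro reg hr h
    have := h.2
    simp only [eval, width]
    omega
  | ite c a b ihc iha ihb =>
    intro reg hr h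
    simp only [eval, width, add_mul]
    split_ifs with hc
    · have := iha reg hr (h.2.1 hc)
      omega
    · have := ihb reg hr (h.2.2 (by simpa using hc))
      omega
  | pow2 a iha =>
    intro reg hr h
    have := h.2
    simp only [eval, width, Nat.size_pow]
    omega
  | sum x big a b iha ihb =>
    intro reg hr h
    obtain ⟨hx, ha, hc, hb⟩ := h
    have hcW : (a.eval mem reg).size ≤ W := by
      cases big
      · exact (Nat.size_self_le _).trans hc
      · exact (Nat.size_le_size hc).trans hN
    have := Nat.size_sum_le (n := a.eval mem reg) (B := b.width * (W + 1))
      (f := fun i => b.eval mem (Function.update reg x i)) (by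
        intro i hi
        refine ihb _ ?_ (hb i hi)
        intro r hr'
        rcases eq_or_ne r x with rfl | hne
        · simpa using (Nat.size_le_size hi.le).trans hcW
        · simpa [hne] using hr r hr')
    simp only [eval, width, add_mul]
    omega

/-- The preservation of all registers below `τ` drives the induction: a subterm compiled at a higher
register does not disturb results already computed. The valuation `reg` is separate from `s.reg`
because only the variables have to agree. -/
theorem compile_run {W N : ℕ} (hN : N.size ≤ W) (e : RAMTerm) :
    ∀ (τ : ℕ) (s : RAMState) (reg : ℕ → ℕ), 32 ≤ τ → (∀ r < 32, s.reg r = reg r) →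
      (∀ r < 32, (reg r).size ≤ W) → e.Ok W N s.mem reg →
      RAMRun (e.compile τ) s (e.cost W N) fun s' =>
        s'.mem = s.mem ∧ s'.reg τ = e.eval s.mem reg ∧ ∀ r < τ, s'.reg r = s.reg r := by
  induction e with
  | var r =>
    intro τ s reg hτ hs hW h
    have hr : r < 32 := h
    have hne : r ≠ τ := by omega
    refine (RAMRun.seq (B := 1) (B' := 1 + W)
      (R := fun s' => s' = s.setReg τ 0) (.const (by simp) rfl) ?_).mono
      (by simp only [cost]; omega) (fun _ h => h)
    rintro _ rfl
    refine .arith ?_ ⟨rfl, ?_, ?_⟩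
    · simpa [RAMState.setReg, hne, hs r hr] using hW r hr
    · simp [RAMState.setReg, hne, hs r hr, eval, ArithOp.eval]
    · intro q hq
      simp [RAMState.setReg, hq.ne]
  | const k =>
    intro τ s reg hτ hs hW h
    refine .const le_rfl ⟨rfl, by simp [RAMState.setReg, eval], ?_⟩
    intro q hq
    simp [RAMState.setReg, hq.ne]
  | op o a b iha ihb =>
    intro τ s reg hτ hs hW h
    refine .seq (iha τ s reg hτ hs hW h.1) ?_
    rintro s1 ⟨m1, e1, f1⟩
    refine .seq (ihb (τ + 1) s1 reg (by omega)
      (fun r hr => by rw [f1 r (by omega), hs r hr]) hW (by rw [m1]; exact h.2)) ?_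
    rintro s2 ⟨m2, e2, f2⟩
    have eτ : s2.reg τ = a.eval s.mem reg := by rw [f2 τ (by omega), e1]
    refine .arith ?_ ⟨by simp [RAMState.setReg, m2, m1], ?_, ?_⟩
    · rw [eτ, e2, m1]
      have := size_eval_le hN a reg hW h.1
      have := size_eval_le hN b reg hW h.2
      omega
    · simp [RAMState.setReg, eval, eτ, e2, m1]
    · intro q hq
      simp [RAMState.setReg, hq.ne, f2 q (by omega), f1 q hq]
  | load a iha =>
    intro τ s reg hτ hs hW h
    refine .seq (iha τ s reg hτ hs hW h.1) ?_
    rintro s1 ⟨m1, e1, f1⟩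
    refine .load ?_ ⟨by simp [RAMState.setReg, m1], ?_, ?_⟩
    · rw [e1, m1]
      have := size_eval_le hN a reg hW h.1
      have := h.2
      omega
    · simp [RAMState.setReg, eval, e1, m1]
    · intro q hq
      simp [RAMState.setReg, hq.ne, f1 q hq]
  | ite c a b ihc iha ihb =>
    intro τ s reg hτ hs hW h
    refine .seq (ihc τ s reg hτ hs hW h.1) ?_
    rintro s1 ⟨m1, e1, f1⟩
    have hsz := size_eval_le hN c reg hW h.1
    rw [← e1] at hsz
    have hs1 : ∀ r < 32, s1.reg r = reg r := fun r hr => by rw [f1 r (by omega), hs r hr]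
    by_cases hc : c.eval s.mem reg = 0
    · obtain ⟨t, s', x1, x2, x3, x4, x5⟩ :=
        ihb τ s1 reg hτ hs1 hW (by rw [m1]; exact h.2.2 hc)
      refine ⟨_, s', .cond_false (by rw [e1, hc]) x1, by omega, by rw [x3, m1], ?_, ?_⟩
      · rw [x4, m1, eval, if_neg (by simpa using hc)]
      · intro r hr
        rw [x5 r hr, f1 r hr]
    · obtain ⟨t, s', x1, x2, x3, x4, x5⟩ :=
        iha τ s1 reg hτ hs1 hW (by rw [m1]; exact h.2.1 hc)
      refine ⟨_, s', .cond_true (by rwa [e1]) x1, by omega, by rw [x3, m1], ?_, ?_⟩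
      · rw [x4, m1, eval, if_pos (by simpa using hc)]
      · intro r hr
        rw [x5 r hr, f1 r hr]
  | pow2 a iha =>
    intro τ s reg hτ hs hW h
    obtain ⟨ha, hv⟩ := h
    set v := a.eval s.mem reg with hvdef
    refine .seq (iha τ s reg hτ hs hW ha) ?_
    rintro s1 ⟨m1, e1, f1⟩
    refine .seq (R := fun s' => s' = s1.setReg (τ + 1) 1) (.const (by simp) rfl) ?_
    rintro _ rfl
    -- Here `j` counts the doublings still to be done.
    let I : ℕ → RAMState → Prop := fun j s' => s'.mem = s.mem ∧ s'.reg τ = j ∧ j ≤ v ∧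
      s'.reg (τ + 1) = 2 ^ (v - j) ∧ ∀ r < τ, s'.reg r = s.reg r
    have hvs : v.size ≤ W := (Nat.size_self_le _).trans hv
    refine .seq (((RAMRun.loop (I := I) (B := 2 * W + W + 9) (S := W) (fun j s h => h.2.1) ?_ v
      (s1.setReg (τ + 1) 1) hvs ?_)).mono ?_ (fun _ h => h)) ?_
    · rintro j s2 hj ⟨i1, i2, i3, i4, i5⟩
      have hp : (2 ^ (v - (j + 1))).size ≤ W := by rw [Nat.size_pow]; omega
      refine RAMRun.mono (.seq (R := fun s' => s' = s2.setReg (τ + 1) (2 ^ (v - j)))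
          (B := 1 + W + W) (.arith (by rw [i4]; omega) ?_)
        (B' := 2 + (1 + W + 1)) ?_) (by omega) (fun _ h => h)
      · rw [i4]
        simp only [ArithOp.eval]
        congr 1
        rw [show v - j = v - (j + 1) + 1 by omega, pow_succ]
        ring
      · rintro _ rfl
        refine .seq (R := fun s' => s' = (s2.setReg (τ + 1) (2 ^ (v - j))).setReg (τ + 2) 1)
          (.const (by simp) rfl) ?_
        rintro _ rfl
        refine .arith ?_ ⟨?_, ?_, ?_, ?_, ?_⟩
        · simp [RAMState.setReg, i2]
          exact hj
        · simpa [RAMState.setReg] using i1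
        · simp [RAMState.setReg, i2, ArithOp.eval]
        · omega
        · simp [RAMState.setReg]
        · intro r hr
          simp [RAMState.setReg, hr.ne, show r ≠ τ + 1 by omega, show r ≠ τ + 2 by omega, i5 r hr]
    · refine ⟨?_, ?_, le_rfl, ?_, ?_⟩
      · simpa [RAMState.setReg] using m1
      · simpa [RAMState.setReg] using e1
      · simp [RAMState.setReg]
      · intro r hr
        simp [RAMState.setReg, show r ≠ τ + 1 by omega, f1 r hr]
    · have := Nat.mul_le_mul_right (2 * W + W + 9 + 1 + W) hv
      omega
    · rintro s3 ⟨i1, i2, i3, i4, i5⟩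
      refine .seq (R := fun s' => s' = s3.setReg τ 0) (.const (by simp) rfl) ?_
      rintro _ rfl
      refine .arith ?_ ⟨by simpa [RAMState.setReg] using i1, ?_, ?_⟩
      · simp [RAMState.setReg, i4, Nat.size_pow]
        omega
      · simp [RAMState.setReg, i4, eval, ArithOp.eval, hvdef]
      · intro r hr
        simp [RAMState.setReg, hr.ne, i5 r hr]
  | sum x big a b iha ihb =>
    intro τ s reg hτ hs hW h
    have hsz := size_eval_le hN _ reg hW h
    obtain ⟨hx, ha, hc, hb⟩ := h
    set v := a.eval s.mem reg with hvdef
    have hxτ : x < τ := by omega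
    have hvs : v.size ≤ W := by
      cases big
      · exact (Nat.size_self_le _).trans hc
      · exact (Nat.size_le_size hc).trans hN
    set S : ℕ → ℕ := fun j => ∑ i ∈ Finset.range j, b.eval s.mem (Function.update reg x i) with hS
    have hSv : eval s.mem (sum x big a b) reg = S v := rfl
    -- Partial sums of natural numbers are below the full sum, so its bit bound serves for all of
    -- them.
    have hSmono : ∀ j ≤ v, (S j).size ≤ (1 + b.width) * (W + 1) := by
      intro j hj
      refine le_trans (Nat.size_le_size ?_) hsz
      rw [hSv]
      exact Finset.sum_le_sum_of_subset (Finset.range_mono hj)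
    refine .seq (iha τ s reg hτ hs hW ha) ?_
    rintro s1 ⟨m1, e1, f1⟩
    refine .seq (R := fun s' => s' = s1.setReg (τ + 2) 0) (.const (by simp) rfl) ?_
    rintro _ rfl
    have hx1 : s1.reg x = s.reg x := f1 x hxτ
    have hxW : (s.reg x).size ≤ W := by rw [hs x hx]; exact hW x hx
    -- With `j` rounds left, the summation variable has the value `v - j` and the first `v - j`
    -- summands have been added.
    let I : ℕ → RAMState → Prop := fun j s' => s'.mem = s.mem ∧ s'.reg τ = j ∧ j ≤ v ∧
      s'.reg (τ + 1) = S (v - j) ∧ s'.reg (τ + 2) = s.reg x ∧ s'.reg x = v - j ∧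
      ∀ r < τ, r ≠ x → s'.reg r = s.reg r
    refine .seq (R := fun s' => s'.mem = s.mem ∧ s'.reg τ = v ∧ s'.reg (τ + 2) = s.reg x ∧
      ∀ r < τ, s'.reg r = s.reg r) (.arith ?_ ⟨?_, ?_, ?_, ?_⟩) ?_
    · simp [RAMState.setReg, show x ≠ τ + 2 by omega, hx1]
      exact hxW
    · simpa [RAMState.setReg] using m1
    · simpa [RAMState.setReg] using e1
    · simp [RAMState.setReg, show x ≠ τ + 2 by omega, hx1, ArithOp.eval]
    · intro r hr
      simp [RAMState.setReg, show r ≠ τ + 2 by omega, f1 r hr]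
    rintro s2 ⟨g1, g2, g3, g4⟩
    refine .seq (R := fun s' => s' = s2.setReg (τ + 1) 0) (.const (by simp) rfl) ?_
    rintro _ rfl
    refine .seq (R := fun s' => s' = (s2.setReg (τ + 1) 0).setReg x 0) (.const (by simp) rfl) ?_
    rintro _ rfl
    refine .seq (((RAMRun.loop (I := I)
      (B := b.cost W N + (1 + (1 + b.width) * (W + 1) + b.width * (W + 1)) + 2 * W + 6) (S := W)
      (fun j s h => h.2.1) ?_ v _ hvs ?_)).mono ?_ (fun _ h => h)) ?_
    · rintro j s3 hj ⟨i1, i2, i3, i4, i5, i6, i7⟩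
      have hi : v - (j + 1) < v := by omega
      have hreg : ∀ r < 32, s3.reg r = Function.update reg x (v - (j + 1)) r := by
        intro r hr
        rcases eq_or_ne r x with rfl | hne
        · simpa using i6
        · simp [hne, i7 r (by omega) hne, hs r hr]
      have hregW : ∀ r < 32, (Function.update reg x (v - (j + 1)) r).size ≤ W := by
        intro r hr
        rcases eq_or_ne r x with rfl | hne
        · simpa using (Nat.size_le_size hi.le).trans hvs
        · simpa [hne] using hW r hr
      have hbk := hb _ hi
      refine RAMRun.mono (.seq (ihb (τ + 3) s3 _ (by omega) hreg hregW (by rw [i1]; exact hbk))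
        (B' := (1 + (1 + b.width) * (W + 1) + b.width * (W + 1)) +
          (2 + ((1 + W + 1) + (1 + W + 1)))) ?_)
        (by omega) (fun _ h => h)
      rintro s4 ⟨m4, e4, f4⟩
      rw [i1] at m4 e4
      have hS' : S (v - j) = S (v - (j + 1)) + s4.reg (τ + 3) := by
        rw [e4, show v - j = v - (j + 1) + 1 by omega]
        exact Finset.sum_range_succ _ _
      refine .seq (R := fun s' => s' = s4.setReg (τ + 1) (S (v - j))) (.arith ?_ ?_) ?_
      · rw [f4 (τ + 1) (by omega), i4, e4]
        have := hSmono (v - (j + 1)) (by omega)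
        have := size_eval_le hN b _ hregW hbk
        omega
      · rw [f4 (τ + 1) (by omega), i4, hS']
        rfl
      rintro _ rfl
      refine .seq (R := fun s' => s' = (s4.setReg (τ + 1) (S (v - j))).setReg (τ + 3) 1)
        (.const (by simp) rfl) ?_
      rintro _ rfl
      have hx4 : s4.reg x = v - (j + 1) := by rw [f4 x (by omega), i6]
      refine .seq (R := fun s' => s' =
        ((s4.setReg (τ + 1) (S (v - j))).setReg (τ + 3) 1).setReg x (v - j)) (.arith ?_ ?_) ?_
      · have : (v - (j + 1)).size ≤ W := (Nat.size_le_size hi.le).trans hvs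
        simp [RAMState.setReg, show x ≠ τ + 3 by omega, show x ≠ τ + 1 by omega, hx4]
        omega
      · simp only [RAMState.setReg, ArithOp.eval]
        congr 2
        simp [show x ≠ τ + 3 by omega, show x ≠ τ + 1 by omega, hx4]
        omega
      rintro _ rfl
      refine .arith ?_ ⟨?_, ?_, ?_, ?_, ?_, ?_, ?_⟩
      · simp [RAMState.setReg, show τ ≠ x by omega, show τ + 3 ≠ x by omega, f4 τ (by omega), i2]
        exact hj
      · simpa [RAMState.setReg] using m4
      · simp [RAMState.setReg, show τ ≠ x by omega, show τ + 3 ≠ x by omega, f4 τ (by omega), i2,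
          ArithOp.eval]
      · omega
      · simp [RAMState.setReg, show τ + 1 ≠ x by omega]
      · simp [RAMState.setReg, show τ + 2 ≠ x by omega, f4 (τ + 2) (by omega), i5]
      · simp [RAMState.setReg, hxτ.ne]
      · intro r hr hrx
        simp [RAMState.setReg, hrx, hr.ne, show r ≠ τ + 1 by omega, show r ≠ τ + 3 by omega,
          f4 r (by omega), i7 r hr hrx]
    · refine ⟨?_, ?_, le_rfl, ?_, ?_, ?_, ?_⟩
      · simpa [RAMState.setReg] using g1
      · simpa [RAMState.setReg, show τ ≠ x by omega] using g2
      · simp [RAMState.setReg, show τ + 1 ≠ x by omega, hS]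
      · simpa [RAMState.setReg, show τ + 2 ≠ x by omega] using g3
      · simp [RAMState.setReg]
      · intro r hr hrx
        simp [RAMState.setReg, hrx, show r ≠ τ + 1 by omega, g4 r hr]
    · have := Nat.mul_le_mul_right (b.cost W N +
        (1 + (1 + b.width) * (W + 1) + b.width * (W + 1)) + 2 * W + 6 + 1 + W) hc
      omega
    · rintro s5 ⟨i1, i2, i3, i4, i5, i6, i7⟩
      refine .seq (R := fun s' => s' = s5.setReg x 0) (.const (by simp) rfl) ?_
      rintro _ rfl
      refine .seq (R := fun s' => s'.mem = s.mem ∧ s'.reg (τ + 1) = S v ∧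
        ∀ r < τ, s'.reg r = s.reg r) (.arith ?_ ⟨?_, ?_, ?_⟩) ?_
      · simp [RAMState.setReg, show τ + 2 ≠ x by omega, i5]
        exact hxW
      · simpa [RAMState.setReg] using i1
      · simp [RAMState.setReg, show τ + 1 ≠ x by omega, i4]
      · intro r hr
        rcases eq_or_ne r x with rfl | hrx
        · simp [RAMState.setReg, show τ + 2 ≠ r by omega, i5, ArithOp.eval]
        · simp [RAMState.setReg, hrx, i7 r hr hrx]
      rintro s6 ⟨j1, j2, j3⟩
      refine .seq (R := fun s' => s' = s6.setReg τ 0) (.const (by simp) rfl) ?_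
      rintro _ rfl
      refine .arith ?_ ⟨?_, ?_, ?_⟩
      · have := hSmono v le_rfl
        simp [RAMState.setReg, j2]
        omega
      · simpa [RAMState.setReg] using j1
      · simp [RAMState.setReg, j2, ArithOp.eval, hSv]
      · intro r hr
        simp [RAMState.setReg, hr.ne, j3 r hr]

end RAMTerm

/-! ### Statements -/

/-- `s` and `σ` agree on the memory and on the variables. -/
def RAMState.Agree (s σ : RAMState) : Prop :=
  s.mem = σ.mem ∧ ∀ r < 32, s.reg r = σ.reg r

/-- All variables have at most `W` bits. -/
def RAMState.VarsLe (W : ℕ) (σ : RAMState) : Prop :=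
  ∀ r < 32, (σ.reg r).size ≤ W

/-- `RAMRun`, up to the values of the registers that are not variables. -/
def VarRun (p : RAMProg) (σ : RAMState) (B : ℕ) (Q : RAMState → Prop) : Prop :=
  ∀ s : RAMState, s.Agree σ → RAMRun p s B fun s' => ∃ σ', s'.Agree σ' ∧ Q σ'

theorem RAMState.VarsLe.setReg {W : ℕ} {σ : RAMState} (h : σ.VarsLe W) {r x : ℕ}
    (hx : x.size ≤ W) : (σ.setReg r x).VarsLe W := by
  intro q hq
  rcases eq_or_ne q r with rfl | hne
  · simpa [RAMState.setReg] using hx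
  · simpa [RAMState.setReg, hne] using h q hq

theorem RAMState.VarsLe.setMem {W : ℕ} {σ : RAMState} (h : σ.VarsLe W) {a x : ℕ} :
    (σ.setMem a x).VarsLe W := h

namespace RAMTerm

/-- `r := e` -/
def assign (r : ℕ) (e : RAMTerm) : RAMProg :=
  .seq (e.compile 32) (.seq (.const 33 0) (.arith .add r 32 33))

/-- `mem[a] := e` -/
def storeAt (a e : RAMTerm) : RAMProg :=
  .seq (a.compile 32) (.seq (e.compile 33) (.store 32 33))

/-- `for i < e do p`, where the register `c` counts down the remaining rounds -/
def forLt (c i : ℕ) (e : RAMTerm) (p : RAMProg) : RAMProg :=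
  .seq (e.assign c) (.seq (.const i 0) (.loop c
    (.seq p (.seq (.const 32 1) (.seq (.arith .add i i 32) (.arith .sub c c 32))))))

def assignCost (W N : ℕ) (e : RAMTerm) : ℕ := e.cost W N + (1 + (1 + e.width * (W + 1)))

def storeCost (W N : ℕ) (a e : RAMTerm) : ℕ :=
  a.cost W N + (e.cost W N + (1 + a.width * (W + 1) + e.width * (W + 1)))

end RAMTerm

namespace VarRun

variable {W N : ℕ} {σ : RAMState} {Q R : RAMState → Prop}

theorem mono {p : RAMProg} {B B' : ℕ} (h : VarRun p σ B R) (hB : B ≤ B')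
    (hQ : ∀ σ', R σ' → Q σ') : VarRun p σ B' Q := fun s hs =>
  (h s hs).mono hB fun _ ⟨σ', h1, h2⟩ => ⟨σ', h1, hQ _ h2⟩

theorem seq {p q : RAMProg} {B B' : ℕ} (hp : VarRun p σ B R)
    (hq : ∀ σ', R σ' → VarRun q σ' B' Q) : VarRun (.seq p q) σ (B + B') Q := fun s hs =>
  .seq (hp s hs) fun s' ⟨σ', h1, h2⟩ => hq σ' h2 s' h1

theorem assign {r : ℕ} {e : RAMTerm} (hr : r < 32) (hN : N.size ≤ W) (hσ : σ.VarsLe W)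
    (he : e.Ok W N σ.mem σ.reg) (hQ : Q (σ.setReg r (e.eval σ.mem σ.reg))) :
    VarRun (e.assign r) σ (e.assignCost W N) Q := by
  rintro s ⟨hm, hr'⟩
  have hsz := e.size_eval_le hN σ.reg hσ he
  refine .seq (e.compile_run hN 32 s σ.reg le_rfl hr' hσ (by rwa [hm])) ?_
  rintro s1 ⟨m1, e1, f1⟩
  refine .seq (R := fun s' => s' = s1.setReg 33 0) (.const (by simp) rfl) ?_
  rintro _ rfl
  refine .arith ?_ ⟨_, ⟨?_, ?_⟩, hQ⟩
  · simpa [RAMState.setReg, e1, hm] using hsz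
  · simp [RAMState.setReg, m1, hm]
  · intro q hq
    rcases eq_or_ne q r with rfl | hne
    · simp [RAMState.setReg, e1, hm, ArithOp.eval]
    · simp [RAMState.setReg, hne, show q ≠ 33 by omega, f1 q (by omega), hr' q hq]

theorem storeAt {a e : RAMTerm} (hN : N.size ≤ W) (hσ : σ.VarsLe W)
    (ha : a.Ok W N σ.mem σ.reg) (he : e.Ok W N σ.mem σ.reg)
    (hQ : Q (σ.setMem (a.eval σ.mem σ.reg) (e.eval σ.mem σ.reg))) :
    VarRun (a.storeAt e) σ (a.storeCost W N e) Q := by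
  rintro s ⟨hm, hr'⟩
  have hsz := e.size_eval_le hN σ.reg hσ he
  have hsza := a.size_eval_le hN σ.reg hσ ha
  refine .seq (a.compile_run hN 32 s σ.reg le_rfl hr' hσ (by rwa [hm])) ?_
  rintro s1 ⟨m1, e1, f1⟩
  refine .seq (e.compile_run hN 33 s1 σ.reg (by norm_num)
    (fun r hr => by rw [f1 r hr, hr' r hr]) hσ (by rwa [m1, hm])) ?_
  rintro s2 ⟨m2, e2, f2⟩
  have e3 : s2.reg 32 = a.eval σ.mem σ.reg := by rw [f2 32 (by norm_num), e1, hm]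
  rw [m1, hm] at e2
  refine .store ?_ ⟨_, ⟨?_, ?_⟩, hQ⟩
  · rw [e3, e2]
    omega
  · simp [RAMState.setMem, m2, m1, hm, e3, e2]
  · intro q hq
    simp [RAMState.setMem, f2 q (by omega), f1 q hq, hr' q hq]

/-- The invariant is indexed by the rounds already done, which is also the value of `i`. The body
must leave `i` and `c` as they were; the loop itself then updates both. -/
theorem forLt {c i B : ℕ} {e : RAMTerm} {p : RAMProg} (I : ℕ → RAMState → Prop)
    (hc : c < 32) (hi : i < 32) (hci : c ≠ i)
    (hN : N.size ≤ W) (hσ : σ.VarsLe W) (he : e.Ok W N σ.mem σ.reg)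
    {v : ℕ} (hv : e.eval σ.mem σ.reg = v) (hvW : v.size ≤ W)
    (h0 : I 0 ((σ.setReg c v).setReg i 0))
    (hstep : ∀ j < v, ∀ σ' : RAMState, I j σ' → σ'.reg i = j → σ'.reg c = v - j →
      VarRun p σ' B fun σ'' => σ''.reg i = j ∧ σ''.reg c = v - j ∧
        I (j + 1) ((σ''.setReg i (j + 1)).setReg c (v - (j + 1))))
    (hQ : ∀ σ', I v σ' → Q σ') :
    VarRun (e.forLt c i p) σ (e.assignCost W N + (1 + (v * (B + (7 + 3 * W)) + 1))) Q := by
  subst hv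
  set v := e.eval σ.mem σ.reg with hvdef
  refine .seq (.assign (Q := fun σ' => σ' = σ.setReg c v) hc hN hσ he rfl) ?_
  rintro _ rfl
  intro s hs
  refine .seq (R := fun s' => s'.Agree ((σ.setReg c v).setReg i 0)) (.const (by simp) ?_) ?_
  · refine ⟨hs.1, fun r hr => ?_⟩
    rcases eq_or_ne r i with rfl | hne
    · simp [RAMState.setReg]
    · simpa [RAMState.setReg, hne] using hs.2 r hr
  intro s1 hs1
  -- `RAMRun.loop` counts the rounds left, so the index of `I` is reversed.
  let J : ℕ → RAMState → Prop := fun j s' => j ≤ v ∧ s'.reg c = j ∧ ∃ σ', s'.Agree σ' ∧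
    σ'.reg i = v - j ∧ I (v - j) σ'
  refine RAMRun.mono (.loop (I := J) (B := B + (2 + (1 + W + 1 + (1 + W + 1)))) (S := W)
    (fun j s h => h.2.1) ?_ v s1 hvW ?_) ?_ ?_
  · rintro j s2 hj ⟨i1, i2, σ2, i3, i4, i5⟩
    have hσ2c : σ2.reg c = v - (v - (j + 1)) := by rw [← i3.2 c hc, i2]; omega
    refine .seq (hstep _ (by omega) σ2 i5 i4 hσ2c s2 i3) ?_
    rintro s3 ⟨σ3, k1, k2, k3, k4⟩
    have e1 : s3.reg i = v - (j + 1) := by rw [k1.2 i hi, k2]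
    have e2 : s3.reg c = j + 1 := by rw [k1.2 c hc, k3]; omega
    refine .seq (R := fun s' => s' = s3.setReg 32 1) (.const (by simp) rfl) ?_
    rintro _ rfl
    refine .seq (R := fun s' => s' = (s3.setReg 32 1).setReg i (v - j)) (.arith ?_ ?_) ?_
    · have : (v - (j + 1)).size ≤ W := (Nat.size_le_size (Nat.sub_le _ _)).trans hvW
      simp [RAMState.setReg, hi.ne, e1]
      omega
    · congr 1
      simp [RAMState.setReg, hi.ne, e1, ArithOp.eval]
      omega
    rintro _ rfl
    refine .arith ?_ ⟨by omega, ?_, (σ3.setReg i (v - j)).setReg c j, ⟨?_, ?_⟩, ?_, ?_⟩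
    · simp [RAMState.setReg, hc.ne, hi.ne', hci, e2]
      exact hj
    · simp [RAMState.setReg, hc.ne, hi.ne', hci, e2, ArithOp.eval]
    · simpa [RAMState.setReg] using k1.1
    · intro r hr
      rcases eq_or_ne r c with rfl | hrc
      · simp [RAMState.setReg, hc.ne, hi.ne', hci, e2, ArithOp.eval]
      rcases eq_or_ne r i with rfl | hri
      · simp [RAMState.setReg, hrc]
      simp [RAMState.setReg, hrc, hri, hr.ne, k1.2 r hr]
    · simp [RAMState.setReg, hci.symm]
    · have h1 : v - (j + 1) + 1 = v - j := by omega
      have h2 : v - (v - j) = j := by omega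
      rwa [h1, h2] at k4
  · refine ⟨le_rfl, ?_, _, hs1, ?_, ?_⟩
    · rw [hs1.2 c hc]
      simp [RAMState.setReg, hci]
    · simp [RAMState.setReg]
    · simpa using h0
  · have : B + (2 + (1 + W + 1 + (1 + W + 1))) + 1 + W = B + (7 + 3 * W) := by ring
    rw [this]
  · rintro s' ⟨_, _, σ', a1, _, a2⟩
    exact ⟨σ', a1, hQ σ' (by simpa using a2)⟩

end VarRun

/-! ### Running a program in a part of the memory -/

namespace RAMProg

/-- `p` mentions only registers below `p.regBound`. -/
def regBound : RAMProg → ℕ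
  | const r _ => r + 1
  | arith _ r a b => r + a + b + 1
  | load r a => r + a + 1
  | store a b => a + b + 1
  | seq p q => p.regBound + q.regBound
  | cond r p q => r + 1 + p.regBound + q.regBound
  | loop r p => r + 1 + p.regBound

/-- `p` with register `r` moved to `33 + r` and cell `a` moved to `b + a * m`, where `m`, `b` are
the contents of the registers `mr`, `br`. -/
def embed (mr br : ℕ) : RAMProg → RAMProg
  | const r k => const (33 + r) k
  | arith o r a b => arith o (33 + r) (33 + a) (33 + b)
  | load r a => .seq (.arith .mul 32 (33 + a) mr) (.seq (.arith .add 32 32 br) (.load (33 + r) 32))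
  | store a b =>
    .seq (.arith .mul 32 (33 + a) mr) (.seq (.arith .add 32 32 br) (.store 32 (33 + b)))
  | seq p q => .seq (p.embed mr br) (q.embed mr br)
  | cond r p q => .cond (33 + r) (p.embed mr br) (q.embed mr br)
  | loop r p => .loop (33 + r) (p.embed mr br)

def clearRegs : ℕ → RAMProg
  | 0 => .const 32 0
  | n + 1 => .seq (clearRegs n) (.const (33 + n) 0)

/-- `p.embed`, started with cleared registers -/
def call (mr br : ℕ) (p : RAMProg) : RAMProg := .seq (clearRegs p.regBound) (p.embed mr br)

end RAMProg

/-- A solver is only known to work when started with zero registers, while here it is called many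
times; so its registers are cleared before each call. -/
theorem RAMProg.clearRegs_run (n : ℕ) (s : RAMState) :
    RAMRun (clearRegs n) s (n + 1) fun s' => s'.mem = s.mem ∧ (∀ r < 32, s'.reg r = s.reg r) ∧
      ∀ r < n, s'.reg (33 + r) = 0 := by
  induction n with
  | zero =>
    refine .const (by simp) ⟨rfl, fun r hr => ?_, by simp⟩
    simp [RAMState.setReg, hr.ne]
  | succ n ih =>
    refine .seq ih ?_
    rintro s1 ⟨h1, h2, h3⟩
    refine .const (by simp) ⟨by simpa [RAMState.setReg] using h1, fun r hr => ?_, fun r hr => ?_⟩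
    · simp [RAMState.setReg, show r ≠ 33 + n by omega, h2 r hr]
    · rcases eq_or_ne r n with rfl | hne
      · simp [RAMState.setReg]
      · simp [RAMState.setReg, hne, h3 r (by omega)]

/-- `S` represents `s`, for `p.embed`. -/
structure RAMState.Embeds (B m b : ℕ) (s S : RAMState) : Prop where
  reg : ∀ r < B, S.reg (33 + r) = s.reg r
  mem : ∀ a, S.mem (b + a * m) = s.mem a

theorem RAMState.Embeds.setReg {B m b r x : ℕ} {s S : RAMState} (h : s.Embeds B m b S) :
    (s.setReg r x).Embeds B m b (S.setReg (33 + r) x) := by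
  refine ⟨fun q hq => ?_, fun a => by simpa [RAMState.setReg] using h.mem a⟩
  rcases eq_or_ne q r with rfl | hne
  · simp [RAMState.setReg]
  · simp [RAMState.setReg, hne, h.reg q hq]

theorem RAMState.Embeds.setTmp {B m b x : ℕ} {s S : RAMState} (h : s.Embeds B m b S) :
    s.Embeds B m b (S.setReg 32 x) := by
  refine ⟨fun q hq => ?_, fun a => by simpa [RAMState.setReg] using h.mem a⟩
  simp [RAMState.setReg, show 33 + q ≠ 32 by omega, h.reg q hq]

theorem RAMState.Embeds.setMem {B m b a x : ℕ} {s S : RAMState} (h : s.Embeds B m b S)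
    (hm : 0 < m) : (s.setMem a x).Embeds B m b (S.setMem (b + a * m) x) := by
  refine ⟨fun q hq => h.reg q hq, fun c => ?_⟩
  rcases eq_or_ne c a with rfl | hne
  · simp [RAMState.setMem]
  · have : c * m ≠ a * m := fun h => hne (Nat.eq_of_mul_eq_mul_right hm h)
    simp [RAMState.setMem, hne, this, h.mem c]

/-- A memory access at an address of x bits becomes a multiplication, an addition and an access at
an address of at most x + 2W bits. The total is at most 5W + 3 + 3x plus the length of the datum,
hence the factor 5W + 3. Only cells in the progression b + c * m are ever written. -/
theorem RAMProg.embed_run {B W m b mr br : ℕ} (hmr : mr < 32) (hbr : br < 32) (hm : 0 < m)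
    (hmW : m.size ≤ W) (hbW : b.size ≤ W) {p : RAMProg} {s s' : RAMState} {t : ℕ}
    (h : RAMExec p s t s') : p.regBound ≤ B → ∀ S : RAMState, s.Embeds B m b S →
      S.reg mr = m → S.reg br = b →
      RAMRun (p.embed mr br) S ((5 * W + 3) * t) fun S' => s'.Embeds B m b S' ∧
        (∀ r < 32, S'.reg r = S.reg r) ∧ ∀ a, (∀ c, a ≠ b + c * m) → S'.mem a = S.mem a := by
  have hF : ∀ x y t : ℕ, y ≤ (5 * W + 3) * t → 1 + x + y ≤ (5 * W + 3) * (1 + x + t) := by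
    intro x y t h
    nlinarith [Nat.zero_le (W * x), Nat.zero_le W, Nat.zero_le x]
  have hF' : ∀ x : ℕ, x ≤ (5 * W + 3) * x := fun x => Nat.le_mul_of_pos_left _ (by omega)
  induction h with
  | const r k s =>
    intro hB S hS hM hb
    refine .const (hF' _) ⟨hS.setReg, fun q hq => ?_, fun _ _ => rfl⟩
    simp [RAMState.setReg, show q ≠ 33 + r by omega]
  | arith o r x y s =>
    intro hB S hS hM hb
    simp only [regBound] at hB
    refine .arith ?_ ⟨?_, fun q hq => ?_, fun _ _ => rfl⟩
    · rw [hS.reg x (by omega), hS.reg y (by omega)]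
      exact hF' _
    · rw [hS.reg x (by omega), hS.reg y (by omega)]
      exact hS.setReg
    · simp [RAMState.setReg, show q ≠ 33 + r by omega]
  | load r x s =>
    intro hB S hS hM hb
    simp only [regBound] at hB
    have hx := hS.reg x (by omega)
    have s1 := Nat.size_mul_le (s.reg x) m
    have s2 := Nat.size_add_le (s.reg x * m) b
    refine RAMRun.mono (.seq (B := 1 + (s.reg x).size + W) (B' := (1 + ((s.reg x).size + W) + W) +
      (1 + ((s.reg x).size + W + W) + (s.mem (s.reg x)).size))
      (R := fun S' => S' = S.setReg 32 (s.reg x * m)) (.arith ?_ ?_) ?_) ?_ (fun _ h => h)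
    · rw [hx, hM]; omega
    · rw [hx, hM]; rfl
    · rintro _ rfl
      refine .seq (R := fun S' => S' = (S.setReg 32 (s.reg x * m)).setReg 32 (b + s.reg x * m))
        (.arith ?_ ?_) ?_
      · simp [RAMState.setReg, hbr.ne, hb]; omega
      · simp [RAMState.setReg, hbr.ne, hb, ArithOp.eval, add_comm]
      rintro _ rfl
      have hv : S.mem (b + s.reg x * m) = s.mem (s.reg x) := hS.mem _
      refine .load ?_ ⟨?_, fun q hq => ?_, fun _ _ => rfl⟩
      · simp only [RAMState.setReg, Function.update_self, hv]
        rw [add_comm b]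
        omega
      · have := (hS.setTmp (x := s.reg x * m)).setTmp (x := b + s.reg x * m) |>.setReg
          (r := r) (x := s.mem (s.reg x))
        simpa [RAMState.setReg, hv] using this
      · simp [RAMState.setReg, show q ≠ 33 + r by omega, hq.ne]
    · nlinarith [Nat.zero_le (W * (s.reg x).size), Nat.zero_le (W * (s.mem (s.reg x)).size)]
  | store x y s =>
    intro hB S hS hM hb
    simp only [regBound] at hB
    have hx := hS.reg x (by omega)
    have hy := hS.reg y (by omega)
    have s1 := Nat.size_mul_le (s.reg x) m
    have s2 := Nat.size_add_le (s.reg x * m) b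
    refine RAMRun.mono (.seq (B := 1 + (s.reg x).size + W) (B' := (1 + ((s.reg x).size + W) + W) +
      (1 + ((s.reg x).size + W + W) + (s.reg y).size))
      (R := fun S' => S' = S.setReg 32 (s.reg x * m)) (.arith ?_ ?_) ?_) ?_ (fun _ h => h)
    · rw [hx, hM]; omega
    · rw [hx, hM]; rfl
    · rintro _ rfl
      refine .seq (R := fun S' => S' = (S.setReg 32 (s.reg x * m)).setReg 32 (b + s.reg x * m))
        (.arith ?_ ?_) ?_
      · simp [RAMState.setReg, hbr.ne, hb]; omega
      · simp [RAMState.setReg, hbr.ne, hb, ArithOp.eval, add_comm]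
      rintro _ rfl
      have hy' : ((S.setReg 32 (s.reg x * m)).setReg 32 (b + s.reg x * m)).reg (33 + y) =
          s.reg y := by
        simp [RAMState.setReg, show 33 + y ≠ 32 by omega, hy]
      have hx' : ((S.setReg 32 (s.reg x * m)).setReg 32 (b + s.reg x * m)).reg 32 =
          b + s.reg x * m := by
        simp [RAMState.setReg]
      refine .store ?_ ⟨?_, fun q hq => ?_, fun a ha => ?_⟩
      · rw [hx', hy', add_comm b]
        omega
      · rw [hx', hy']
        exact ((hS.setTmp).setTmp).setMem hm
      · simp [RAMState.setReg, RAMState.setMem, hq.ne]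
      · rw [hx']
        simp [RAMState.setReg, RAMState.setMem, ha (s.reg x)]
    · nlinarith [Nat.zero_le (W * (s.reg x).size), Nat.zero_le (W * (s.reg y).size)]
  | seq _ _ ih1 ih2 =>
    intro hB S hS hM hb
    simp only [regBound] at hB
    rw [mul_add]
    refine .seq (ih1 (by omega) S hS hM hb) ?_
    rintro S1 ⟨h1, h2, h3⟩
    refine (ih2 (by omega) S1 h1 (by rw [h2 _ hmr, hM]) (by rw [h2 _ hbr, hb])).mono le_rfl ?_
    rintro S2 ⟨k1, k2, k3⟩
    exact ⟨k1, fun r hr => by rw [k2 r hr, h2 r hr], fun a ha => by rw [k3 a ha, h3 a ha]⟩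
  | @cond_true r _ _ s _ _ hne _ ih =>
    intro hB S hS hM hb
    simp only [regBound] at hB
    have hr := hS.reg r (by omega)
    obtain ⟨t', S', h1, h2, h3⟩ := ih (by omega) S hS hM hb
    exact ⟨_, S', .cond_true (by rwa [hr]) h1, by rw [hr]; exact hF _ _ _ h2, h3⟩
  | @cond_false r _ _ s _ _ he _ ih =>
    intro hB S hS hM hb
    simp only [regBound] at hB
    have hr := hS.reg r (by omega)
    obtain ⟨t', S', h1, h2, h3⟩ := ih (by omega) S hS hM hb
    exact ⟨_, S', .cond_false (by rwa [hr]) h1, by rw [hr]; exact hF _ _ _ h2, h3⟩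
  | @loop_step r p s s1 s2 t1 t2 hne _ _ ih1 ih2 =>
    intro hB S hS hM hb
    have hB' := hB
    simp only [regBound] at hB
    have hr := hS.reg r (by omega)
    obtain ⟨t', S', h1, h2, h3, h4, h5⟩ := ih1 (by omega) S hS hM hb
    obtain ⟨t'', S'', k1, k2, k3, k4, k5⟩ := ih2 hB' S' h3 (by rw [h4 _ hmr, hM])
      (by rw [h4 _ hbr, hb])
    refine ⟨_, S'', .loop_step (by rwa [hr]) h1 k1, ?_, k3,
      fun r hr => by rw [k4 r hr, h4 r hr], fun a ha => by rw [k5 a ha, h5 a ha]⟩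
    rw [hr, mul_add (5 * W + 3) (1 + _ + t1)]
    exact Nat.add_le_add (hF _ _ _ h2) k2
  -- The remaining case is a loop whose test register is zero.
  | _ =>
    rename_i r _ s he
    intro hB S hS hM hb
    simp only [regBound] at hB
    have hr := hS.reg r (by omega)
    exact ⟨_, S, .loop_of_eq_zero (by rwa [hr]), by rw [hr]; exact hF' _, hS, fun _ _ => rfl,
      fun _ _ => rfl⟩

theorem VarRun.call {W m b mr br : ℕ} {σ : RAMState} {Q : RAMState → Prop} (hmr : mr < 32)
    (hbr : br < 32) (hm : 0 < m) (hσ : σ.VarsLe W) (hσm : σ.reg mr = m) (hσb : σ.reg br = b)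
    {p : RAMProg} {s s' : RAMState} {t : ℕ}
    (h : RAMExec p s t s') (hs : ∀ r, s.reg r = 0) (hmem : ∀ a, σ.mem (b + a * m) = s.mem a)
    (hQ : ∀ mem, (∀ a, mem (b + a * m) = s'.mem a) →
      (∀ a, (∀ c, a ≠ b + c * m) → mem a = σ.mem a) → Q ⟨σ.reg, mem⟩) :
    VarRun (p.call mr br) σ (p.regBound + 1 + (5 * W + 3) * t) Q := by
  rintro S ⟨hS1, hS2⟩
  refine .seq (RAMProg.clearRegs_run p.regBound S) ?_
  rintro S1 ⟨h1, h2, h3⟩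
  refine (RAMProg.embed_run (B := p.regBound) hmr hbr hm (hσm ▸ hσ mr hmr) (hσb ▸ hσ br hbr)
    h le_rfl S1 ⟨fun r hr => by rw [h3 r hr, hs], fun a => by rw [h1, hS1, hmem]⟩
    (by rw [h2 _ hmr, hS2 _ hmr, hσm]) (by rw [h2 _ hbr, hS2 _ hbr, hσb])).mono le_rfl ?_
  rintro S2 ⟨k1, k2, k3⟩
  refine ⟨⟨σ.reg, S2.mem⟩, ⟨rfl, fun r hr => ?_⟩, hQ _ k1.mem fun a ha => ?_⟩
  · rw [k2 r hr, h2 r hr, hS2 r hr]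
  · rw [k3 a ha, h1, hS1]

/-! ### Polynomial cost bounds -/

/-- `F W N` is bounded by a polynomial in `W` times `N ^ g`. -/
def PolyBounded (g : ℕ) (F : ℕ → ℕ → ℕ) : Prop :=
  ∃ c, ∀ W N, 1 ≤ N → F W N ≤ c * (W + 1) ^ c * N ^ g

namespace PolyBounded

variable {g h : ℕ} {F G : ℕ → ℕ → ℕ}

theorem of_le (c : ℕ) (hF : ∀ W N, F W N ≤ c * (W + 1) ^ c) : PolyBounded 0 F :=
  ⟨c, fun W N _ => by simpa using hF W N⟩

theorem const (k : ℕ) : PolyBounded 0 fun _ _ => k :=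
  of_le k fun W _ => Nat.le_mul_of_pos_right _ (by positivity)

theorem fst : PolyBounded 0 fun W _ => W := of_le 1 fun W _ => by simp

theorem snd : PolyBounded 1 fun _ N => N :=
  ⟨1, fun W N _ => by simpa using Nat.le_mul_of_pos_left N (by positivity)⟩

theorem weaken (hF : PolyBounded g F) (hg : g ≤ h) : PolyBounded h F := by
  obtain ⟨c, hc⟩ := hF
  exact ⟨c, fun W N hN => (hc W N hN).trans
    (Nat.mul_le_mul_left _ (Nat.pow_le_pow_right hN hg))⟩

theorem add (hF : PolyBounded g F) (hG : PolyBounded g G) :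
    PolyBounded g fun W N => F W N + G W N := by
  obtain ⟨c, hc⟩ := hF
  obtain ⟨d, hd⟩ := hG
  refine ⟨c + d, fun W N hN => (Nat.add_le_add (hc W N hN) (hd W N hN)).trans ?_⟩
  have h1 : (W + 1) ^ c ≤ (W + 1) ^ (c + d) := Nat.pow_le_pow_right (by omega) (by omega)
  have h2 : (W + 1) ^ d ≤ (W + 1) ^ (c + d) := Nat.pow_le_pow_right (by omega) (by omega)
  rw [add_mul, add_mul]
  gcongr

theorem mul (hF : PolyBounded g F) (hG : PolyBounded h G) :
    PolyBounded (g + h) fun W N => F W N * G W N := by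
  obtain ⟨c, hc⟩ := hF
  obtain ⟨d, hd⟩ := hG
  refine ⟨c * d + (c + d), fun W N hN => (Nat.mul_le_mul (hc W N hN) (hd W N hN)).trans ?_⟩
  have h1 : (W + 1) ^ (c + d) ≤ (W + 1) ^ (c * d + (c + d)) :=
    Nat.pow_le_pow_right (by omega) (by omega)
  calc c * (W + 1) ^ c * N ^ g * (d * (W + 1) ^ d * N ^ h)
      = (c * d) * (W + 1) ^ (c + d) * N ^ (g + h) := by rw [pow_add, pow_add]; ring
    _ ≤ _ := by gcongr; omega

end PolyBounded

namespace RAMTerm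

/-- The number of nested big sums. -/
def bigDepth : RAMTerm → ℕ
  | var _ => 0
  | const _ => 0
  | op _ a b => max a.bigDepth b.bigDepth
  | load a => a.bigDepth
  | ite c a b => max c.bigDepth (max a.bigDepth b.bigDepth)
  | pow2 a => a.bigDepth
  | sum _ big a b => max a.bigDepth (bif big then 1 + b.bigDepth else b.bigDepth)

/-- Only a big sum multiplies the cost by `N`; every other construct adds costs or multiplies them
by a polynomial in `W`. -/
theorem polyBounded_cost (e : RAMTerm) : PolyBounded e.bigDepth fun W N => e.cost W N := by
  have hwid : ∀ (g k : ℕ), PolyBounded g fun W _ => k * (W + 1) := fun g k =>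
    ((PolyBounded.const k).mul (PolyBounded.fst.add (.const 1))).weaken (Nat.zero_le g)
  have hcon : ∀ (g k : ℕ), PolyBounded g fun _ _ => k := fun g k =>
    (PolyBounded.const k).weaken (Nat.zero_le g)
  have hW : ∀ g : ℕ, PolyBounded g fun W _ => W := fun g => PolyBounded.fst.weaken (Nat.zero_le g)
  induction e with
  | var r => exact PolyBounded.fst.add (.const 2)
  | const k => exact .const _
  | op o a b iha ihb =>
    exact (iha.weaken (le_max_left _ _)).add ((ihb.weaken (le_max_right _ _)).add
      (((hcon _ 1).add (hwid _ _)).add (hwid _ _)))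
  | load a iha => exact iha.add (((hcon _ 1).add (hwid _ _)).add (hW _))
  | ite c a b ihc iha ihb =>
    exact (ihc.weaken (le_max_left _ _)).add (((hcon _ 1).add (hwid _ _)).add
      ((iha.weaken ((le_max_left _ _).trans (le_max_right _ _))).add
        (ihb.weaken ((le_max_right _ _).trans (le_max_right _ _)))))
  | pow2 a iha =>
    have h2 : PolyBounded 0 fun W _ => W * (2 * W + W + 9 + 1 + W) :=
      (hW 0).mul (h := 0) ((((((hcon 0 2).mul (h := 0) (hW 0)).add (hW 0)).add (hcon 0 9)).add
        (hcon 0 1)).add (hW 0))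
    exact iha.add ((hcon _ 2).add (((h2.weaken (Nat.zero_le _)).add (hcon _ 1)).add
      ((hcon _ 1).add ((hcon _ 1).add ((hW _).add (hcon _ 1))))))
  | sum x big a b iha ihb =>
    refine (iha.weaken (le_max_left _ _)).add ((hcon _ 1).add (((hcon _ 1).add (hW _)).add
      ((hcon _ 1).add ((hcon _ 1).add (PolyBounded.add (PolyBounded.add ?_ (hcon _ 1))
        ((hcon _ 1).add (((hcon _ 1).add (hW _)).add ((hcon _ 1).add
          (((hcon _ 1)).add (hwid _ _))))))))))
    have hbody : PolyBounded b.bigDepth fun W N =>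
        b.cost W N + (1 + (1 + b.width) * (W + 1) + b.width * (W + 1)) + 2 * W + 6 + 1 + W :=
      ((((ihb.add (((hcon _ 1).add (hwid _ _)).add (hwid _ _))).add
        ((((hcon 0 2).mul (hW 0)).weaken (Nat.zero_le _)))).add (hcon _ 6)).add (hcon _ 1)).add
        (hW _)
    cases big
    · exact (((hW 0).mul hbody).weaken (h := max a.bigDepth b.bigDepth) (by simp))
    · exact ((PolyBounded.snd.mul hbody).weaken (h := max a.bigDepth (1 + b.bigDepth)) (by simp))

theorem polyBounded_assignCost (e : RAMTerm) :
    PolyBounded e.bigDepth fun W N => e.assignCost W N :=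
  e.polyBounded_cost.add (((PolyBounded.const 1).add ((PolyBounded.const 1).add
    ((PolyBounded.const e.width).mul (h := 0) (PolyBounded.fst.add (.const 1))))).weaken
    (Nat.zero_le _))

theorem polyBounded_storeCost (a e : RAMTerm) :
    PolyBounded (max a.bigDepth e.bigDepth) fun W N => a.storeCost W N e :=
  (a.polyBounded_cost.weaken (le_max_left _ _)).add
    ((e.polyBounded_cost.weaken (le_max_right _ _)).add
      ((((PolyBounded.const 1).add
        ((PolyBounded.const a.width).mul (h := 0) (PolyBounded.fst.add (.const 1)))).add
        ((PolyBounded.const e.width).mul (h := 0) (PolyBounded.fst.add (.const 1)))).weaken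
        (Nat.zero_le _)))

end RAMTerm

/-! ### A greedy code -/

/-- The number of the lowest `L` bits in which `x` and `y` differ. -/
def bitDist (L x y : ℕ) : ℕ :=
  ∑ t ∈ Finset.range L, ((x / 2 ^ t % 2 - y / 2 ^ t % 2) + (y / 2 ^ t % 2 - x / 2 ^ t % 2))

theorem bitDist_comm (L x y : ℕ) : bitDist L x y = bitDist L y x :=
  Finset.sum_congr rfl fun _ _ => add_comm _ _

theorem bitDist_succ (L x y : ℕ) : bitDist (L + 1) x y =
    bitDist L (x / 2) (y / 2) + ((x % 2 - y % 2) + (y % 2 - x % 2)) := by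
  simp only [bitDist]
  rw [Finset.sum_range_succ']
  simp [pow_succ', Nat.div_div_eq_div_mul]

theorem bitDist_le (L x y : ℕ) : bitDist L x y ≤ L := by
  calc bitDist L x y ≤ ∑ t ∈ Finset.range L, 1 := Finset.sum_le_sum fun t _ => by omega
    _ = L := by simp

theorem Finset.sum_range_two_mul {M : Type*} [AddCommMonoid M] (f : ℕ → M) (n : ℕ) :
    ∑ i ∈ Finset.range (2 * n), f i = ∑ i ∈ Finset.range n, (f (2 * i) + f (2 * i + 1)) := by
  induction n with
  | zero => simp
  | succ n ih => rw [Nat.mul_succ, Finset.sum_range_succ, Finset.sum_range_succ, ih,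
      Finset.sum_range_succ, add_assoc]

/-- The weight counts a factor 2 for each position of agreement and 1 for each difference, so the
sum over all words factors into `L` factors 2 + 1. -/
theorem sum_two_pow_sub_bitDist (L u : ℕ) :
    ∑ w ∈ Finset.range (2 ^ L), 2 ^ (L - bitDist L w u) = 3 ^ L := by
  induction L generalizing u with
  | zero => simp [bitDist]
  | succ L ih =>
    rw [pow_succ', Finset.sum_range_two_mul, pow_succ, ← ih (u / 2), Finset.sum_mul]
    refine Finset.sum_congr rfl fun w _ => ?_
    rw [bitDist_succ, bitDist_succ]
    have h1 : (2 * w) / 2 = w := by omega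
    have h2 : (2 * w + 1) / 2 = w := by omega
    have h3 := bitDist_le L w (u / 2)
    rw [h1, h2]
    have e : L + 1 - bitDist L w (u / 2) = L - bitDist L w (u / 2) + 1 := by omega
    rcases Nat.mod_two_eq_zero_or_one u with hu | hu
    · have a1 : 2 * w % 2 - u % 2 + (u % 2 - 2 * w % 2) = 0 := by omega
      have a2 : (2 * w + 1) % 2 - u % 2 + (u % 2 - (2 * w + 1) % 2) = 1 := by omega
      rw [a1, a2, add_zero, e, Nat.add_sub_add_right, pow_succ]
      ring
    · have a1 : 2 * w % 2 - u % 2 + (u % 2 - 2 * w % 2) = 1 := by omega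
      have a2 : (2 * w + 1) % 2 - u % 2 + (u % 2 - (2 * w + 1) % 2) = 0 := by omega
      rw [a1, a2, add_zero, e, Nat.add_sub_add_right, pow_succ]
      ring

/-- A covering code with radius a third of the length is large (Gilbert–Varshamov). -/
theorem two_pow_le_of_covering {k cnt : ℕ} {T : ℕ → ℕ}
    (h : ∀ w < 2 ^ (24 * k), ∃ a < cnt, bitDist (24 * k) w (T a) ≤ 8 * k) : 2 ^ k ≤ cnt := by
  -- Double counting: each word receives weight at least 2^(16k) from a codeword covering it, and
  -- each codeword hands out 3^(24k) in total.
  have h1 : 2 ^ (24 * k) * 2 ^ (16 * k) ≤ cnt * 3 ^ (24 * k) := by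
    calc 2 ^ (24 * k) * 2 ^ (16 * k)
        = ∑ w ∈ Finset.range (2 ^ (24 * k)), 2 ^ (16 * k) := by simp
      _ ≤ ∑ w ∈ Finset.range (2 ^ (24 * k)), ∑ a ∈ Finset.range cnt,
          2 ^ (24 * k - bitDist (24 * k) w (T a)) := by
        refine Finset.sum_le_sum fun w hw => ?_
        obtain ⟨a, ha, hle⟩ := h w (Finset.mem_range.1 hw)
        calc 2 ^ (16 * k) ≤ 2 ^ (24 * k - bitDist (24 * k) w (T a)) :=
              Nat.pow_le_pow_right (by norm_num) (by omega)
          _ ≤ _ := Finset.single_le_sum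
            (f := fun a => 2 ^ (24 * k - bitDist (24 * k) w (T a)))
            (fun _ _ => Nat.zero_le _) (Finset.mem_range.2 ha)
      _ = cnt * 3 ^ (24 * k) := by
        rw [Finset.sum_comm]
        simp [sum_two_pow_sub_bitDist]
  -- 3^24 lies between 2^38 and 2^39, and 24 + 16 - 39 = 1 leaves the factor 2^k.
  have h2 : 3 ^ (24 * k) ≤ 2 ^ (39 * k) := by
    rw [pow_mul, pow_mul]
    exact Nat.pow_le_pow_left (by norm_num) k
  have h3 : 2 ^ k * 2 ^ (39 * k) ≤ cnt * 2 ^ (39 * k) := by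
    calc 2 ^ k * 2 ^ (39 * k) = 2 ^ (24 * k) * 2 ^ (16 * k) := by
          rw [← pow_add, ← pow_add]; congr 1; ring
      _ ≤ cnt * 3 ^ (24 * k) := h1
      _ ≤ _ := Nat.mul_le_mul_left _ h2
  exact Nat.le_of_mul_le_mul_right h3 (by positivity)

/-! ### The point set -/

/-- The entries, increased by one, of the points made from `s` vectors `a 0, …` and `s` vectors
`b 0, …`. The points of the first kind end with a codeword, those of the second kind with the
binary expansion of the index. -/
def pointEntry (d L R k s : ℕ) (a b : ℕ → ℕ → ℕ) (T : ℕ → ℕ) (i c : ℕ) : ℕ :=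
  if i < s then
    if c < d then 2 - a i c
    else if c < d + d then 1 + a i (c - d)
    else if c < d + d + L * R then 2 * (T i / 2 ^ ((c - (d + d)) / R) % 2)
    else 1
  else
    if c < d then 2
    else if c < d + d then 2 - 2 * b (i - s) (c - d)
    else if c < d + d + L * R then 1
    else if c < d + d + L * R + k then 2 * (i / 2 ^ (c - (d + d + L * R)) % 2)
    else 1

theorem pointEntry_le {d L R k s : ℕ} {a b : ℕ → ℕ → ℕ} {T : ℕ → ℕ}
    (ha : ∀ i t, a i t ≤ 1) (i c : ℕ) :
    pointEntry d L R k s a b T i c ≤ 2 := by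
  have := ha i (c - d)
  unfold pointEntry
  split_ifs <;> omega

/-- Squared distances of points with entries `E`. -/
def sqDistOf (D : ℕ) (E : ℕ → ℕ → ℕ) (i j : ℕ) : ℤ :=
  ∑ c ∈ Finset.range D, ((E i c : ℤ) - E j c) ^ 2

theorem Finset.sum_range_mul_div (f : ℕ → ℤ) (L : ℕ) {R : ℕ} (hR : 0 < R) :
    ∑ q ∈ Finset.range (L * R), f (q / R) = R * ∑ t ∈ Finset.range L, f t := by
  induction L with
  | zero => simp
  | succ L ih =>
    rw [Nat.succ_mul, Finset.sum_range_add, ih, Finset.sum_range_succ, mul_add]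
    congr 1
    rw [Finset.sum_congr rfl (g := fun _ => f L)]
    · simp
    · intro q hq
      rw [Nat.add_comm, Nat.add_mul_div_right _ _ hR, Nat.div_eq_of_lt (Finset.mem_range.1 hq),
        Nat.zero_add]

section PointSet

variable {d L R k s e : ℕ} {a b : ℕ → ℕ → ℕ} {T : ℕ → ℕ}

/-- Coordinates `t` and `d + t` together contribute a² + (a + 2b - 1)² = 1 + 4ab for bits a, b. On
the code and index coordinates one point has ±1 and the other 0, contributing 1 each; on the padding
both are 0. -/
theorem sqDistOf_pointEntry_of_lt_of_le {i j : ℕ} (ha : ∀ i t, a i t ≤ 1) (hb : ∀ i t, b i t ≤ 1)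
    (hi : i < s) (hj : s ≤ j) :
    sqDistOf (d + d + L * R + k + e) (pointEntry d L R k s a b T) i j =
      d + 4 * (∑ t ∈ Finset.range d, a i t * b (j - s) t : ℕ) + L * R + k := by
  have hj' : ¬ j < s := by omega
  rw [sqDistOf, Finset.sum_range_add, Finset.sum_range_add, Finset.sum_range_add,
    Finset.sum_range_add, ← Finset.sum_add_distrib]
  have h1 : ∀ t ∈ Finset.range d,
      ((pointEntry d L R k s a b T i t : ℤ) - pointEntry d L R k s a b T j t) ^ 2 +
      ((pointEntry d L R k s a b T i (d + t) : ℤ) - pointEntry d L R k s a b T j (d + t)) ^ 2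
      = 1 + 4 * ((a i t * b (j - s) t : ℕ) : ℤ) := by
    intro t ht
    have ht := Finset.mem_range.1 ht
    have h1 := ha i t
    have h2 := hb (j - s) t
    simp only [pointEntry, hi, hj', if_true, if_false, ht, Nat.not_lt.2 (Nat.le_add_right d t),
      Nat.add_lt_add_left ht d, Nat.add_sub_cancel_left]
    interval_cases a i t <;> interval_cases b (j - s) t <;> norm_num
  have h2 : ∀ q ∈ Finset.range (L * R), ((pointEntry d L R k s a b T i (d + d + q) : ℤ) -
      pointEntry d L R k s a b T j (d + d + q)) ^ 2 = 1 := by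
    intro q hq
    have hq := Finset.mem_range.1 hq
    simp only [pointEntry, hi, hj', if_true, if_false, show ¬ d + d + q < d by omega,
      show ¬ d + d + q < d + d by omega, Nat.add_lt_add_left hq (d + d), Nat.add_sub_cancel_left]
    rcases Nat.mod_two_eq_zero_or_one (T i / 2 ^ (q / R)) with h | h <;> rw [h] <;> norm_num
  have h3 : ∀ q ∈ Finset.range k, ((pointEntry d L R k s a b T i (d + d + L * R + q) : ℤ) -
      pointEntry d L R k s a b T j (d + d + L * R + q)) ^ 2 = 1 := by
    intro q hq
    have hq := Finset.mem_range.1 hq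
    simp only [pointEntry, hi, hj', if_true, if_false, show ¬ d + d + L * R + q < d by omega,
      show ¬ d + d + L * R + q < d + d by omega, show ¬ d + d + L * R + q < d + d + L * R by omega,
      Nat.add_lt_add_left hq (d + d + L * R), Nat.add_sub_cancel_left]
    rcases Nat.mod_two_eq_zero_or_one (j / 2 ^ q) with h | h <;> rw [h] <;> norm_num
  have h4 : ∀ q ∈ Finset.range e, ((pointEntry d L R k s a b T i (d + d + L * R + k + q) : ℤ) -
      pointEntry d L R k s a b T j (d + d + L * R + k + q)) ^ 2 = 0 := by
    intro q hq
    simp only [pointEntry, hi, hj', if_true, if_false, show ¬ d + d + L * R + k + q < d by omega,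
      show ¬ d + d + L * R + k + q < d + d by omega,
      show ¬ d + d + L * R + k + q < d + d + L * R by omega,
      show ¬ d + d + L * R + k + q < d + d + L * R + k by omega]
    norm_num
  rw [Finset.sum_congr rfl h1, Finset.sum_congr rfl h2, Finset.sum_congr rfl h3,
    Finset.sum_congr rfl h4, Finset.sum_add_distrib, ← Finset.mul_sum]
  push_cast
  simp

/-- The code coordinates alone suffice: a differing bit is 1 against -1, contributes 4, and is
repeated `R` times. -/
theorem le_sqDistOf_pointEntry {i j : ℕ} (hR : 0 < R) (hi : i < s) (hj : j < s) :
    4 * R * (bitDist L (T i) (T j) : ℤ) ≤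
      sqDistOf (d + d + L * R + k + e) (pointEntry d L R k s a b T) i j := by
  rw [sqDistOf, Finset.sum_range_add, Finset.sum_range_add, Finset.sum_range_add (n := d + d)]
  have h0 : ∀ (n m : ℕ), (0 : ℤ) ≤ ∑ q ∈ Finset.range n,
      ((pointEntry d L R k s a b T i (m + q) : ℤ) -
        pointEntry d L R k s a b T j (m + q)) ^ 2 := fun n m =>
    Finset.sum_nonneg fun q _ => sq_nonneg _
  have h1 := h0 (d + d) 0
  simp only [Nat.zero_add] at h1
  have h2 : ∑ q ∈ Finset.range (L * R), ((pointEntry d L R k s a b T i (d + d + q) : ℤ) -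
      pointEntry d L R k s a b T j (d + d + q)) ^ 2 = 4 * R * (bitDist L (T i) (T j) : ℤ) := by
    let F : ℕ → ℤ := fun t => 4 * (((T i / 2 ^ t % 2 - T j / 2 ^ t % 2) +
      (T j / 2 ^ t % 2 - T i / 2 ^ t % 2) : ℕ) : ℤ)
    have : ∀ q ∈ Finset.range (L * R), ((pointEntry d L R k s a b T i (d + d + q) : ℤ) -
        pointEntry d L R k s a b T j (d + d + q)) ^ 2 = F (q / R) := by
      intro q hq
      have hq := Finset.mem_range.1 hq
      simp only [F, pointEntry, hi, hj, if_true, if_false, show ¬ d + d + q < d by omega,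
        show ¬ d + d + q < d + d by omega, Nat.add_lt_add_left hq (d + d),
        Nat.add_sub_cancel_left]
      rcases Nat.mod_two_eq_zero_or_one (T i / 2 ^ (q / R)) with h | h <;>
      rcases Nat.mod_two_eq_zero_or_one (T j / 2 ^ (q / R)) with h' | h' <;>
      rw [h, h'] <;> norm_num
    rw [Finset.sum_congr rfl this, Finset.sum_range_mul_div F L hR, bitDist, ← Finset.mul_sum]
    push_cast
    ring
  have h3 := h0 k (d + d + L * R)
  have h4 := h0 e (d + d + L * R + k)
  linarith

/-- The points are distinct. -/
theorem pointEntry_injective {i j : ℕ} (hR : 0 < R) (hL : 0 < L) (hs : s = 2 ^ k)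
    (hT : ∀ i < s, ∀ j < s, i ≠ j → 0 < bitDist L (T i) (T j)) (hi : i < 2 * s) (hj : j < 2 * s)
    (h : ∀ c < d + d + L * R + k + e,
      pointEntry d L R k s a b T i c = pointEntry d L R k s a b T j c) : i = j := by
  have hLR : 0 < L * R := Nat.mul_pos hL hR
  -- The first code coordinate is ±1 for one kind and 0 for the other.
  have hmix : ∀ i j, i < s → s ≤ j →
      pointEntry d L R k s a b T i (d + d) ≠ pointEntry d L R k s a b T j (d + d) := by
    intro i j hi hj
    simp only [pointEntry, hi, show ¬ j < s by omega, if_true, if_false,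
      show ¬ d + d < d by omega, lt_irrefl, show d + d < d + d + L * R by omega]
    omega
  rcases lt_or_ge i s with his | his <;> rcases lt_or_ge j s with hjs | hjs
  · by_contra hne
    have h1 := hT i his j hjs hne
    have h2 := le_sqDistOf_pointEntry (d := d) (L := L) (k := k) (e := e) (a := a) (b := b)
      (T := T) hR his hjs
    have h3 : sqDistOf (d + d + L * R + k + e) (pointEntry d L R k s a b T) i j = 0 :=
      Finset.sum_eq_zero fun c hc => by rw [h c (Finset.mem_range.1 hc)]; simp
    rw [h3] at h2
    have : (0 : ℤ) < 4 * R * (bitDist L (T i) (T j) : ℤ) := by positivity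
    omega
  · exact absurd (h _ (by omega)) (hmix i j his hjs)
  · exact absurd (h _ (by omega)).symm (hmix j i hjs his)
  -- Indices of the second kind lie between 2^k and 2^(k+1), so their lowest `k` bits determine
  -- them.
  · have hmod : i % 2 ^ k = j % 2 ^ k := by
      refine Nat.eq_of_testBit_eq fun t => ?_
      rw [Nat.testBit_mod_two_pow, Nat.testBit_mod_two_pow]
      by_cases ht : t < k
      · have := h (d + d + L * R + t) (by omega)
        simp only [pointEntry, show ¬ i < s by omega, show ¬ j < s by omega, if_false,
          show ¬ d + d + L * R + t < d by omega, show ¬ d + d + L * R + t < d + d by omega,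
          show ¬ d + d + L * R + t < d + d + L * R by omega,
          show d + d + L * R + t < d + d + L * R + k by omega, if_true,
          Nat.add_sub_cancel_left] at this
        rw [Nat.testBit_eq_decide_div_mod_eq, Nat.testBit_eq_decide_div_mod_eq,
          show i / 2 ^ t % 2 = j / 2 ^ t % 2 by omega]
      · simp [ht]
    rw [← hs, Nat.mod_eq_sub_mod his, Nat.mod_eq_sub_mod hjs, Nat.mod_eq_of_lt (by omega),
      Nat.mod_eq_of_lt (by omega)] at hmod
    omega

end PointSet

theorem dist_euclPoint_le_iff {d : ℕ} (x y z : Fin d → ℤ) :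
    dist (euclPoint x) (euclPoint y) ≤ dist (euclPoint x) (euclPoint z) ↔
      ∑ c, (x c - y c) ^ 2 ≤ ∑ c, (x c - z c) ^ 2 := by
  have h : ∀ y : Fin d → ℤ, dist (euclPoint x) (euclPoint y) =
      Real.sqrt ((∑ c, (x c - y c) ^ 2 : ℤ) : ℝ) := by
    intro y
    rw [EuclideanSpace.dist_eq]
    congr 1
    push_cast
    refine Finset.sum_congr rfl fun c _ => ?_
    simp [euclPoint, Real.dist_eq]
  rw [h, h, Real.sqrt_le_sqrt_iff (Int.cast_nonneg (Finset.sum_nonneg fun c _ => sq_nonneg _))]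
  exact Int.cast_le

theorem sum_fin_eq_sqDistOf (D : ℕ) (E : ℕ → ℕ → ℕ) (i j : ℕ) :
    ∑ c : Fin D, (((E i c : ℤ) - 1) - ((E j c : ℤ) - 1)) ^ 2 = sqDistOf D E i j := by
  rw [sqDistOf, Finset.sum_range]
  exact Finset.sum_congr rfl fun c _ => by ring

/-- A nearest neighbor of a point of the first kind is of the second kind, and finds an orthogonal
vector if there is one. -/
theorem orthogonal_of_nearest {d L R k s e r D : ℕ} (hD : D = d + d + L * R + k + e)
    {a b : ℕ → ℕ → ℕ} {T : ℕ → ℕ}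
    (ha : ∀ i t, a i t ≤ 1) (hb : ∀ i t, b i t ≤ 1) (hR : 0 < R)
    (hT : ∀ i < s, ∀ j < s, i ≠ j → r < bitDist L (T i) (T j))
    (hr : 5 * d + L * R + k < 4 * R * (r + 1)) {out : ℕ → ℕ}
    (hout : IsAllNearestNeighbors (n := 2 * s) (d := D)
      (fun i c => (pointEntry d L R k s a b T i c : ℤ) - 1) out)
    {i j : ℕ} (hi : i < s) (hj : j < s) (hij : ∑ t ∈ Finset.range d, a i t * b j t = 0) :
    ∑ t ∈ Finset.range d, a i t * b (out i - s) t = 0 := by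
  subst hD
  obtain ⟨o, ho, hne, hmin⟩ := hout ⟨i, by omega⟩
  -- The competitor is the point made from the orthogonal vector `b j`, at the least distance
  -- possible between the two kinds.
  have hmin' := hmin ⟨s + j, by omega⟩ (by simp [Fin.ext_iff]; omega)
  rw [dist_euclPoint_le_iff, sum_fin_eq_sqDistOf, sum_fin_eq_sqDistOf] at hmin'
  simp only at hmin' ho
  rw [ho]
  rw [sqDistOf_pointEntry_of_lt_of_le (j := s + j) ha hb hi (by omega),
    Nat.add_sub_cancel_left, hij] at hmin'
  have ho2 : s ≤ (o : ℕ) := by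
    by_contra hlt
    have hlt : (o : ℕ) < s := by omega
    have h1 := hT i hi o hlt (fun h => hne (Fin.ext h.symm))
    have h2 := (le_sqDistOf_pointEntry (d := d) (L := L) (k := k) (e := e) (a := a) (b := b)
      (T := T) hR hi hlt).trans hmin'
    have h3 : 4 * R * (r + 1) ≤ 4 * R * bitDist L (T i) (T o) := Nat.mul_le_mul_left _ h1
    push_cast at h2
    have h4 : (4 * R * bitDist L (T i) (T o) : ℤ) ≤ d + L * R + k := by linarith
    have h5 : 4 * R * bitDist L (T i) (T o) ≤ d + L * R + k := by exact_mod_cast h4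
    omega
  rw [sqDistOf_pointEntry_of_lt_of_le ha hb hi ho2] at hmin'
  have : (∑ t ∈ Finset.range d, a i t * b (o - s) t : ℕ) ≤ 0 := by
    push_cast at hmin' ⊢
    have h : (∑ t ∈ Finset.range d, (a i t : ℤ) * b (o - s) t) ≤ 0 := by linarith
    exact_mod_cast h
  omega

/-! ### Rewriting rules for states and notation for terms. -/

theorem RAMState.setReg_reg (σ : RAMState) (r x q : ℕ) :
    (σ.setReg r x).reg q = if q = r then x else σ.reg q := by
  simp [RAMState.setReg, Function.update_apply]

theorem RAMState.setReg_mem (σ : RAMState) (r x : ℕ) : (σ.setReg r x).mem = σ.mem := rfl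

theorem RAMState.setMem_reg (σ : RAMState) (a x : ℕ) : (σ.setMem a x).reg = σ.reg := rfl

theorem RAMState.setMem_mem (σ : RAMState) (a x q : ℕ) :
    (σ.setMem a x).mem q = if q = a then x else σ.mem q := by
  simp [RAMState.setMem, Function.update_apply]

namespace RAMTerm

instance : Add RAMTerm := ⟨.op .add⟩
instance : Sub RAMTerm := ⟨.op .sub⟩
instance : Mul RAMTerm := ⟨.op .mul⟩
instance : Div RAMTerm := ⟨.op .div⟩
instance : Mod RAMTerm := ⟨fun a b => a - a / b * b⟩

/-- `x` if `a < b`, and `y` otherwise -/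
def iteLt (a b x y : RAMTerm) : RAMTerm := .ite (b - a) x y

section

variable {W N : ℕ} {mem reg : ℕ → ℕ} {a b x y : RAMTerm}

theorem eval_add : (a + b).eval mem reg = a.eval mem reg + b.eval mem reg := rfl
theorem eval_sub : (a - b).eval mem reg = a.eval mem reg - b.eval mem reg := rfl
theorem eval_mul : (a * b).eval mem reg = a.eval mem reg * b.eval mem reg := rfl
theorem eval_div : (a / b).eval mem reg = a.eval mem reg / b.eval mem reg := rfl
theorem eval_mod : (a % b).eval mem reg = a.eval mem reg % b.eval mem reg :=
  (Nat.mod_eq_sub_div_mul).symm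
theorem eval_iteLt : (iteLt a b x y).eval mem reg =
    if a.eval mem reg < b.eval mem reg then x.eval mem reg else y.eval mem reg := by
  simp only [iteLt, eval, eval_sub, Nat.sub_ne_zero_iff_lt]
theorem ok_add : (a + b).Ok W N mem reg ↔ a.Ok W N mem reg ∧ b.Ok W N mem reg := Iff.rfl
theorem ok_sub : (a - b).Ok W N mem reg ↔ a.Ok W N mem reg ∧ b.Ok W N mem reg := Iff.rfl
theorem ok_mul : (a * b).Ok W N mem reg ↔ a.Ok W N mem reg ∧ b.Ok W N mem reg := Iff.rfl
theorem ok_div : (a / b).Ok W N mem reg ↔ a.Ok W N mem reg ∧ b.Ok W N mem reg := Iff.rfl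
theorem ok_mod : (a % b).Ok W N mem reg ↔ a.Ok W N mem reg ∧ b.Ok W N mem reg := by
  change (a.Ok W N mem reg ∧ (a.Ok W N mem reg ∧ b.Ok W N mem reg) ∧ b.Ok W N mem reg) ↔ _
  tauto
theorem ok_iteLt : (iteLt a b x y).Ok W N mem reg ↔ (b.Ok W N mem reg ∧ a.Ok W N mem reg) ∧
    (a.eval mem reg < b.eval mem reg → x.Ok W N mem reg) ∧
    (b.eval mem reg ≤ a.eval mem reg → y.Ok W N mem reg) := by
  simp only [iteLt, Ok, eval_sub, ok_sub, Nat.sub_ne_zero_iff_lt, Nat.sub_eq_zero_iff_le]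

theorem eval_var (r : ℕ) : (var r).eval mem reg = reg r := rfl
theorem eval_const (k : ℕ) : (const k).eval mem reg = k := rfl
theorem eval_load : (load a).eval mem reg = mem (a.eval mem reg) := rfl
theorem eval_pow2 : (pow2 a).eval mem reg = 2 ^ a.eval mem reg := rfl
theorem eval_ite : (ite a x y).eval mem reg =
    if a.eval mem reg ≠ 0 then x.eval mem reg else y.eval mem reg := rfl
theorem eval_sum (v : ℕ) (big : Bool) : (sum v big a b).eval mem reg =
    ∑ i ∈ Finset.range (a.eval mem reg), b.eval mem (Function.update reg v i) := rfl
theorem ok_var (r : ℕ) : (var r).Ok W N mem reg ↔ r < 32 := Iff.rfl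
theorem ok_const (k : ℕ) : (const k).Ok W N mem reg := trivial
theorem ok_load : (load a).Ok W N mem reg ↔
    a.Ok W N mem reg ∧ (mem (a.eval mem reg)).size ≤ W := Iff.rfl
theorem ok_pow2 : (pow2 a).Ok W N mem reg ↔ a.Ok W N mem reg ∧ a.eval mem reg ≤ W := Iff.rfl
theorem ok_ite : (ite a x y).Ok W N mem reg ↔ a.Ok W N mem reg ∧
    (a.eval mem reg ≠ 0 → x.Ok W N mem reg) ∧ (a.eval mem reg = 0 → y.Ok W N mem reg) := Iff.rfl
theorem ok_sum (v : ℕ) (big : Bool) : (sum v big a b).Ok W N mem reg ↔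
    v < 32 ∧ a.Ok W N mem reg ∧ a.eval mem reg ≤ (if big then N else W) ∧
      ∀ i < a.eval mem reg, b.Ok W N mem (Function.update reg v i) := Iff.rfl

end

end RAMTerm

namespace OVReduction

open RAMTerm

/-! ### The program

Variables: `0` result, `1` number `n` of vectors, `2` dimension `d`, `3` the parameter `k`, `4` the
block size `2 ^ k`, `5` number of codewords found, `6` word under test, `7` number of the pair of
blocks, `8` cell to be filled, `9` number of pairs of blocks, `10` address of the embedded memory,
`11`–`13` loop counters, `14`, `15` for the logarithm, `20`, `21` summation variables. -/

/-- address of the code table -/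
def offT : RAMTerm := var 1 * var 2 + const 2

/-- `min q (n - 1)` -/
def clampT (q : RAMTerm) : RAMTerm := q - (q + const 1 - var 1)

def bitT (x t : RAMTerm) : RAMTerm := x / pow2 t % const 2

def bitDistT (x y : RAMTerm) : RAMTerm :=
  sum 21 false (const 24 * var 3) ((bitT x (var 21) - bitT y (var 21)) +
    (bitT y (var 21) - bitT x (var 21)))

/-- number of codewords close to the word under test (with multiplicity) -/
def closeT : RAMTerm :=
  sum 20 true (var 5) (const 8 * var 3 + const 1 - bitDistT (var 6) (load (offT + var 20)))

/-- number of blocks -/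
def groupsT : RAMTerm := var 1 / var 4 + const 1

/-- entry `t` of vector `i` of block `g` -/
def entryT (g i t : RAMTerm) : RAMTerm := load (const 2 + var 2 * clampT (g * var 4 + i) + t)

/-- The pair number codes two blocks, as quotient and remainder by the number of blocks. -/
def firstT : RAMTerm := var 7 / groupsT

def secondT : RAMTerm := var 7 % groupsT

section

variable (D k₀ : ℕ)

/-- dimension of the points -/
def dimT : RAMTerm := const (27 * D) * (var 3 + const 1)

def pointT (i c : RAMTerm) : RAMTerm :=
  iteLt i (var 4)
    (iteLt c (var 2) (const 2 - entryT firstT i c)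
      (iteLt c (var 2 + var 2) (const 1 + entryT firstT i (c - var 2))
        (iteLt c (var 2 + var 2 + const 24 * var 3 * const D)
          (const 2 * bitT (load (offT + i)) ((c - (var 2 + var 2)) / const D)) (const 1))))
    (iteLt c (var 2) (const 2)
      (iteLt c (var 2 + var 2) (const 2 - const 2 * entryT secondT (i - var 4) (c - var 2))
        (iteLt c (var 2 + var 2 + const 24 * var 3 * const D) (const 1)
          (iteLt c (var 2 + var 2 + const 24 * var 3 * const D + var 3)
            (const 2 * bitT i (c - (var 2 + var 2 + const 24 * var 3 * const D))) (const 1)))))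

/-- content of cell `q` of the embedded input -/
def cellT : RAMTerm :=
  ite (var 8)
    (ite (var 8 - const 1) (pointT D ((var 8 - const 2) / dimT D) ((var 8 - const 2) % dimT D))
      (dimT D))
    (const 2 * var 4)

/-- number of vectors of the first block that are orthogonal to the vector found -/
def hitsT : RAMTerm :=
  sum 20 true (var 4) (const 1 - sum 21 false (var 2) (entryT firstT (var 20) (var 21) *
    entryT secondT (load (var 10 + var 20 * var 9) - var 4) (var 21)))

/-- Raises register 15 as long as the next power of two does not exceed `n`; linearly many rounds
are affordable. -/
def logStep : RAMProg :=
  assign 15 (var 15 + ite (var 1 / pow2 (var 15 + const 1)) (const 1) (const 0))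

def prelude : RAMProg :=
  .seq (assign 1 (load (const 0))) (.seq (assign 2 (load (const 1)))
    (.seq (forLt 11 14 (var 1) logStep)
    (.seq (assign 3 (var 15 / const 48 + const k₀)) (assign 4 (pow2 (var 3))))))

/-- The word is stored behind the codewords in any case, but counted only if no codeword is close; a
rejected word is overwritten in the next round. -/
def codeStep : RAMProg :=
  .seq (storeAt (offT + var 5) (var 6)) (assign 5 (var 5 + (const 1 - closeT)))

def codeLoop : RAMProg := forLt 11 6 (pow2 (const 24 * var 3)) codeStep

def fillLoop : RAMProg :=
  forLt 13 8 (const 2 + const 2 * var 4 * dimT D) (storeAt (var 10 + var 8 * var 9) (cellT D))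

def pairStep (P : RAMProg) : RAMProg :=
  .seq (assign 10 (offT + pow2 (const 24 * var 3) + var 7)) (.seq (fillLoop D)
    (.seq (P.call 9 10) (assign 0 (ite (var 0 + hitsT) (const 1) (const 0)))))

def program (P : RAMProg) : RAMProg :=
  .seq (prelude k₀) (.seq codeLoop (.seq (assign 9 (groupsT * groupsT))
    (forLt 12 7 (var 9) (pairStep D P))))

end

/-! ### The logarithm -/

section

variable {W n d : ℕ} {mem : ℕ → ℕ}

theorem prelude_run (k₀ : ℕ) (hn : 1 ≤ n) (h0 : mem 0 = n) (h1 : mem 1 = d) {k : ℕ}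
    (hk : k = Nat.log 2 n / 48 + k₀) (hnW : n.size ≤ W) (hdW : d.size ≤ W) (hkW : k ≤ W)
    (hsW : (2 ^ k).size ≤ W) (hW : 1 ≤ W) :
    VarRun (prelude k₀) ⟨fun _ => 0, mem⟩
      ((load (const 0)).assignCost W 1 + ((load (const 1)).assignCost W 1 +
        (((var 1).assignCost W 1 +
        (1 + (n * ((var 15 + ite (var 1 / pow2 (var 15 + const 1)) (const 1) (const 0) :
          RAMTerm).assignCost W 1 +
          (7 + 3 * W)) + 1))) + ((var 15 / const 48 + const k₀ : RAMTerm).assignCost W 1 +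
            (pow2 (var 3)).assignCost W 1))))
      fun σ => σ.VarsLe W ∧ σ.mem = mem ∧ σ.reg 0 = 0 ∧ σ.reg 1 = n ∧ σ.reg 2 = d ∧
        σ.reg 3 = k ∧ σ.reg 4 = 2 ^ k ∧ σ.reg 5 = 0 := by
  have hN : Nat.size 1 ≤ W := by simpa using hW
  have hz : (RAMState.mk (fun _ => 0) mem).VarsLe W := fun r _ => by simp
  refine .seq (R := fun σ => σ = (RAMState.mk (fun _ => 0) mem).setReg 1 n)
    (.assign (by norm_num) hN hz ⟨trivial, by simpa [eval, h0] using hnW⟩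
      (by simp [eval, h0])) ?_
  rintro _ rfl
  refine .seq (R := fun σ => σ = ((RAMState.mk (fun _ => 0) mem).setReg 1 n).setReg 2 d)
    (.assign (by norm_num) hN (hz.setReg hnW) ⟨trivial, ?_⟩ ?_) ?_
  · change (mem 1).size ≤ W
    rw [h1]; exact hdW
  · change RAMState.setReg _ 2 (mem 1) = _
    rw [h1]
  rintro _ rfl
  refine .seq (R := fun σ => σ.VarsLe W ∧ σ.mem = mem ∧ σ.reg 0 = 0 ∧ σ.reg 1 = n ∧ σ.reg 2 = d ∧
    σ.reg 5 = 0 ∧ σ.reg 15 = Nat.log 2 n) (.forLt (fun j σ => σ.VarsLe W ∧ σ.mem = mem ∧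
      σ.reg 0 = 0 ∧ σ.reg 1 = n ∧ σ.reg 2 = d ∧ σ.reg 5 = 0 ∧ σ.reg 15 ≤ j ∧
      2 ^ σ.reg 15 ≤ n ∧ (n < 2 ^ (σ.reg 15 + 1) ∨ σ.reg 15 = j)) (by norm_num) (by norm_num)
      (by norm_num) hN ((hz.setReg hnW).setReg hdW) (by simp [ok_var]) (v := n) rfl hnW ?_ ?_ ?_) ?_
  · refine ⟨(((hz.setReg hnW).setReg hdW).setReg hnW).setReg (by simp), rfl, ?_⟩
    simp [RAMState.setReg_reg]
    omega
  · rintro j hj σ ⟨i1, i2, i3, i4, i5, i6, i7, i8, i9⟩ hi hc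
    have hlt := Nat.lt_size.2 i8
    refine .assign (by norm_num) hN i1 ?_ ?_
    · simp only [ok_add, ok_var, ok_ite, ok_div, ok_pow2, ok_const, eval_add, eval_var, eval_const]
      refine ⟨by norm_num, ⟨by norm_num, ⟨by norm_num, trivial⟩, ?_⟩, fun _ => trivial,
        fun _ => trivial⟩
      omega
    · simp only [eval_add, eval_var, eval_const, eval_ite, eval_div, eval_pow2, i4]
      have hdiv : n / 2 ^ (σ.reg 15 + 1) ≠ 0 ↔ 2 ^ (σ.reg 15 + 1) ≤ n := by
        rw [Nat.div_ne_zero_iff]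
        exact ⟨fun h => h.2, fun h => ⟨by positivity, h⟩⟩
      refine ⟨by simp [RAMState.setReg_reg, hi], by simp [RAMState.setReg_reg, hc],
        ((i1.setReg ?_).setReg ?_).setReg ?_, i2, ?_⟩
      · refine (Nat.size_le_size ?_).trans hnW
        split_ifs <;> omega
      · exact (Nat.size_le_size hj).trans hnW
      · exact (Nat.size_le_size (Nat.sub_le _ _)).trans hnW
      · simp only [RAMState.setReg_reg]
        norm_num
        refine ⟨i3, i4, i5, i6, ?_⟩
        by_cases h : 2 ^ (σ.reg 15 + 1) ≤ n
        · rw [if_pos h]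
          refine ⟨by omega, h, Or.inr ?_⟩
          rcases i9 with i9 | i9 <;> omega
        · rw [if_neg h]
          refine ⟨by omega, i8, Or.inl (by simpa using h)⟩
  · rintro σ ⟨i1, i2, i3, i4, i5, i6, i7, i8, i9⟩
    refine ⟨i1, i2, i3, i4, i5, i6, ?_⟩
    -- If the counter were still rising after `n` rounds it would equal `n`, contradicting n < 2^n.
    have : n < 2 ^ (σ.reg 15 + 1) := by
      rcases i9 with h | h
      · exact h
      · rw [h] at i8
        exact absurd i8 (by simpa using (Nat.lt_two_pow_self (n := n)))
    exact ((Nat.log_eq_iff (Or.inr ⟨by norm_num, by omega⟩)).2 ⟨i8, this⟩).symm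
  rintro σ ⟨i1, i2, i3, i4, i5, i6, i7⟩
  have e3 : (var 15 / const 48 + const k₀ : RAMTerm).eval σ.mem σ.reg = k := by
    rw [eval_add, eval_div, eval_var, eval_const, eval_const, i7, hk]
  have hkW' : k.size ≤ W := (Nat.size_self_le k).trans hkW
  refine .seq (R := fun σ' => σ' = σ.setReg 3 k) (.assign (by norm_num) hN i1 ?_ (by rw [e3])) ?_
  · simp [ok_add, ok_div, ok_var, ok_const, ok_const]
  rintro _ rfl
  refine .assign (by norm_num) hN (i1.setReg hkW') ?_ ?_
  · simp [ok_pow2, ok_var, eval_var, RAMState.setReg_reg, hkW]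
  · simp only [eval_pow2, eval_var, RAMState.setReg_reg, if_true]
    refine ⟨(i1.setReg hkW').setReg hsW, i2, ?_⟩
    simp [i3, i4, i5, i6]

end

end OVReduction

namespace OVReduction

open RAMTerm

/-! ### The code -/

section

variable {W N n d k : ℕ} {mem : ℕ → ℕ}

/-- By truncation a summand vanishes exactly when the distance exceeds 8k, so the sum is zero
exactly when no codeword is close. -/
theorem eval_closeT (mem reg : ℕ → ℕ) : closeT.eval mem reg =
    ∑ i ∈ Finset.range (reg 5), (8 * reg 3 + 1 -
      bitDist (24 * reg 3) (reg 6) (mem (reg 1 * reg 2 + 2 + i))) := by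
  simp only [closeT, bitDistT, bitT, offT, eval_sum, eval_sub, eval_add, eval_mul, eval_mod,
    eval_div, eval_pow2, eval_load, eval_var, eval_const, bitDist]
  simp

theorem ok_closeT {mem reg : ℕ → ℕ} (h1 : reg 5 ≤ N) (h2 : 24 * reg 3 ≤ W)
    (h3 : ∀ i < reg 5, (mem (reg 1 * reg 2 + 2 + i)).size ≤ W) : closeT.Ok W N mem reg := by
  simp only [closeT, bitDistT, bitT, offT, ok_sum, ok_sub, ok_add, ok_mul, ok_mod,
    ok_div, ok_pow2, ok_load, ok_var, ok_const, eval_add, eval_mul, eval_var,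
    eval_const]
  simp only [Function.update_apply]
  norm_num
  refine ⟨h1, fun i hi => ⟨h2, fun j hj => ⟨by omega, h3 i hi, by omega⟩⟩⟩

/-- The memory after the search for the code. -/
structure CodeMem (n d k : ℕ) (mem mem' : ℕ → ℕ) : Prop where
  low : ∀ a < n * d + 2, mem' a = mem a
  mid : ∀ a < n * d + 2 + 2 ^ (24 * k), n * d + 2 ≤ a → mem' a < 2 ^ (24 * k)
  high : ∀ a, n * d + 2 + 2 ^ (24 * k) ≤ a → mem' a = mem a
  code : ∀ i < 2 ^ k, ∀ j < 2 ^ k, i ≠ j →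
    8 * k < bitDist (24 * k) (mem' (n * d + 2 + i)) (mem' (n * d + 2 + j))

/-- The greedy invariant has two halves: codewords are pairwise far apart, and every word tested so
far is within 8k of a codeword. When all words are tested the second half is a covering, and
`two_pow_le_of_covering` gives the 2^k codewords required. -/
theorem codeLoop_run {σ : RAMState} (hσ : σ.VarsLe W) (hmem : σ.mem = mem)
    (h0 : σ.reg 0 = 0) (h1 : σ.reg 1 = n) (h2 : σ.reg 2 = d) (h3 : σ.reg 3 = k)
    (h4 : σ.reg 4 = 2 ^ k) (h5 : σ.reg 5 = 0) (hW : 24 * k + 1 ≤ W)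
    (hz : ∀ a, n * d + 2 ≤ a → mem a = 0) :
    VarRun codeLoop σ
      ((pow2 (const 24 * var 3)).assignCost W (2 ^ (24 * k)) + (1 + (2 ^ (24 * k) *
        (((offT + var 5).storeCost W (2 ^ (24 * k)) (var 6) +
          (var 5 + (const 1 - closeT)).assignCost W (2 ^ (24 * k))) + (7 + 3 * W)) + 1)))
      fun σ => σ.VarsLe W ∧ CodeMem n d k mem σ.mem ∧ σ.reg 0 = 0 ∧ σ.reg 1 = n ∧ σ.reg 2 = d ∧
        σ.reg 3 = k ∧ σ.reg 4 = 2 ^ k := by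
  have hN : (2 ^ (24 * k)).size ≤ W := by rw [Nat.size_pow]; exact hW
  refine .forLt (fun w σ => σ.VarsLe W ∧ σ.reg 0 = 0 ∧ σ.reg 1 = n ∧ σ.reg 2 = d ∧
    σ.reg 3 = k ∧ σ.reg 4 = 2 ^ k ∧ σ.reg 5 ≤ w ∧ (∀ a < n * d + 2, σ.mem a = mem a) ∧
    (∀ a, n * d + 2 + w ≤ a → σ.mem a = mem a) ∧ (∀ a, n * d + 2 ≤ a → σ.mem a < 2 ^ (24 * k)) ∧
    (∀ i < σ.reg 5, ∀ j < i, 8 * k <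
      bitDist (24 * k) (σ.mem (n * d + 2 + i)) (σ.mem (n * d + 2 + j))) ∧
    (∀ w' < w, ∃ i < σ.reg 5, bitDist (24 * k) w' (σ.mem (n * d + 2 + i)) ≤ 8 * k))
    (by norm_num) (by norm_num) (by norm_num) hN hσ ?_ (v := 2 ^ (24 * k)) ?_ hN ?_ ?_ ?_
  · simp only [ok_pow2, ok_mul, ok_const, ok_var, eval_mul, eval_const, eval_var, h3]
    norm_num
    omega
  · simp only [eval_pow2, eval_mul, eval_const, eval_var, h3]
  · refine ⟨(hσ.setReg hN).setReg (by simp), ?_⟩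
    simp only [RAMState.setReg_reg, RAMState.setReg_mem, hmem]
    norm_num
    refine ⟨h0, h1, h2, h3, h4, by omega, fun a ha => ?_, by omega⟩
    rw [hz a ha]
    positivity
  · rintro w hw σ ⟨i0, i1, i2, i3, i4, i5, i6, i7, i8, i9, i10, i11⟩ hi hc
    refine .seq (R := fun σ' => σ' = σ.setMem (n * d + 2 + σ.reg 5) w)
      (.storeAt hN i0 ?_ ?_ ?_) ?_
    · simp [ok_add, offT, ok_mul, ok_var, ok_const]
    · simp [ok_var]
    · simp [offT, eval_add, eval_mul, eval_var, eval_const, i2, i3, hi]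
    rintro _ rfl
    have hsame : ∀ i < σ.reg 5, (σ.setMem (n * d + 2 + σ.reg 5) w).mem (n * d + 2 + i) =
        σ.mem (n * d + 2 + i) := by
      intro i hi
      rw [RAMState.setMem_mem, if_neg (by omega)]
    have hself : (σ.setMem (n * d + 2 + σ.reg 5) w).mem (n * d + 2 + σ.reg 5) = w := by
      rw [RAMState.setMem_mem, if_pos rfl]
    have hclose : closeT.eval (σ.setMem (n * d + 2 + σ.reg 5) w).mem σ.reg =
        ∑ i ∈ Finset.range (σ.reg 5), (8 * k + 1 -
          bitDist (24 * k) w (σ.mem (n * d + 2 + i))) := by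
      rw [eval_closeT, i2, i3, i4, hi]
      refine Finset.sum_congr rfl fun i hi => ?_
      rw [hsame i (Finset.mem_range.1 hi)]
    refine .assign (by norm_num) hN i0.setMem ?_ ?_
    · simp only [ok_add, ok_sub, ok_var, ok_const]
      refine ⟨by norm_num, trivial, ok_closeT ?_ ?_ ?_⟩
      · rw [RAMState.setMem_reg]; omega
      · rw [RAMState.setMem_reg, i4]; omega
      · intro i hi'
        rw [RAMState.setMem_reg] at hi' ⊢
        rw [i2, i3, hsame i hi']
        exact (Nat.size_le.2 (i9 _ (by omega))).trans (by omega)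
    · simp only [eval_add, eval_sub, eval_var, eval_const, RAMState.setMem_reg, hclose]
      have hw' : ∀ x, x ≤ 2 ^ (24 * k) → x.size ≤ W := fun x hx => (Nat.size_le_size hx).trans hN
      set S := ∑ i ∈ Finset.range (σ.reg 5), (8 * k + 1 -
          bitDist (24 * k) w (σ.mem (n * d + 2 + i))) with hS
      refine ⟨?_, ?_, ((i0.setMem.setReg (hw' _ (by omega))).setReg (hw' _ (by omega))).setReg
        (hw' _ (by omega)), ?_⟩
      · simp [RAMState.setReg_reg, RAMState.setMem_reg, hi]
      · simp [RAMState.setReg_reg, RAMState.setMem_reg, hc]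
      simp only [RAMState.setReg_reg, RAMState.setReg_mem, RAMState.setMem_reg]
      norm_num only [if_true, if_false]
      refine ⟨i1, i2, i3, i4, i5, by omega, ?_, ?_, ?_, ?_, ?_⟩
      · intro a ha
        rw [RAMState.setMem_mem, if_neg (by omega), i7 a ha]
      · intro a ha
        rw [RAMState.setMem_mem, if_neg (by omega), i8 a (by omega)]
      · intro a ha
        rw [RAMState.setMem_mem]
        split_ifs
        · exact hw
        · exact i9 a ha
      · intro i hi' j hj
        rw [hsame j (by omega)]
        by_cases hlt : i < σ.reg 5
        · rw [hsame i hlt]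
          exact i10 i hlt j hj
        · have hS0 : S = 0 := by omega
          have hieq : i = σ.reg 5 := by omega
          subst hieq
          rw [hself]
          have := Finset.sum_eq_zero_iff.1 hS0 j (Finset.mem_range.2 hj)
          omega
      · intro w' hw''
        rcases Nat.lt_succ_iff_lt_or_eq.1 hw'' with h | rfl
        · obtain ⟨i, hi', hle⟩ := i11 w' h
          exact ⟨i, by omega, by rwa [hsame i hi']⟩
        -- An accepted word covers itself; a rejected one is covered by a codeword with nonzero
        -- summand.
        · by_cases hS0 : S = 0
          · refine ⟨σ.reg 5, by omega, ?_⟩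
            rw [hself]
            simp [bitDist]
          · obtain ⟨i, hi', hne⟩ := Finset.exists_ne_zero_of_sum_ne_zero hS0
            have hi' := Finset.mem_range.1 hi'
            exact ⟨i, by omega, by rw [hsame i hi']; omega⟩
  · rintro σ ⟨i0, i1, i2, i3, i4, i5, i6, i7, i8, i9, i10, i11⟩
    have hcnt := two_pow_le_of_covering (T := fun i => σ.mem (n * d + 2 + i)) i11
    refine ⟨i0, ⟨i7, fun a _ ha => i9 a ha, i8, fun i hi j hj hij => ?_⟩, i1, i2, i3, i4, i5⟩
    rcases lt_or_gt_of_ne hij with h | h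
    · rw [bitDist_comm]
      exact i10 j (by omega) i h
    · exact i10 i (by omega) j h

end

end OVReduction

theorem pointEntry_congr {d L R k s : ℕ} {a b a' b' : ℕ → ℕ → ℕ} {T T' : ℕ → ℕ} {i : ℕ} (c : ℕ)
    (ha : ∀ t < d, a i t = a' i t) (hb : ∀ t < d, b (i - s) t = b' (i - s) t)
    (hT : i < s → T i = T' i) :
    pointEntry d L R k s a b T i c = pointEntry d L R k s a' b' T' i c := by
  unfold pointEntry
  split_ifs with h1 h2 h3 h4 h5 h6
  · rw [ha _ h2]
  · rw [ha _ (by omega)]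
  · rw [hT h1]
  · rfl
  · rfl
  · rw [hb _ (by omega)]
  all_goals rfl

namespace OVReduction

open RAMTerm

/-! ### The table of points -/

/-- Entry `t` of vector `i` of block `g`, where blocks have size `s` and the last vector is
repeated. -/
def blockVec (mem : ℕ → ℕ) (n d s g i t : ℕ) : ℕ := mem (2 + d * min (g * s + i) (n - 1) + t)

/-- Content of cell `q` of the embedded input, for the pair `c` of blocks. -/
def cellValue (D n d k : ℕ) (mem T : ℕ → ℕ) (c q : ℕ) : ℕ :=
  if q = 0 then 2 * 2 ^ k else if q = 1 then 27 * D * (k + 1) else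
    pointEntry d (24 * k) D k (2 ^ k) (blockVec mem n d (2 ^ k) (c / (n / 2 ^ k + 1)))
      (blockVec mem n d (2 ^ k) (c % (n / 2 ^ k + 1))) T
      ((q - 2) / (27 * D * (k + 1))) ((q - 2) % (27 * D * (k + 1)))

section

variable {W N n d k D : ℕ}

theorem blockVec_addr_lt (hn : 1 ≤ n) {i t : ℕ} (ht : t < d) :
    2 + d * min i (n - 1) + t < n * d + 2 := by
  have h1 : d * min i (n - 1) ≤ d * (n - 1) := Nat.mul_le_mul_left _ (min_le_right _ _)
  have h2 : d * (n - 1) + d = n * d := by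
    obtain ⟨m, rfl⟩ := Nat.exists_eq_add_of_le hn
    rw [Nat.add_sub_cancel_left]
    ring
  omega

theorem eval_clampT {mem reg : ℕ → ℕ} (q : RAMTerm) :
    (clampT q).eval mem reg = min (q.eval mem reg) (reg 1 - 1) := by
  simp only [clampT, eval_sub, eval_add, eval_var, eval_const]
  omega

theorem eval_entryT {mem reg : ℕ → ℕ} (g i t : RAMTerm) : (entryT g i t).eval mem reg =
    blockVec mem (reg 1) (reg 2) (reg 4) (g.eval mem reg) (i.eval mem reg) (t.eval mem reg) := by
  simp only [entryT, blockVec, eval_load, eval_add, eval_mul, eval_clampT, eval_var, eval_const]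

theorem ok_entryT {mem reg : ℕ → ℕ} {g i t : RAMTerm} (hg : g.Ok W N mem reg)
    (hi : i.Ok W N mem reg) (ht : t.Ok W N mem reg) (hn : 1 ≤ reg 1)
    (hmem : ∀ a < reg 1 * reg 2 + 2, (mem a).size ≤ W) (htd : t.eval mem reg < reg 2) :
    (entryT g i t).Ok W N mem reg := by
  simp only [entryT, clampT, ok_load, ok_add, ok_mul, ok_sub, ok_var, ok_const]
  refine ⟨⟨⟨trivial, by norm_num, ⟨⟨hg, by norm_num⟩, hi⟩, ⟨⟨⟨hg, by norm_num⟩, hi⟩, trivial⟩,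
    by norm_num⟩, ht⟩, hmem _ ?_⟩
  have := eval_clampT (mem := mem) (reg := reg) (g * var 4 + i)
  rw [clampT] at this
  simp only [eval_add, eval_mul, eval_const, eval_var] at this ⊢
  rw [this]
  exact blockVec_addr_lt hn htd

theorem eval_firstT {mem reg : ℕ → ℕ} :
    firstT.eval mem reg = reg 7 / (reg 1 / reg 4 + 1) := rfl

theorem eval_secondT {mem reg : ℕ → ℕ} :
    secondT.eval mem reg = reg 7 % (reg 1 / reg 4 + 1) := by
  rw [secondT, eval_mod]; rfl

theorem ok_firstT {mem reg : ℕ → ℕ} : firstT.Ok W N mem reg := by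
  simp [firstT, groupsT, ok_div, ok_add, ok_var, ok_const]

theorem ok_secondT {mem reg : ℕ → ℕ} : secondT.Ok W N mem reg := by
  simp [secondT, groupsT, ok_mod, ok_div, ok_add, ok_var, ok_const]

theorem eval_cellT {mem reg : ℕ → ℕ} (h4 : reg 4 = 2 ^ reg 3) : (cellT D).eval mem reg =
    cellValue D (reg 1) (reg 2) (reg 3) mem (fun i => mem (reg 1 * reg 2 + 2 + i)) (reg 7)
      (reg 8) := by
  simp only [cellT, pointT, bitT, offT, dimT, cellValue, pointEntry, eval_ite, eval_iteLt, eval_sub,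
    eval_add, eval_mul, eval_mod, eval_div, eval_pow2, eval_load, eval_var, eval_const,
    eval_entryT, eval_firstT, eval_secondT, h4]
  by_cases h0 : reg 8 = 0
  · simp [h0]
  by_cases h1 : reg 8 = 1
  · simp [h1]
  rw [if_pos h0, if_pos (by omega), if_neg h0, if_neg h1]

theorem ok_cellT {mem reg : ℕ → ℕ} (hD : 0 < D) (h4 : reg 4 = 2 ^ reg 3) (hn : 1 ≤ reg 1)
    (hmem : ∀ a < reg 1 * reg 2 + 2 + 2 ^ (24 * reg 3), (mem a).size ≤ W)
    (hW : 24 * reg 3 ≤ W) : (cellT D).Ok W N mem reg := by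
  have hlow : ∀ a < reg 1 * reg 2 + 2, (mem a).size ≤ W := fun a ha =>
    hmem a (Nat.lt_add_right _ ha)
  have hi : ((var 8 - const 2) / dimT D).Ok W N mem reg := by
    simp [dimT, ok_div, ok_sub, ok_mul, ok_add, ok_var, ok_const]
  have hc : ((var 8 - const 2) % dimT D).Ok W N mem reg := by
    simp [dimT, ok_mod, ok_sub, ok_mul, ok_add, ok_var, ok_const]
  rw [cellT, ok_ite, ok_ite]
  refine ⟨by simp [ok_var], fun _ => ⟨by simp [ok_sub, ok_var, ok_const], fun _ => ?_, fun _ => by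
    simp [dimT, ok_mul, ok_add, ok_var, ok_const]⟩, fun _ => by simp [ok_mul, ok_var, ok_const]⟩
  generalize (var 8 - const 2) / dimT D = i at hi
  generalize (var 8 - const 2) % dimT D = c at hc
  simp only [pointT, bitT, offT, ok_iteLt, ok_sub, ok_add, ok_mul, ok_mod, ok_div, ok_pow2, ok_load,
    ok_var, ok_const, eval_sub, eval_add, eval_mul, eval_div, eval_var, eval_const]
  norm_num only [hi, hc, true_and, and_true]
  refine ⟨fun his => ⟨fun h => ok_entryT ok_firstT hi hc hn hlow h, fun h => ⟨fun h' =>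
    ok_entryT ok_firstT hi ?_ hn hlow ?_, fun h' => ⟨fun h'' => ⟨hmem _ ?_, ?_⟩, fun _ => trivial⟩⟩⟩,
    fun his =>
    ⟨fun _ => trivial, fun h => ⟨fun h' => ok_entryT ok_secondT ?_ ?_ hn hlow ?_,
      fun h' => ⟨fun _ => trivial, fun h'' => ⟨fun h3 => ?_, fun _ => trivial⟩⟩⟩⟩⟩
  · simp [ok_sub, hc, ok_var]
  · simp only [eval_sub, eval_var]; omega
  · have : 2 ^ reg 3 ≤ 2 ^ (24 * reg 3) := Nat.pow_le_pow_right (by norm_num) (by omega)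
    omega
  -- Among the code coordinates the quotient by `D` is at most 24k, so the power of two in the bit
  -- extraction stays within `W`.
  · refine le_trans ?_ hW
    refine (Nat.div_le_iff_le_mul_add_pred hD).2 ?_
    rw [mul_comm D]
    omega
  · simp [ok_sub, hi, ok_var]
  · simp [ok_sub, hc, ok_var]
  · simp only [eval_sub, eval_var]; omega
  · omega

theorem cellValue_congr {mem mem' T T' : ℕ → ℕ} {c q : ℕ} (hn : 1 ≤ n)
    (h : ∀ a < n * d + 2, mem a = mem' a) (hT : ∀ i < 2 ^ k, T i = T' i) :
    cellValue D n d k mem T c q = cellValue D n d k mem' T' c q := by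
  unfold cellValue
  split_ifs
  · rfl
  · rfl
  · exact pointEntry_congr _ (fun t ht => h _ (blockVec_addr_lt hn ht))
      (fun t ht => h _ (blockVec_addr_lt hn ht)) (hT _)

/-- Links what the program writes to the input format of the solver: past the two header cells, row
and column are quotient and remainder by the dimension. -/
theorem cellValue_eq_tableInput (hD : 0 < D) {mem T : ℕ → ℕ} {c : ℕ} (a : ℕ) :
    (if a < 2 + 2 * 2 ^ k * (27 * D * (k + 1)) then cellValue D n d k mem T c a else 0) =
    (tableInput (2 * 2 ^ k) (27 * D * (k + 1)) fun i j => (((pointEntry d (24 * k) D k (2 ^ k)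
      (blockVec mem n d (2 ^ k) (c / (n / 2 ^ k + 1)))
      (blockVec mem n d (2 ^ k) (c % (n / 2 ^ k + 1))) T i j : ℤ) - 1) + 1).toNat).mem a := by
  rcases a with _ | _ | q
  · simp [tableInput, cellValue]
  · have : 0 < 2 * 2 ^ k * (27 * D * (k + 1)) := by positivity
    rw [if_pos (by omega)]
    simp [tableInput, cellValue]
  · simp only [tableInput, cellValue]
    by_cases hq : q < 2 * 2 ^ k * (27 * D * (k + 1))
    · rw [if_pos (by omega), dif_pos hq]
      simp [finProdFinEquiv, Fin.divNat, Fin.modNat]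
    · rw [if_neg (by omega), dif_neg hq]

/-! ### Filling the embedded input -/

/-- Everything read lies below `bc` and everything written at or above it, so the values computed do
not change during the loop. -/
theorem fillLoop_run {M bc : ℕ} {σ : RAMState} {mem₀ T : ℕ → ℕ} (hσ : σ.VarsLe W) (hD : 0 < D)
    (hn : 1 ≤ n) (h1 : σ.reg 1 = n) (h2 : σ.reg 2 = d) (h3 : σ.reg 3 = k) (h4 : σ.reg 4 = 2 ^ k)
    (h9 : σ.reg 9 = M) (h10 : σ.reg 10 = bc) (hM : 0 < M) (hW : 24 * k + 1 ≤ W)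
    (hW' : (2 + 2 * 2 ^ k * (27 * D * (k + 1))).size ≤ W)
    (hbc : n * d + 2 + 2 ^ (24 * k) ≤ bc)
    (hmem : ∀ a < n * d + 2 + 2 ^ (24 * k), (σ.mem a).size ≤ W)
    (hlow : ∀ a < n * d + 2, σ.mem a = mem₀ a)
    (hT : ∀ i < 2 ^ k, σ.mem (n * d + 2 + i) = T i)
    (hz : ∀ a, σ.mem (bc + a * M) = 0) :
    VarRun (fillLoop D) σ
      ((const 2 + const 2 * var 4 * dimT D).assignCost W 1 + (1 +
        ((2 + 2 * 2 ^ k * (27 * D * (k + 1))) *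
          ((var 10 + var 8 * var 9).storeCost W 1 (cellT D) + (7 + 3 * W)) + 1)))
      fun σ' => σ'.VarsLe W ∧ (∀ r < 8, σ'.reg r = σ.reg r) ∧ σ'.reg 9 = M ∧ σ'.reg 10 = bc ∧
        σ'.reg 12 = σ.reg 12 ∧
        (∀ a, σ'.mem (bc + a * M) = if a < 2 + 2 * 2 ^ k * (27 * D * (k + 1)) then
          cellValue D n d k mem₀ T (σ.reg 7) a else 0) ∧
        ∀ x, (∀ a, x ≠ bc + a * M) → σ'.mem x = σ.mem x := by
  have hN : Nat.size 1 ≤ W := by simp; omega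
  refine .forLt (fun q σ' => σ'.VarsLe W ∧ (∀ r < 8, σ'.reg r = σ.reg r) ∧ σ'.reg 9 = M ∧
        σ'.reg 10 = bc ∧ σ'.reg 12 = σ.reg 12 ∧ (∀ a, σ'.mem (bc + a * M) = if a < q then
          cellValue D n d k mem₀ T (σ.reg 7) a else 0) ∧
        ∀ x, (∀ a, x ≠ bc + a * M) → σ'.mem x = σ.mem x) (by norm_num) (by norm_num)
      (by norm_num) hN hσ ?_ (v := 2 + 2 * 2 ^ k * (27 * D * (k + 1))) ?_ hW' ?_ ?_
      (fun _ h => h)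
  · simp [dimT, ok_add, ok_mul, ok_var, ok_const]
  · simp only [dimT, eval_add, eval_mul, eval_var, eval_const, h4, h3]
  · refine ⟨(hσ.setReg hW').setReg (by simp), fun r hr => ?_, ?_, ?_, ?_, fun a => ?_,
      fun x _ => rfl⟩
    · simp [RAMState.setReg_reg, show r ≠ 8 by omega, show r ≠ 13 by omega]
    · simp [RAMState.setReg_reg, h9]
    · simp [RAMState.setReg_reg, h10]
    · simp [RAMState.setReg_reg]
    · simp [RAMState.setReg_mem, hz]
  · rintro q hq σ' ⟨i1, i2, i3, i4, i4', i5, i6⟩ hi hc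
    have hout : ∀ x < n * d + 2 + 2 ^ (24 * k), σ'.mem x = σ.mem x := fun x hx =>
      i6 x fun a => by omega
    have r1 : σ'.reg 1 = n := by rw [i2 1 (by norm_num), h1]
    have r2 : σ'.reg 2 = d := by rw [i2 2 (by norm_num), h2]
    have r3 : σ'.reg 3 = k := by rw [i2 3 (by norm_num), h3]
    have r4 : σ'.reg 4 = 2 ^ k := by rw [i2 4 (by norm_num), h4]
    have hks : 2 ^ k ≤ 2 ^ (24 * k) := Nat.pow_le_pow_right (by norm_num) (by omega)
    have hval : (cellT D).eval σ'.mem σ'.reg = cellValue D n d k mem₀ T (σ.reg 7) q := by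
      rw [eval_cellT (by rw [r3, r4]), r1, r2, r3, hi, i2 7 (by norm_num)]
      refine cellValue_congr hn (fun a ha => ?_) (fun i hi => ?_)
      · rw [hout a (by omega), hlow a ha]
      · rw [hout _ (by omega), hT i hi]
    refine .storeAt hN i1 (by simp [ok_add, ok_mul, ok_var]) (ok_cellT hD (by rw [r3, r4])
      (by rw [r1]; exact hn) ?_ (by rw [r3]; omega)) ?_
    · rw [r1, r2, r3]
      intro a ha
      rw [hout a ha]
      exact hmem a ha
    rw [hval]
    simp only [eval_add, eval_mul, eval_var, i3, i4, hi]
    refine ⟨hi, hc, (i1.setMem.setReg ((Nat.size_le_size hq).trans hW')).setReg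
      ((Nat.size_le_size (Nat.sub_le _ _)).trans hW'), fun r hr => ?_, ?_, ?_, ?_, fun a => ?_,
      fun x hx => ?_⟩
    · simp [RAMState.setReg_reg, RAMState.setMem_reg, show r ≠ 8 by omega, show r ≠ 13 by omega,
        i2 r hr]
    · simp [RAMState.setReg_reg, RAMState.setMem_reg, i3]
    · simp [RAMState.setReg_reg, RAMState.setMem_reg, i4]
    · simp [RAMState.setReg_reg, RAMState.setMem_reg, i4']
    · simp only [RAMState.setReg_mem, RAMState.setMem_mem]
      rcases eq_or_ne a q with rfl | hne
      · simp
      · have : bc + a * M ≠ bc + q * M := fun h =>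
          hne (Nat.eq_of_mul_eq_mul_right hM (Nat.add_left_cancel h))
        rw [if_neg this, i5]
        have : a < q ↔ a < q + 1 := by omega
        simp only [this]
    · simp only [RAMState.setReg_mem, RAMState.setMem_mem]
      rw [if_neg (hx q), i6 x hx]

end

end OVReduction

/-! ### Treating one pair of blocks. -/

/-- `P` solves All-Nearest Neighbors on `n` points in `{-1,0,1}^d` at cost at most `B`. -/
def SolvesANNAt (P : RAMProg) (n d B : ℕ) : Prop :=
  ∀ x : Fin n → Fin d → ℤ, (∀ i k, x i k = -1 ∨ x i k = 0 ∨ x i k = 1) →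
    Function.Injective x →
    ∃ (t : ℕ) (s : RAMState), RAMExec P (tableInput n d fun i k => (x i k + 1).toNat) t s ∧
      t ≤ B ∧ IsAllNearestNeighbors x s.mem

namespace OVReduction

open RAMTerm

/-- Two of the vectors stored in `mem` are orthogonal. -/
def OrthogonalPairIn (mem : ℕ → ℕ) (n d : ℕ) : Prop :=
  ∃ i < n, ∃ j < n, ∑ t ∈ Finset.range d, mem (2 + d * i + t) * mem (2 + d * j + t) = 0

/-- Some vectors of the two blocks with pair number `c` are orthogonal. -/
def OrthogonalBlocks (mem : ℕ → ℕ) (n d s c : ℕ) : Prop :=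
  ∃ i < s, ∃ j < s, ∑ t ∈ Finset.range d, blockVec mem n d s (c / (n / s + 1)) i t *
    blockVec mem n d s (c % (n / s + 1)) j t = 0

/-- The state before the pair of blocks number `c` is treated. -/
structure PairInv (W n d k M : ℕ) (mem₀ mem₁ : ℕ → ℕ) (c : ℕ) (σ : RAMState) : Prop where
  varsLe : σ.VarsLe W
  reg1 : σ.reg 1 = n
  reg2 : σ.reg 2 = d
  reg3 : σ.reg 3 = k
  reg4 : σ.reg 4 = 2 ^ k
  reg9 : σ.reg 9 = M
  reg0 : σ.reg 0 ≤ 1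
  low : ∀ a < n * d + 2 + 2 ^ (24 * k), σ.mem a = mem₁ a
  high : ∀ a, n * d + 2 + 2 ^ (24 * k) ≤ a → c ≤ (a - (n * d + 2 + 2 ^ (24 * k))) % M → σ.mem a = 0
  sound : σ.reg 0 ≠ 0 → OrthogonalPairIn mem₀ n d
  complete : ∀ c' < c, OrthogonalBlocks mem₀ n d (2 ^ k) c' → σ.reg 0 ≠ 0

section

variable {W N n d k D M : ℕ} {mem₀ mem₁ : ℕ → ℕ}

theorem PairInv.setReg {c : ℕ} {σ : RAMState} (h : PairInv W n d k M mem₀ mem₁ c σ) {r x : ℕ}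
    (hr : r ∉ [0, 1, 2, 3, 4, 9]) (hx : x.size ≤ W) :
    PairInv W n d k M mem₀ mem₁ c (σ.setReg r x) := by
  have e : ∀ q ∈ [0, 1, 2, 3, 4, 9], (σ.setReg r x).reg q = σ.reg q := by
    intro q hq
    rw [RAMState.setReg_reg, if_neg]
    rintro rfl
    exact hr hq
  have e0 := e 0 (by simp)
  exact ⟨h.varsLe.setReg hx, by rw [e 1 (by simp), h.reg1], by rw [e 2 (by simp), h.reg2],
    by rw [e 3 (by simp), h.reg3], by rw [e 4 (by simp), h.reg4], by rw [e 9 (by simp), h.reg9],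
    by rw [e0]; exact h.reg0, h.low, h.high, by rw [e0]; exact h.sound,
    by rw [e0]; exact h.complete⟩

theorem eval_hitsT (mem reg : ℕ → ℕ) : hitsT.eval mem reg =
    ∑ i ∈ Finset.range (reg 4), (1 - ∑ t ∈ Finset.range (reg 2),
      blockVec mem (reg 1) (reg 2) (reg 4) (reg 7 / (reg 1 / reg 4 + 1)) i t *
      blockVec mem (reg 1) (reg 2) (reg 4) (reg 7 % (reg 1 / reg 4 + 1))
        (mem (reg 10 + i * reg 9) - reg 4) t) := by
  simp only [hitsT, eval_sum, eval_sub, eval_mul, eval_entryT, eval_load, eval_add, eval_firstT,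
    eval_secondT, eval_var, eval_const]
  simp

theorem ok_hitsT {mem reg : ℕ → ℕ} (hn : 1 ≤ reg 1) (hN : reg 4 ≤ N) (hW : reg 2 ≤ W)
    (hmem : ∀ a < reg 1 * reg 2 + 2, (mem a).size ≤ W)
    (hout : ∀ i < reg 4, (mem (reg 10 + i * reg 9)).size ≤ W) : hitsT.Ok W N mem reg := by
  rw [hitsT, ok_sum]
  refine ⟨by norm_num, by simp [ok_var], by simpa [eval_var] using hN, fun i hi => ?_⟩
  rw [ok_sub, ok_sum]
  refine ⟨trivial, by norm_num, by simp [ok_var], by simpa [eval_var] using hW, fun t ht => ?_⟩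
  simp only [eval_var] at hi ht
  have ht' : t < reg 2 := by simpa using ht
  rw [ok_mul]
  refine ⟨ok_entryT ok_firstT (by simp [ok_var]) (by simp [ok_var]) (by simpa using hn)
    (by simpa using hmem) (by simpa [eval_var] using ht'),
    ok_entryT ok_secondT ?_ (by simp [ok_var]) (by simpa using hn)
    (by simpa using hmem) (by simpa [eval_var] using ht')⟩
  simp only [ok_sub, ok_load, ok_add, ok_mul, ok_var, eval_add, eval_mul, eval_var]
  simpa using hout i hi

/-- The coordinates fit into the dimension, as 2 + 24 + 1 = 27; the rest is padding. -/
theorem two_mul_add_le (hD : 0 < D) (hd : d ≤ D * k) :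
    d + d + 24 * k * D + k ≤ 27 * D * (k + 1) := by
  have : k ≤ D * k := Nat.le_mul_of_pos_left k hD
  nlinarith

/-- The separation needed by `orthogonal_of_nearest` for code distance above 8k: 5 + 24 + 1 < 4 * 8.
-/
theorem five_mul_add_lt (hD : 0 < D) (hd : d ≤ D * k) :
    5 * d + 24 * k * D + k < 4 * D * (8 * k + 1) := by
  have : k ≤ D * k := Nat.le_mul_of_pos_left k hD
  nlinarith

/-- cost bound for `pairStep` -/
def pairCost (D W k R B : ℕ) : ℕ :=
  (offT + pow2 (const 24 * var 3) + var 7).assignCost W 1 +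
    (((const 2 + const 2 * var 4 * dimT D).assignCost W 1 + (1 +
        ((2 + 2 * 2 ^ k * (27 * D * (k + 1))) *
          ((var 10 + var 8 * var 9).storeCost W 1 (cellT D) + (7 + 3 * W)) + 1))) +
    ((R + 1 + (5 * W + 3) * B) +
      (ite (var 0 + hitsT) (const 1) (const 0)).assignCost W (2 ^ k)))

-- Soundness does not rely on the neighbors found: a hit is an inner product computed from the
-- input, and clamping makes every index valid. Completeness is `orthogonal_of_nearest`. The
-- solver's memory for pair `c` is the residue class of `c` modulo `M` beyond the code table, so the
-- classes of later pairs stay zero.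
set_option maxHeartbeats 400000 in
theorem pairStep_run {P : RAMProg} {B : ℕ} (hP : SolvesANNAt P (2 * 2 ^ k) (27 * D * (k + 1)) B)
    (hD : 0 < D) (hk : 1 ≤ k) (hn : 1 ≤ n) (hd : d ≤ D * k)
    (hbin : ∀ a, 2 ≤ a → mem₀ a ≤ 1) (hcode : CodeMem n d k mem₀ mem₁)
    (hW : 24 * k + 1 ≤ W) (hdW : d ≤ W)
    (hW' : (2 + 2 * 2 ^ k * (27 * D * (k + 1))).size ≤ W)
    (hbW : (n * d + 2 + 2 ^ (24 * k) + M).size ≤ W)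
    (hmemW : ∀ a < n * d + 2, (mem₀ a).size ≤ W)
    {c : ℕ} (hc : c < M) {σ : RAMState} (hσ : PairInv W n d k M mem₀ mem₁ c σ) (h7 : σ.reg 7 = c) :
    VarRun (pairStep D P) σ (pairCost D W k P.regBound B) fun σ' =>
      σ'.reg 7 = c ∧ σ'.reg 12 = σ.reg 12 ∧ PairInv W n d k M mem₀ mem₁ (c + 1) σ' := by
  have hN : Nat.size 1 ≤ W := by simp; omega
  have hM : 0 < M := by omega
  have hks : 2 ^ k ≤ 2 ^ (24 * k) := Nat.pow_le_pow_right (by norm_num) (by omega)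
  have hsN : (2 ^ k).size ≤ W := by rw [Nat.size_pow]; omega
  have hmem₁W : ∀ a < n * d + 2 + 2 ^ (24 * k), (mem₁ a).size ≤ W := by
    intro a ha
    by_cases h : a < n * d + 2
    · rw [hcode.low a h]
      exact hmemW a h
    · exact (Nat.size_le.2 (hcode.mid a ha (by omega))).trans (by omega)
  set base := n * d + 2 + 2 ^ (24 * k) with hbase
  set G := n / 2 ^ k + 1 with hG
  set T : ℕ → ℕ := fun i => mem₁ (n * d + 2 + i) with hT
  have heval : (offT + pow2 (const 24 * var 3) + var 7 : RAMTerm).eval σ.mem σ.reg = base + c := by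
    simp only [offT, eval_add, eval_mul, eval_pow2, eval_var, eval_const, hσ.reg1, hσ.reg2,
      hσ.reg3, h7, hbase]
  have hbcW : (base + c).size ≤ W := (Nat.size_le_size (by omega)).trans hbW
  refine .seq (R := fun σ' => σ' = σ.setReg 10 (base + c)) (.assign (by norm_num) hN hσ.varsLe ?_
    (by rw [heval])) ?_
  · simp only [offT, ok_add, ok_mul, ok_pow2, ok_var, ok_const, eval_mul, eval_const, eval_var,
      hσ.reg3]
    norm_num
    omega
  rintro _ rfl
  have hne : ∀ x < base, ∀ a, x ≠ base + c + a * M := fun x hx a => by omega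
  refine .seq (fillLoop_run (d := d) (mem₀ := mem₀) (T := T) (M := M) (bc := base + c)
    (hσ.varsLe.setReg hbcW) hD hn ?_ ?_ ?_ ?_ ?_ ?_ hM hW hW' ?_ ?_ ?_ ?_ ?_) ?_
  · simp [RAMState.setReg_reg, hσ.reg1]
  · simp [RAMState.setReg_reg, hσ.reg2]
  · simp [RAMState.setReg_reg, hσ.reg3]
  · simp [RAMState.setReg_reg, hσ.reg4]
  · simp [RAMState.setReg_reg, hσ.reg9]
  · simp [RAMState.setReg_reg]
  · omega
  · intro a ha
    rw [RAMState.setReg_mem, hσ.low a ha]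
    exact hmem₁W a ha
  · intro a ha
    rw [RAMState.setReg_mem, hσ.low a (Nat.lt_add_right _ ha), hcode.low a ha]
  · intro i hi
    rw [RAMState.setReg_mem, hσ.low _ (by omega)]
  · intro a
    refine hσ.high _ (by omega) ?_
    rw [show base + c + a * M - base = c + a * M by omega, Nat.add_mul_mod_self_right,
      Nat.mod_eq_of_lt hc]
  have h7' : (σ.setReg 10 (base + c)).reg 7 = c := by simp [RAMState.setReg_reg, h7]
  have h12' : (σ.setReg 10 (base + c)).reg 12 = σ.reg 12 := by simp [RAMState.setReg_reg]
  rw [h7', h12']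
  have hregs : ∀ r < 8, (σ.setReg 10 (base + c)).reg r = σ.reg r := fun r hr => by
    rw [RAMState.setReg_reg, if_neg (by omega)]
  rintro σ' ⟨i1, i2, i3, i4, i5, i6, i7⟩
  simp only [RAMState.setReg_mem] at i7
  set u := blockVec mem₀ n d (2 ^ k) (c / G) with hu
  set v := blockVec mem₀ n d (2 ^ k) (c % G) with hv
  have hu1 : ∀ i t, u i t ≤ 1 := fun i t => hbin _ (by omega)
  have hv1 : ∀ i t, v i t ≤ 1 := fun i t => hbin _ (by omega)
  obtain ⟨e, he⟩ : ∃ e, 27 * D * (k + 1) = d + d + 24 * k * D + k + e := by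
    exact Nat.exists_eq_add_of_le (two_mul_add_le hD hd)
  have hTdist : ∀ i < 2 ^ k, ∀ j < 2 ^ k, i ≠ j → 8 * k < bitDist (24 * k) (T i) (T j) := hcode.code
  obtain ⟨t, s', hex, htB, hann⟩ := hP
    -- The stored entries are larger by one than the coordinates.
    (fun i j => (pointEntry d (24 * k) D k (2 ^ k) u v T i j : ℤ) - 1) (fun i j => by
      have := pointEntry_le (d := d) (L := 24 * k) (R := D) (k := k) (s := 2 ^ k) (b := v)
        (T := T) hu1 i j
      omega) (fun i j hij => by
      refine Fin.ext (pointEntry_injective (d := d) (e := e) (a := u) (b := v) (T := T) hD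
        (by omega) rfl (fun i hi j hj h => lt_of_le_of_lt (Nat.zero_le _) (hTdist i hi j hj h))
        i.2 j.2 fun x hx => ?_)
      have := congrFun hij ⟨x, he ▸ hx⟩
      simpa using this)
  refine .seq (B := P.regBound + 1 + (5 * W + 3) * B) (VarRun.mono (Q := fun σ'' =>
      σ''.reg = σ'.reg ∧ (∀ a, σ''.mem (base + c + a * M) = s'.mem a) ∧
      ∀ x, (∀ a, x ≠ base + c + a * M) → σ''.mem x = σ.mem x)
    (.call (by norm_num) (by norm_num) hM i1 i3 i4 hex (fun _ => rfl) ?_ ?_) ?_ fun _ h => h) ?_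
  · intro a
    rw [i6, cellValue_eq_tableInput hD]
  · intro mem hm1 hm2
    exact ⟨rfl, hm1, fun x hx => (hm2 x hx).trans (i7 x hx)⟩
  · gcongr
  rintro σ'' ⟨j1, j2, j3⟩
  have v2 : σ''.VarsLe W := fun r hr => by rw [j1]; exact i1 r hr
  have rr : ∀ r < 8, σ''.reg r = σ.reg r := fun r hr => by rw [j1, i2 r hr, hregs r hr]
  have r0 := rr 0 (by norm_num)
  have r1 : σ''.reg 1 = n := by rw [rr 1 (by norm_num), hσ.reg1]
  have r2 : σ''.reg 2 = d := by rw [rr 2 (by norm_num), hσ.reg2]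
  have r3 : σ''.reg 3 = k := by rw [rr 3 (by norm_num), hσ.reg3]
  have r4 : σ''.reg 4 = 2 ^ k := by rw [rr 4 (by norm_num), hσ.reg4]
  have r7 : σ''.reg 7 = c := by rw [rr 7 (by norm_num), h7]
  have r9 : σ''.reg 9 = M := by rw [j1, i3]
  have r10 : σ''.reg 10 = base + c := by rw [j1, i4]
  have r12 : σ''.reg 12 = σ.reg 12 := by rw [j1, i5]
  have hlow : ∀ a < base, σ''.mem a = mem₁ a := fun a ha => by
    rw [j3 a (hne a ha), hσ.low a ha]
  have hlow' : ∀ a < n * d + 2, σ''.mem a = mem₀ a := fun a ha => by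
    rw [hlow a (Nat.lt_add_right _ ha), hcode.low a ha]
  have hbv : ∀ g i, ∀ t < d, blockVec σ''.mem n d (2 ^ k) g i t =
      blockVec mem₀ n d (2 ^ k) g i t := fun g i t ht => hlow' _ (blockVec_addr_lt hn ht)
  have hhits : hitsT.eval σ''.mem σ''.reg = ∑ i ∈ Finset.range (2 ^ k),
      (1 - ∑ t ∈ Finset.range d, u i t * v (s'.mem i - 2 ^ k) t) := by
    rw [eval_hitsT, r1, r2, r4, r7, r9, r10]
    refine Finset.sum_congr rfl fun i _ => ?_
    congr 1
    refine Finset.sum_congr rfl fun t ht => ?_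
    have ht := Finset.mem_range.1 ht
    rw [hbv _ _ t ht, hbv _ _ t ht, j2]
  have hnew : (ite (var 0 + hitsT) (const 1) (const 0)).eval σ''.mem σ''.reg =
      if σ.reg 0 + ∑ i ∈ Finset.range (2 ^ k),
        (1 - ∑ t ∈ Finset.range d, u i t * v (s'.mem i - 2 ^ k) t) ≠ 0 then 1 else 0 := by
    simp only [eval_ite, eval_add, eval_var, eval_const, hhits, r0]
  set S := ∑ i ∈ Finset.range (2 ^ k),
        (1 - ∑ t ∈ Finset.range d, u i t * v (s'.mem i - 2 ^ k) t) with hS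
  have hnew0 : (if σ.reg 0 + S ≠ 0 then 1 else 0) ≠ 0 ↔ σ.reg 0 ≠ 0 ∨ S ≠ 0 := by
    split_ifs <;> omega
  refine .assign (by norm_num) hsN v2 ?_ ?_
  · rw [ok_ite, ok_add]
    refine ⟨⟨by simp [ok_var], ok_hitsT (by rw [r1]; exact hn) (by rw [r4]) (by rw [r2]; exact hdW)
      ?_ ?_⟩, fun _ => trivial, fun _ => trivial⟩
    · rw [r1, r2]
      intro a ha
      rw [hlow' a ha]
      exact hmemW a ha
    · rw [r4, r9, r10]
      intro i hi
      rw [j2]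
      obtain ⟨o, ho, -⟩ := hann ⟨i, by omega⟩
      simp only at ho
      rw [ho]
      refine (Nat.size_le_size ?_).trans hW'
      have h1 := o.2
      have h2 : 2 * 2 ^ k ≤ 2 * 2 ^ k * (27 * D * (k + 1)) :=
        Nat.le_mul_of_pos_right _ (by positivity)
      omega
  rw [hnew]
  refine ⟨by simp [RAMState.setReg_reg, r7], by simp [RAMState.setReg_reg, r12],
    v2.setReg ?_, by simp [RAMState.setReg_reg, r1], by simp [RAMState.setReg_reg, r2],
    by simp [RAMState.setReg_reg, r3], by simp [RAMState.setReg_reg, r4],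
    by simp [RAMState.setReg_reg, r9], ?_, hlow, ?_, ?_, ?_⟩
  · split_ifs
    · exact hN
    · simp
  · rw [RAMState.setReg_reg, if_pos rfl]
    split_ifs <;> omega
  · intro a ha hac
    rw [RAMState.setReg_mem, j3, hσ.high a ha (by omega)]
    -- A cell written in this round has residue `c`, which the bound `c + 1` on the residue
    -- excludes.
    rintro x rfl
    rw [← hbase, show base + c + x * M - base = c + x * M by omega, Nat.add_mul_mod_self_right,
      Nat.mod_eq_of_lt hc] at hac
    omega
  · rw [RAMState.setReg_reg, if_pos rfl, hnew0]
    rintro (h | h)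
    · exact hσ.sound h
    · obtain ⟨i, -, hi⟩ := Finset.exists_ne_zero_of_sum_ne_zero h
      exact ⟨min (c / G * 2 ^ k + i) (n - 1), by omega,
        min (c % G * 2 ^ k + (s'.mem i - 2 ^ k)) (n - 1), by omega,
        Nat.eq_zero_of_not_pos fun h => hi (Nat.sub_eq_zero_of_le h)⟩
  · intro c' hc' hOB
    rw [RAMState.setReg_reg, if_pos rfl, hnew0]
    rcases Nat.lt_succ_iff_lt_or_eq.1 hc' with h | rfl
    · exact Or.inl (hσ.complete c' h hOB)
    · obtain ⟨i, hi, j, hj, hij⟩ := hOB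
      refine Or.inr fun h0 => ?_
      have hz := orthogonal_of_nearest he hu1 hv1 hD hTdist (five_mul_add_lt hD hd) hann hi hj hij
      have := Finset.sum_eq_zero_iff.1 h0 i (Finset.mem_range.2 hi)
      rw [hz] at this
      omega

end

end OVReduction

/-! ### Correctness and cost of the whole program. -/

theorem PolyBounded.eventually {g : ℕ} {F : ℕ → ℕ → ℕ} (h : PolyBounded g F) :
    ∀ᶠ c in atTop, ∀ W N, 1 ≤ N → F W N ≤ c * (W + 1) ^ c * N ^ g := by
  obtain ⟨c, hc⟩ := h
  filter_upwards [eventually_ge_atTop c] with c' hc' W N hN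
  refine (hc W N hN).trans ?_
  gcongr
  omega

namespace OVReduction

open RAMTerm

theorem exists_orthogonalBlocks {mem : ℕ → ℕ} {n d s : ℕ} (hs : 0 < s)
    (h : OrthogonalPairIn mem n d) :
    ∃ c < (n / s + 1) * (n / s + 1), OrthogonalBlocks mem n d s c := by
  obtain ⟨i, hi, j, hj, hij⟩ := h
  have hi' : i / s < n / s + 1 := Nat.lt_succ_of_le (Nat.div_le_div_right hi.le)
  have hj' : j / s < n / s + 1 := Nat.lt_succ_of_le (Nat.div_le_div_right hj.le)
  have e1 : ((n / s + 1) * (i / s) + j / s) / (n / s + 1) = i / s := by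
    rw [Nat.mul_add_div (Nat.succ_pos _), Nat.div_eq_of_lt hj', add_zero]
  have e2 : ((n / s + 1) * (i / s) + j / s) % (n / s + 1) = j / s := by
    rw [Nat.mul_add_mod, Nat.mod_eq_of_lt hj']
  -- Vector `i` is number `i % s` of block `i / s`; as `i < n`, clamping does not affect it.
  refine ⟨(n / s + 1) * (i / s) + j / s, ?_, i % s, Nat.mod_lt _ hs, j % s, Nat.mod_lt _ hs, ?_⟩
  · calc (n / s + 1) * (i / s) + j / s < (n / s + 1) * (i / s) + (n / s + 1) := by omega
      _ = (n / s + 1) * (i / s + 1) := by ring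
      _ ≤ _ := Nat.mul_le_mul_left _ hi'
  · rw [e1, e2]
    simp only [blockVec, Nat.div_add_mod', min_eq_left (Nat.le_sub_one_of_lt hi),
      min_eq_left (Nat.le_sub_one_of_lt hj)]
    exact hij

/-- cost bound for `program` -/
def programCost (D k₀ W n k M R B : ℕ) : ℕ :=
  ((load (const 0)).assignCost W 1 + ((load (const 1)).assignCost W 1 +
    (((var 1).assignCost W 1 + (1 + (n * ((var 15 + ite (var 1 / pow2 (var 15 + const 1)) (const 1)
      (const 0) : RAMTerm).assignCost W 1 + (7 + 3 * W)) + 1))) +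
    ((var 15 / const 48 + const k₀ : RAMTerm).assignCost W 1 + (pow2 (var 3)).assignCost W 1)))) +
  (((pow2 (const 24 * var 3)).assignCost W (2 ^ (24 * k)) + (1 + (2 ^ (24 * k) *
    (((offT + var 5).storeCost W (2 ^ (24 * k)) (var 6) +
      (var 5 + (const 1 - closeT)).assignCost W (2 ^ (24 * k))) + (7 + 3 * W)) + 1))) +
  ((groupsT * groupsT).assignCost W 1 + ((var 9).assignCost W 1 +
    (1 + (M * (pairCost D W k R B + (7 + 3 * W)) + 1)))))

theorem program_run {P : RAMProg} {B W n d k k₀ D M : ℕ} {mem : ℕ → ℕ}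
    (hP : SolvesANNAt P (2 * 2 ^ k) (27 * D * (k + 1)) B)
    (hD : 0 < D) (hk : k = Nat.log 2 n / 48 + k₀) (hk1 : 1 ≤ k) (hn : 1 ≤ n) (hd : d ≤ D * k)
    (h0 : mem 0 = n) (h1 : mem 1 = d) (hbin : ∀ a, 2 ≤ a → mem a ≤ 1)
    (hz : ∀ a, n * d + 2 ≤ a → mem a = 0) (hM : M = (n / 2 ^ k + 1) * (n / 2 ^ k + 1))
    (hW : 24 * k + 1 ≤ W) (hdW : d ≤ W) (hnW : n.size ≤ W)
    (hW' : (2 + 2 * 2 ^ k * (27 * D * (k + 1))).size ≤ W)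
    (hbW : (n * d + 2 + 2 ^ (24 * k) + M).size ≤ W) :
    RAMRun (program D k₀ P) ⟨fun _ => 0, mem⟩ (programCost D k₀ W n k M P.regBound B)
      fun s => s.reg 0 ≠ 0 ↔ OrthogonalPairIn mem n d := by
  have hN : Nat.size 1 ≤ W := by simp; omega
  have hsW : (2 ^ k).size ≤ W := by rw [Nat.size_pow]; omega
  have hMW : M.size ≤ W := (Nat.size_le_size (Nat.le_add_left _ _)).trans hbW
  have hmemW : ∀ a < n * d + 2, (mem a).size ≤ W := by
    intro a ha
    rcases a with _ | _ | a
    · rwa [h0]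
    · rw [h1]
      exact (Nat.size_self_le d).trans hdW
    · exact (Nat.size_le_size (hbin _ (by omega))).trans hN
  have key : VarRun (program D k₀ P) ⟨fun _ => 0, mem⟩
      (programCost D k₀ W n k M P.regBound B)
      fun s => s.reg 0 ≠ 0 ↔ OrthogonalPairIn mem n d := by
    refine .seq (prelude_run k₀ hn h0 h1 hk hnW ((Nat.size_self_le d).trans hdW) (by omega) hsW
      (by omega)) ?_
    rintro σ ⟨a1, a2, a3, a4, a5, a6, a7, a8⟩
    refine .seq (codeLoop_run a1 a2 a3 a4 a5 a6 a7 a8 hW hz) ?_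
    rintro σ ⟨b1, b2, b3, b4, b5, b6, b7⟩
    have hev : (groupsT * groupsT).eval σ.mem σ.reg = M := by
      simp only [groupsT, eval_mul, eval_add, eval_div, eval_var, eval_const, b4, b7, hM]
    refine .seq (R := fun σ' => PairInv W n d k M mem σ.mem 0 σ')
      (.assign (by norm_num) hN b1 ?_ ?_)
      ?_
    · simp [groupsT, ok_mul, ok_add, ok_div, ok_var, ok_const]
    · rw [hev]
      refine ⟨b1.setReg hMW, ?_, ?_, ?_, ?_, ?_, ?_, fun _ _ => rfl, ?_, ?_, ?_⟩
      · simp [RAMState.setReg_reg, b4]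
      · simp [RAMState.setReg_reg, b5]
      · simp [RAMState.setReg_reg, b6]
      · simp [RAMState.setReg_reg, b7]
      · simp [RAMState.setReg_reg]
      · simp [RAMState.setReg_reg, b3]
      · intro a ha _
        rw [RAMState.setReg_mem, b2.high a ha]
        exact hz a (le_trans (Nat.le_add_right _ _) ha)
      · simp [RAMState.setReg_reg, b3]
      · simp
    intro σ' hσ'
    refine .forLt (fun c σ'' => PairInv W n d k M mem σ.mem c σ'') (by norm_num) (by norm_num)
      (by norm_num) hN hσ'.varsLe (by simp [ok_var]) (v := M) (by rw [eval_var, hσ'.reg9]) hMW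
      ((hσ'.setReg (by simp) hMW).setReg (by simp) (by simp)) ?_ ?_
    · intro c hc σ'' hσ'' h7 h12
      refine (pairStep_run hP hD hk1 hn hd hbin b2 hW hdW hW' hbW hmemW hc hσ'' h7).mono le_rfl ?_
      rintro τ ⟨c1, c2, c3⟩
      refine ⟨c1, by rw [c2, h12], (c3.setReg (by simp) ?_).setReg (by simp) ?_⟩
      · exact (Nat.size_le_size hc).trans hMW
      · exact (Nat.size_le_size (Nat.sub_le _ _)).trans hMW
    · intro τ hτ
      refine ⟨hτ.sound, fun h => ?_⟩
      obtain ⟨c, hc, hOB⟩ := exists_orthogonalBlocks (s := 2 ^ k) (by positivity) h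
      exact hτ.complete c (hM ▸ hc) hOB
  obtain ⟨t, s', x1, x2, σ', x3, x4⟩ := key _ ⟨rfl, fun _ _ => rfl⟩
  refine ⟨t, s', x1, x2, ?_⟩
  simpa only [x3.2 0 (by norm_num)] using x4

/-- One assumption on `U` that absorbs all overheads linear in `W`. -/
theorem linear_bounds {R D W U : ℕ} (h : (R + 60 * (D + 1)) * (W + 1) ≤ U) :
    7 + 3 * W ≤ U ∧ 5 * W + 3 ≤ U ∧ R + 1 ≤ U ∧ 2 + 54 * D * (W + 1) ≤ U := by
  have e1 : (R + 60 * (D + 1)) * (W + 1) = R * W + R + 60 * (D * W) + 60 * D + 60 * W + 60 := by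
    ring
  have e2 : 2 + 54 * D * (W + 1) = 2 + 54 * (D * W) + 54 * D := by ring
  rw [e1] at h
  rw [e2]
  omega

/-- Filling takes at most `U * 2 ^ k` cells at cost O(U) each, the call at most `U * B` plus
clearing, and the search for hits at most `U * 2 ^ k`. -/
theorem pairCost_le {D W k R B U : ℕ} (hk : k ≤ W)
    (h16 : (R + 60 * (D + 1)) * (W + 1) ≤ U)
    (h12 : (offT + pow2 (const 24 * var 3) + var 7).assignCost W 1 ≤ U)
    (h13 : (const 2 + const 2 * var 4 * dimT D).assignCost W 1 ≤ U)
    (h14 : (var 10 + var 8 * var 9).storeCost W 1 (cellT D) ≤ U)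
    (h15 : (ite (var 0 + hitsT) (const 1) (const 0)).assignCost W (2 ^ k) ≤ U * 2 ^ k) :
    pairCost D W k R B ≤ 12 * (U * U) * (2 ^ k + B) := by
  obtain ⟨l1, l2, l3, l4⟩ := linear_bounds h16
  unfold pairCost
  generalize 2 ^ k = s, Nat.one_le_two_pow (n := k) = hs1 at *
  have hlin4 : 2 + 2 * s * (27 * D * (k + 1)) ≤ s * U := by
    have h1 : s * (54 * (D * (k + 1))) ≤ s * (54 * (D * (W + 1))) := by gcongr
    calc 2 + 2 * s * (27 * D * (k + 1)) = 2 + s * (54 * (D * (k + 1))) := by ring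
      _ ≤ s * 2 + s * (54 * (D * (W + 1))) := by omega
      _ = s * (2 + 54 * D * (W + 1)) := by ring
      _ ≤ s * U := Nat.mul_le_mul_left _ l4
  have hU1 : 1 ≤ U := by omega
  have hUU : U ≤ U * U := Nat.le_mul_of_pos_left U hU1
  have e1 : (2 + 2 * s * (27 * D * (k + 1))) *
      ((var 10 + var 8 * var 9).storeCost W 1 (cellT D) + (7 + 3 * W)) ≤ s * U * (U + U) :=
    Nat.mul_le_mul hlin4 (Nat.add_le_add h14 l1)
  have e1' : s * U * (U + U) = 2 * (U * U * s) := by ring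
  have e2 : (5 * W + 3) * B ≤ U * B := Nat.mul_le_mul_right _ l2
  have e3 : U * B ≤ U * U * B := Nat.mul_le_mul_right _ hUU
  have e4 : U * s ≤ U * U * s := Nat.mul_le_mul_right _ hUU
  have e5 : U * 1 ≤ U * s := Nat.mul_le_mul_left _ hs1
  have e6 : 12 * (U * U) * (s + B) = 12 * (U * U * s) + 12 * (U * U * B) := by ring
  omega

/-- The three summands come from the logarithm (n rounds), the code (2^(24k) words, each compared
with up to as many codewords) and the `M` pairs of blocks. -/
theorem programCost_le_of {D k₀ W n k M R B U : ℕ} (hk : k ≤ W) (hn : 1 ≤ n) (_hM : 1 ≤ M)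
    (h16 : (R + 60 * (D + 1)) * (W + 1) ≤ U)
    (h1 : (load (const 0)).assignCost W 1 ≤ U) (h2 : (load (const 1)).assignCost W 1 ≤ U)
    (h3 : (var 1).assignCost W 1 ≤ U)
    (h4 : (var 15 + ite (var 1 / pow2 (var 15 + const 1)) (const 1) (const 0)).assignCost W 1 ≤ U)
    (h5 : (var 15 / const 48 + const k₀).assignCost W 1 ≤ U)
    (h6 : (pow2 (var 3)).assignCost W 1 ≤ U)
    (h7 : (pow2 (const 24 * var 3)).assignCost W (2 ^ (24 * k)) ≤ U)
    (h8 : (offT + var 5).storeCost W (2 ^ (24 * k)) (var 6) ≤ U)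
    (h9 : (var 5 + (const 1 - closeT)).assignCost W (2 ^ (24 * k)) ≤ U * 2 ^ (24 * k))
    (h10 : (groupsT * groupsT).assignCost W 1 ≤ U) (h11 : (var 9).assignCost W 1 ≤ U)
    (h12 : (offT + pow2 (const 24 * var 3) + var 7).assignCost W 1 ≤ U)
    (h13 : (const 2 + const 2 * var 4 * dimT D).assignCost W 1 ≤ U)
    (h14 : (var 10 + var 8 * var 9).storeCost W 1 (cellT D) ≤ U)
    (h15 : (ite (var 0 + hitsT) (const 1) (const 0)).assignCost W (2 ^ k) ≤ U * 2 ^ k) :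
    programCost D k₀ W n k M R B ≤ 20 * (U * U) * (n + 2 ^ (48 * k) + M * (2 ^ k + B)) := by
  have hpair := pairCost_le (B := B) hk h16 h12 h13 h14 h15
  obtain ⟨l1, l2, l3, l4⟩ := linear_bounds h16
  have hVV : 2 ^ (48 * k) = 2 ^ (24 * k) * 2 ^ (24 * k) := by rw [← pow_add]; congr 1; ring
  rw [hVV]
  unfold programCost
  have hs1 : 1 ≤ 2 ^ k + B := le_trans Nat.one_le_two_pow (Nat.le_add_right _ _)
  generalize 2 ^ k + B = s at *
  have hV1 := Nat.one_le_two_pow (n := 24 * k)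
  generalize 2 ^ (24 * k) = V at *
  generalize pairCost D W k R B = p at *
  have hU1 : 1 ≤ U := by omega
  have hUU : U ≤ U * U := Nat.le_mul_of_pos_left U hU1
  have hcode : V * (((offT + var 5).storeCost W V (var 6) +
      (var 5 + (const 1 - closeT)).assignCost W V) + (7 + 3 * W)) ≤ V * (U + U * V + U) :=
    Nat.mul_le_mul_left _ (by omega)
  have hcode1 : V * (U + U * V + U) = 2 * (U * V) + U * (V * V) := by ring
  have hcode2 : U * V ≤ U * (V * V) := Nat.mul_le_mul_left _ (Nat.le_mul_of_pos_left V hV1)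
  have hlog : n * ((var 15 + ite (var 1 / pow2 (var 15 + const 1)) (const 1)
      (const 0) : RAMTerm).assignCost W 1 + (7 + 3 * W)) ≤ n * (U + U) :=
    Nat.mul_le_mul_left _ (by omega)
  have hlog1 : n * (U + U) = 2 * (U * n) := by ring
  have hmain : M * (p + (7 + 3 * W)) ≤ M * (12 * (U * U) * s + U) :=
    Nat.mul_le_mul_left _ (by omega)
  have hmain1 : M * (12 * (U * U) * s + U) = 12 * (U * U * (M * s)) + M * U := by ring
  have hmain2 : M * U ≤ U * U * (M * s) := by
    calc M * U ≤ M * U * (U * s) := Nat.le_mul_of_pos_right _ (by positivity)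
      _ = U * U * (M * s) := by ring
  have f1 : U ≤ U * n := Nat.le_mul_of_pos_right _ hn
  have f2 : U * n ≤ U * U * n := Nat.mul_le_mul_right _ hUU
  have f3 : U ≤ U * (V * V) := Nat.le_mul_of_pos_right _ (by positivity)
  have f4 : U * (V * V) ≤ U * U * (V * V) := Nat.mul_le_mul_right _ hUU
  have f6 : 20 * (U * U) * (n + V * V + M * s) =
      20 * (U * U * n) + 20 * (U * U * (V * V)) + 20 * (U * U * (M * s)) := by ring
  omega

theorem programCost_le (D k₀ R : ℕ) : ∃ c, ∀ W n k M B, k ≤ W → 1 ≤ n → 1 ≤ M →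
    programCost D k₀ W n k M R B ≤ c * (W + 1) ^ c * (n + 2 ^ (48 * k) + M * (2 ^ k + B)) := by
  have hA := fun e : RAMTerm => e.polyBounded_assignCost.eventually
  have hS := fun a e : RAMTerm => (a.polyBounded_storeCost e).eventually
  have hlin : ∀ᶠ c in atTop, ∀ W N, 1 ≤ N →
      (R + 60 * (D + 1)) * (W + 1) ≤ c * (W + 1) ^ c * N ^ 0 :=
    ((PolyBounded.const (R + 60 * (D + 1))).mul (h := 0)
      (PolyBounded.fst.add (.const 1))).eventually
  -- `PolyBounded` bounds are monotone in the constant, which is both factor and exponent; so one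
  -- `c` serves for all the terms.
  obtain ⟨c, h1, h2, h3, h4, h5, h6, h7, h8, h9, h10, h11, h12, h13, h14, h15, h16⟩ :=
    ((hA (load (const 0))).and <| (hA (load (const 1))).and <| (hA (var 1)).and <|
      (hA (var 15 + ite (var 1 / pow2 (var 15 + const 1)) (const 1) (const 0))).and <|
      (hA (var 15 / const 48 + const k₀)).and <| (hA (pow2 (var 3))).and <|
      (hA (pow2 (const 24 * var 3))).and <| (hS (offT + var 5) (var 6)).and <|
      (hA (var 5 + (const 1 - closeT))).and <| (hA (groupsT * groupsT)).and <| (hA (var 9)).and <|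
      (hA (offT + pow2 (const 24 * var 3) + var 7)).and <|
      (hA (const 2 + const 2 * var 4 * dimT D)).and <|
      (hS (var 10 + var 8 * var 9) (cellT D)).and <|
      (hA (ite (var 0 + hitsT) (const 1) (const 0))).and hlin).exists
  refine ⟨20 * c * c + 2 * c, fun W n k M B hk hn hM => ?_⟩
  set U := c * (W + 1) ^ c with hU
  have hs1 : 1 ≤ 2 ^ k := Nat.one_le_two_pow
  have hV1 : 1 ≤ 2 ^ (24 * k) := Nat.one_le_two_pow
  -- Only `closeT` and `hitsT` contain a big sum, one each; just these two costs pick up a factor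
  -- `N`.
  have d7 : (pow2 (const 24 * var 3)).bigDepth = 0 := rfl
  have d8 : max (offT + var 5).bigDepth (var 6).bigDepth = 0 := rfl
  have d9 : (var 5 + (const 1 - closeT)).bigDepth = 1 := rfl
  have d15 : (ite (var 0 + hitsT) (const 1) (const 0)).bigDepth = 1 := rfl
  replace h7 := h7 W _ hV1
  replace h8 := h8 W _ hV1
  replace h9 := h9 W _ hV1
  replace h15 := h15 W _ hs1
  rw [d7, pow_zero, mul_one] at h7
  rw [d8, pow_zero, mul_one] at h8
  rw [d9, pow_one] at h9
  rw [d15, pow_one] at h15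
  have one : ∀ {x g : ℕ}, x ≤ U * 1 ^ g → x ≤ U := fun h => by simpa using h
  refine (programCost_le_of hk hn hM (one (h16 W 1 le_rfl)) (one (h1 W 1 le_rfl))
    (one (h2 W 1 le_rfl)) (one (h3 W 1 le_rfl)) (one (h4 W 1 le_rfl)) (one (h5 W 1 le_rfl))
    (one (h6 W 1 le_rfl)) h7 h8 h9 (one (h10 W 1 le_rfl)) (one (h11 W 1 le_rfl))
    (one (h12 W 1 le_rfl)) (one (h13 W 1 le_rfl)) (one (h14 W 1 le_rfl)) h15).trans ?_
  refine Nat.mul_le_mul_right _ ?_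
  calc 20 * (U * U) = 20 * c * c * (W + 1) ^ (2 * c) := by rw [hU, two_mul, pow_add]; ring
    _ ≤ (20 * c * c + 2 * c) * (W + 1) ^ (20 * c * c + 2 * c) := by
      gcongr <;> omega

end OVReduction

/-! ### Input tables -/

section TableInput

variable {n d : ℕ} {v : Fin n → Fin d → ℕ}

theorem tableInput_mem_entry (i : Fin n) (t : Fin d) :
    (tableInput n d v).mem (2 + d * i + t) = v i t := by
  have h : d * i + t < n * d := by
    have := (finProdFinEquiv (i, t)).2
    simpa [finProdFinEquiv, add_comm] using this
  rw [show 2 + d * (i : ℕ) + t = (d * i + t) + 2 by ring]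
  simp only [tableInput, dif_pos h]
  have : finProdFinEquiv.symm (⟨d * i + t, h⟩ : Fin (n * d)) = (i, t) := by
    rw [Equiv.symm_apply_eq]
    ext
    simp [finProdFinEquiv, add_comm]
  rw [this]

theorem tableInput_mem_le_one (hv : ∀ i k, v i k = 0 ∨ v i k = 1) {a : ℕ} (ha : 2 ≤ a) :
    (tableInput n d v).mem a ≤ 1 := by
  obtain ⟨q, rfl⟩ := Nat.exists_eq_add_of_le' ha
  simp only [tableInput]
  split_ifs with h
  · exact (hv _ _).elim (fun h => h.le.trans zero_le_one) fun h => h.le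
  · norm_num

theorem tableInput_mem_eq_zero {a : ℕ} (ha : n * d + 2 ≤ a) : (tableInput n d v).mem a = 0 := by
  obtain ⟨q, rfl⟩ := Nat.exists_eq_add_of_le' (le_trans (Nat.le_add_left 2 _) ha)
  simp only [tableInput]
  rw [dif_neg (by omega)]

theorem orthogonalPairIn_tableInput :
    OVReduction.OrthogonalPairIn (tableInput n d v).mem n d ↔ HasOrthogonalPair v := by
  have h : ∀ i j : Fin n, ∑ t ∈ Finset.range d, (tableInput n d v).mem (2 + d * i + t) *
      (tableInput n d v).mem (2 + d * j + t) = ∑ k, v i k * v j k := by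
    intro i j
    rw [Finset.sum_range]
    simp only [tableInput_mem_entry]
  constructor
  · rintro ⟨i, hi, j, hj, hij⟩
    exact ⟨⟨i, hi⟩, ⟨j, hj⟩, by rw [← h]; exact hij⟩
  · rintro ⟨i, j, hij⟩
    exact ⟨i, i.2, j, j.2, by rw [h]; exact hij⟩

end TableInput

/-! ### Asymptotics -/

/-- The number of points is a power of two so that the floor is exact and the padded dimension is
the one the solver expects. -/
theorem logDim_two_pow (a k : ℕ) : logDim a (2 * 2 ^ k) = a * (k + 1) := by
  have : Real.logb 2 ((2 * 2 ^ k : ℕ) : ℝ) = ((k + 1 : ℕ) : ℝ) := by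
    rw [show 2 * 2 ^ k = 2 ^ (k + 1) by ring]
    push_cast
    rw [← Nat.cast_succ, Real.logb_pow, Real.logb_self_eq_one (by norm_num), mul_one]
  rw [logDim, this, ← Nat.cast_mul, Nat.floor_natCast]

theorem logDim_le {c : ℝ} {n : ℕ} (hn : 1 ≤ n) :
    logDim c n ≤ ⌈c⌉₊ * (Nat.log 2 n + 1) := by
  refine Nat.floor_le_of_le ?_
  have h1 : Real.logb 2 n ≤ (Nat.log 2 n + 1 : ℕ) := by
    rw [Real.logb_le_iff_le_rpow (by norm_num) (by exact_mod_cast hn), Real.rpow_natCast]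
    exact_mod_cast (Nat.lt_pow_succ_log_self (by norm_num) n).le
  push_cast at h1 ⊢
  have h2 : 0 ≤ Real.logb 2 n := Real.logb_nonneg (by norm_num) (by exact_mod_cast hn)
  exact mul_le_mul (Nat.le_ceil c) h1 h2 (by positivity)

/-- A polynomial in `k` is dominated by any exponential; with words of κk bits this turns the
overhead into a small power of the block size. -/
theorem exists_pow_le_mul_rpow (c κ : ℕ) {δ : ℝ} (hδ : 0 < δ) :
    ∃ C : ℝ, 0 < C ∧ ∀ k : ℕ, 1 ≤ k → (c * (κ * k + 1) ^ c : ℝ) ≤ C * ((2 : ℝ) ^ k) ^ δ := by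
  have hr : 1 < (2 : ℝ) ^ δ := Real.one_lt_rpow (by norm_num) hδ
  obtain ⟨C, hC, h⟩ := bound_of_isBigO_nat_atTop
    (isLittleO_pow_const_const_pow_of_one_lt (R := ℝ) c hr).isBigO
  refine ⟨(c + 1) * (κ + 1) ^ c * C, by positivity, fun k hk => ?_⟩
  have h1 := h (x := k) (by positivity)
  rw [Real.norm_of_nonneg (by positivity), Real.norm_of_nonneg (by positivity)] at h1
  have h2 : ((2 : ℝ) ^ k) ^ δ = ((2 : ℝ) ^ δ) ^ k := by
    rw [← Real.rpow_natCast, ← Real.rpow_natCast, ← Real.rpow_mul (by norm_num),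
      ← Real.rpow_mul (by norm_num), mul_comm]
  have hk' : (1 : ℝ) ≤ k := by exact_mod_cast hk
  have h3 : (κ * k + 1 : ℝ) ≤ (κ + 1) * k := by linarith
  calc (c * (κ * k + 1) ^ c : ℝ) ≤ (c + 1) * ((κ + 1) * k) ^ c := by gcongr; linarith
    _ = (c + 1) * (κ + 1) ^ c * (k : ℝ) ^ c := by rw [mul_pow]; ring
    _ ≤ (c + 1) * (κ + 1) ^ c * (C * ((2 : ℝ) ^ δ) ^ k) := by gcongr
    _ = _ := by rw [h2]; ring

/-- With blocks of size `S`, a polynomial in `n`, and a saving of `S ^ δ` for each pair of blocks,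
the total is subquadratic. -/
theorem blocks_cost_le {A C₁ C₂ δ x S G B Q : ℝ} (hδ : 0 < δ) (hδ1 : δ ≤ 1) (hx : 1 ≤ x)
    (hS : 1 ≤ S) (hA : 1 ≤ A) (hSx : S ^ 48 ≤ A * x) (hxS : x ≤ S ^ 48) (hG : 0 ≤ G)
    (hGS : G * S ≤ x + S) (hC₁ : 0 ≤ C₁) (hB : B ≤ C₁ * S ^ (2 - δ)) (hC₂ : 0 ≤ C₂)
    (hQ : Q ≤ C₂ * S ^ (δ / 2)) (hQ0 : 0 ≤ Q) :
    Q * (x + S ^ 48 + G * G * (S + B)) ≤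
      C₂ * ((1 + A) * A + (1 + C₁) * (1 + A) ^ 2) * x ^ (2 - δ / 96) := by
  have hS0 : 0 < S := by linarith
  have hx0 : 0 < x := by linarith
  have hSA : S ≤ A * x := (le_self_pow₀ hS (by norm_num)).trans hSx
  have hSδ : S ^ δ ≤ A * x := by
    calc S ^ δ ≤ S ^ (1 : ℝ) := Real.rpow_le_rpow_of_exponent_le hS hδ1
      _ = S := Real.rpow_one S
      _ ≤ _ := hSA
  have hinv : S ^ δ * S ^ (-δ) = 1 := by rw [← Real.rpow_add hS0]; simp
  have hpos : 0 < S ^ (-δ) := by positivity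
  -- The terms linear in x fit into the quadratic budget because S^δ ≤ S ≤ A x; this uses δ ≤ 1.
  have h1 : x + S ^ 48 ≤ (1 + A) * A * (x ^ 2 * S ^ (-δ)) := by
    calc x + S ^ 48 ≤ (1 + A) * x * (S ^ δ * S ^ (-δ)) := by rw [hinv]; linarith
      _ ≤ (1 + A) * x * (A * x * S ^ (-δ)) := by gcongr
      _ = _ := by ring
  have h2 : S ≤ S ^ (2 - δ) := by
    calc S = S ^ (1 : ℝ) := (Real.rpow_one S).symm
      _ ≤ _ := Real.rpow_le_rpow_of_exponent_le hS (by linarith)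
  have h3 : S ^ (2 - δ) = S ^ 2 * S ^ (-δ) := by
    rw [sub_eq_add_neg, Real.rpow_add hS0]; norm_num
  have h4 : G * G * (S + B) ≤ (1 + C₁) * (1 + A) ^ 2 * (x ^ 2 * S ^ (-δ)) := by
    calc G * G * (S + B) ≤ G * G * (S ^ (2 - δ) + C₁ * S ^ (2 - δ)) := by gcongr
      _ = (1 + C₁) * (G * S) ^ 2 * S ^ (-δ) := by rw [h3]; ring
      _ ≤ (1 + C₁) * ((1 + A) * x) ^ 2 * S ^ (-δ) := by
        have hGS' : G * S ≤ (1 + A) * x := by linarith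
        have := pow_le_pow_left₀ (by positivity) hGS' 2
        exact mul_le_mul_of_nonneg_right (mul_le_mul_of_nonneg_left this (by linarith)) hpos.le
      _ = _ := by ring
  -- The net saving S^(-δ/2) is converted into a power of x through x ≤ S^48.
  have h5 : S ^ (δ / 2) * S ^ (-δ) ≤ x ^ (-(δ / 96)) := by
    calc S ^ (δ / 2) * S ^ (-δ) = (S ^ 48) ^ (-(δ / 96)) := by
          rw [← Real.rpow_add hS0, ← Real.rpow_natCast, ← Real.rpow_mul hS0.le]
          congr 1
          push_cast
          ring
      _ ≤ _ := Real.rpow_le_rpow_of_nonpos hx0 hxS (by linarith)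
  have h6 : x ^ (2 - δ / 96) = x ^ 2 * x ^ (-(δ / 96)) := by
    rw [sub_eq_add_neg, Real.rpow_add hx0]; norm_num
  set K := (1 + A) * A + (1 + C₁) * (1 + A) ^ 2 with hK
  have hK0 : 0 ≤ K := by positivity
  calc Q * (x + S ^ 48 + G * G * (S + B)) ≤ Q * (K * (x ^ 2 * S ^ (-δ))) := by
        refine mul_le_mul_of_nonneg_left ?_ hQ0
        rw [hK, add_mul]
        linarith
    _ ≤ C₂ * S ^ (δ / 2) * (K * (x ^ 2 * S ^ (-δ))) := by gcongr
    _ = C₂ * K * x ^ 2 * (S ^ (δ / 2) * S ^ (-δ)) := by ring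
    _ ≤ C₂ * K * x ^ 2 * x ^ (-(δ / 96)) := by gcongr
    _ = _ := by rw [h6]; ring

/-- Costs are natural numbers, so the solver's bound may be floored. The constant `C` may be
negative, hence the maximum; 4 bounds 2^(2 - δ). -/
theorem floor_cost_le (C : ℝ) {ε δ : ℝ} (hδε : δ ≤ ε) (hδ : 0 < δ) (k : ℕ) :
    (⌊C * ((2 * 2 ^ k : ℕ) : ℝ) ^ (2 - ε)⌋₊ : ℝ) ≤ max C 0 * 4 * ((2 : ℝ) ^ k) ^ (2 - δ) := by
  have hS1 : (1 : ℝ) ≤ 2 ^ k := one_le_pow₀ (by norm_num)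
  have e1 : ((2 * 2 ^ k : ℕ) : ℝ) ^ (2 - ε) ≤ 4 * ((2 : ℝ) ^ k) ^ (2 - δ) := by
    push_cast
    calc (2 * (2 : ℝ) ^ k) ^ (2 - ε) ≤ (2 * (2 : ℝ) ^ k) ^ (2 - δ) :=
          Real.rpow_le_rpow_of_exponent_le (by linarith) (by linarith)
      _ = 2 ^ (2 - δ) * ((2 : ℝ) ^ k) ^ (2 - δ) := Real.mul_rpow (by norm_num) (by positivity)
      _ ≤ 2 ^ (2 : ℝ) * ((2 : ℝ) ^ k) ^ (2 - δ) := by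
          gcongr
          · norm_num
          · linarith
      _ = _ := by norm_num
  have e2 : (⌊C * ((2 * 2 ^ k : ℕ) : ℝ) ^ (2 - ε)⌋₊ : ℝ) ≤
      max C 0 * ((2 * 2 ^ k : ℕ) : ℝ) ^ (2 - ε) := by
    rcases le_total 0 C with hC | hC
    · rw [max_eq_left hC]
      exact Nat.floor_le (by positivity)
    · rw [Nat.floor_of_nonpos (mul_nonpos_of_nonpos_of_nonneg hC (by positivity)),
        max_eq_right hC]
      simp
  calc _ ≤ max C 0 * ((2 * 2 ^ k : ℕ) : ℝ) ^ (2 - ε) := e2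
    _ ≤ max C 0 * (4 * ((2 : ℝ) ^ k) ^ (2 - δ)) :=
        mul_le_mul_of_nonneg_left e1 (le_max_right _ _)
    _ = _ := by ring

theorem totalCost_le_rpow {A C₁ C₂ δ : ℝ} {a D n k B t : ℕ} (hδ : 0 < δ) (hδ1 : δ ≤ 1) (hn : 1 ≤ n)
    (hA : 1 ≤ A) (hkn : (2 : ℝ) ^ (48 * k) ≤ A * n) (hnk : n ≤ 2 ^ (48 * k)) (hC₁ : 0 ≤ C₁)
    (hB : (B : ℝ) ≤ C₁ * ((2 : ℝ) ^ k) ^ (2 - δ)) (hC₂ : 0 ≤ C₂)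
    (hQ : (a * ((D : ℕ) * k + 1) ^ a : ℝ) ≤ C₂ * ((2 : ℝ) ^ k) ^ (δ / 2))
    (h : t ≤ a * (D * k + 1) ^ a *
      (n + 2 ^ (48 * k) + (n / 2 ^ k + 1) * (n / 2 ^ k + 1) * (2 ^ k + B))) :
    (t : ℝ) ≤ C₂ * ((1 + A) * A + (1 + C₁) * (1 + A) ^ 2) * (n : ℝ) ^ (2 - δ / 96) := by
  have e : ((2 : ℝ) ^ k) ^ 48 = 2 ^ (48 * k) := by rw [← pow_mul, mul_comm k 48]
  have hGS : (n / 2 ^ k + 1) * 2 ^ k ≤ n + 2 ^ k := by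
    rw [add_mul, one_mul]
    exact Nat.add_le_add_right (Nat.div_mul_le_self _ _) _
  generalize n / 2 ^ k + 1 = G at h hGS
  have h' : (t : ℝ) ≤ a * (D * k + 1) ^ a *
      (n + ((2 : ℝ) ^ k) ^ 48 + G * G * ((2 : ℝ) ^ k + B)) := by
    rw [e]
    exact_mod_cast h
  refine h'.trans (blocks_cost_le hδ hδ1 (by exact_mod_cast hn) (one_le_pow₀ (by norm_num)) hA
    (e.trans_le hkn) ?_ (by positivity) (by exact_mod_cast hGS) hC₁ hB hC₂ hQ (by positivity))
  rw [e]
  exact_mod_cast hnk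

/-- All numbers in the reduction have `O(k)` bits. -/
theorem word_size_bounds {n d k D : ℕ} (hk : 1 ≤ k) (hD : 0 < D) (hn : n < 2 ^ (48 * k))
    (hd : d ≤ D * k) :
    24 * k + 1 ≤ (200 + 28 * D) * k ∧ d ≤ (200 + 28 * D) * k ∧ n.size ≤ (200 + 28 * D) * k ∧
    (2 + 2 * 2 ^ k * (27 * D * (k + 1))).size ≤ (200 + 28 * D) * k ∧
    (n * d + 2 + 2 ^ (24 * k) + (n / 2 ^ k + 1) * (n / 2 ^ k + 1)).size ≤ (200 + 28 * D) * k ∧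
    k ≤ (200 + 28 * D) * k := by
  have hDk : D ≤ D * k := Nat.le_mul_of_pos_right _ hk
  have hW : (200 + 28 * D) * k = 200 * k + 28 * (D * k) := by ring
  have hnsize : n.size ≤ 48 * k := Nat.size_le.2 hn
  have h1 : (n / 2 ^ k + 1).size ≤ 48 * k + 1 :=
    (Nat.size_add_le _ _).trans (Nat.add_le_add
      ((Nat.size_le_size (Nat.div_le_self _ _)).trans hnsize) (by simp))
  have size2 : Nat.size 2 ≤ 2 := Nat.size_self_le 2
  rw [hW]
  refine ⟨by omega, by omega, by omega, ?_, ?_, by omega⟩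
  · have e1 := Nat.size_add_le 2 (2 * 2 ^ k * (27 * D * (k + 1)))
    have e2 := Nat.size_mul_le (2 * 2 ^ k) (27 * D * (k + 1))
    have e3 := Nat.size_mul_le 2 (2 ^ k)
    have e4 := Nat.size_mul_le (27 * D) (k + 1)
    have e5 := Nat.size_self_le (27 * D)
    have e6 := Nat.size_self_le (k + 1)
    rw [Nat.size_pow] at e3
    omega
  · have e0 := Nat.size_mul_le (n / 2 ^ k + 1) (n / 2 ^ k + 1)
    have e1 := Nat.size_add_le (n * d + 2 + 2 ^ (24 * k)) ((n / 2 ^ k + 1) * (n / 2 ^ k + 1))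
    have e2 := Nat.size_add_le (n * d + 2) (2 ^ (24 * k))
    have e3 := Nat.size_add_le (n * d) 2
    have e4 := Nat.size_mul_le n d
    have e5 := Nat.size_self_le d
    rw [Nat.size_pow] at e2
    omega

/-! ### The reduction -/

/-- A subquadratic algorithm for All-Nearest Neighbors in all dimensions `O(log n)` yields one for
Orthogonal Vectors. -/
theorem ovSolvable_of_annSolvable {c ε δ : ℝ} (hc : 1 ≤ c) (hδ : 0 < δ) (hδ1 : δ ≤ 1) (hδε : δ ≤ ε)
    (h : ANNSolvable (fun n d => d = logDim ((27 * (48 * ⌈c⌉₊) : ℕ) : ℝ) n) ε) :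
    OVSolvable (logDim c) (δ / 96) := by
  obtain ⟨P, C, N, hP⟩ := h
  -- Chosen so that the dimension, at most ⌈c⌉ (log n + 1), is at most `D * k`, as log n + 1 ≤ 48k.
  set D := 48 * ⌈c⌉₊ with hD
  have hc0 : 0 < ⌈c⌉₊ := Nat.ceil_pos.2 (by linarith)
  have hDpos : 0 < D := by omega
  have hcD : ∀ m k, m + 1 ≤ 48 * k → ⌈c⌉₊ * (m + 1) ≤ D * k := fun m k h =>
    (Nat.mul_le_mul_left _ h).trans_eq (by rw [hD]; ring)
  clear_value D
  -- Makes every block instance large enough for the solver, which is only guaranteed from `N`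
  -- points on, whereas Orthogonal Vectors has to be solved for all `n`. The price is the constant
  -- factor `A` below.
  obtain ⟨k₀, hk₀⟩ : ∃ k₀, k₀ = N + 1 := ⟨_, rfl⟩
  obtain ⟨a, ha⟩ := OVReduction.programCost_le D k₀ P.regBound
  obtain ⟨C₂, hC₂, hpoly⟩ := exists_pow_le_mul_rpow a (200 + 28 * D) (half_pos hδ)
  obtain ⟨A, hA⟩ : ∃ A : ℝ, A = 2 ^ (48 * k₀) := ⟨_, rfl⟩
  have hA1 : 1 ≤ A := hA ▸ one_le_pow₀ (by norm_num)
  refine ⟨OVReduction.program D k₀ P,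
    C₂ * ((1 + A) * A + (1 + max C 0 * 4) * (1 + A) ^ 2), fun n hn => ?_⟩
  obtain ⟨m, hm⟩ : ∃ m, m = Nat.log 2 n := ⟨_, rfl⟩
  obtain ⟨k, hk⟩ : ∃ k, k = m / 48 + k₀ := ⟨_, rfl⟩
  have hk1 : 1 ≤ k := by omega
  have hnm : 2 ^ m ≤ n := hm ▸ Nat.pow_log_le_self 2 (by omega)
  have hnm' : n < 2 ^ (m + 1) := hm ▸ Nat.lt_pow_succ_log_self (by norm_num) n
  have hnk : n < 2 ^ (48 * k) :=
    hnm'.trans_le (Nat.pow_le_pow_right (by norm_num) (by omega))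
  have hkn : (2 : ℝ) ^ (48 * k) ≤ A * n := by
    rw [hA]
    norm_cast
    calc 2 ^ (48 * k) ≤ 2 ^ (48 * k₀ + m) := Nat.pow_le_pow_right (by norm_num) (by omega)
      _ = 2 ^ (48 * k₀) * 2 ^ m := pow_add _ _ _
      _ ≤ _ := Nat.mul_le_mul_left _ hnm
  have hdk : logDim c n ≤ D * k := (logDim_le hn).trans (hm ▸ hcD m k (by omega))
  generalize logDim c n = d at hdk
  intro v hv
  obtain ⟨B, hB⟩ : ∃ B, B = ⌊C * ((2 * 2 ^ k : ℕ) : ℝ) ^ (2 - ε)⌋₊ := ⟨_, rfl⟩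
  have hsolve : SolvesANNAt P (2 * 2 ^ k) (27 * D * (k + 1)) B := by
    intro x hx hinj
    have hN : N ≤ 2 * 2 ^ k := by
      have : k < 2 ^ k := Nat.lt_two_pow_self
      omega
    obtain ⟨t, s, h1, h2, h3⟩ := hP (2 * 2 ^ k) (27 * D * (k + 1)) hN
      (logDim_two_pow _ _).symm x hx hinj
    exact ⟨t, s, h1, hB ▸ Nat.le_floor h2, h3⟩
  obtain ⟨w1, w2, w3, w4, w5, w6⟩ := word_size_bounds hk1 hDpos hnk hdk
  obtain ⟨t, s, h1, h2, h3⟩ := OVReduction.program_run (mem := (tableInput n d v).mem) hsolve hDpos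
    (hm ▸ hk) hk1 hn hdk rfl rfl (fun a ha => tableInput_mem_le_one hv ha)
    (fun a ha => tableInput_mem_eq_zero ha) rfl w1 w2 w3 w4 w5
  exact ⟨t, s, h1, totalCost_le_rpow hδ hδ1 hn hA1 hkn hnk.le (by positivity)
    (hB ▸ floor_cost_le C hδε hδ k) hC₂.le (hpoly k hk1)
    (h2.trans (ha _ n k _ B w6 hn (Nat.mul_pos (Nat.succ_pos _) (Nat.succ_pos _)))),
    by rw [h3, orthogonalPairIn_tableInput]⟩

/-- The little-o bound is used with the constant log 2 / c, which cancels the factor c / log 2 in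
the dimension. -/
theorem eventually_logDim_le {c : ℝ} (hc : 0 < c) {f : ℕ → ℕ}
    (hf : (fun n : ℕ => Real.log n) =o[atTop] (fun n : ℕ => (f n : ℝ))) :
    ∀ᶠ n in atTop, logDim c n ≤ f n := by
  have h2 : 0 < Real.log 2 := Real.log_pos (by norm_num)
  filter_upwards [hf.bound (div_pos h2 hc)] with n hn
  refine Nat.floor_le_of_le ?_
  rw [Real.norm_of_nonneg (Real.log_natCast_nonneg n),
    Real.norm_of_nonneg (Nat.cast_nonneg _)] at hn
  calc c * Real.logb 2 n = c / Real.log 2 * Real.log n := by rw [Real.logb]; ring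
    _ ≤ c / Real.log 2 * (Real.log 2 / c * f n) := by gcongr
    _ = f n := by field_simp

/-- Assume the Orthogonal Vectors Conjecture. Then for every `ε > 0`, All-Nearest Neighbors in `ℓ₂`
for vectors with entries in `{-1,0,1}` is not solvable in time `O(n^(2-ε))` in dimension `c log n`,
for some constant `c`; hence neither in dimensions up to `f n`, for any `f = ω(log n)`. -/
theorem theorem1p4 (hOVC : OrthogonalVectorsConjecture) (ε : ℝ) (hε : 0 < ε) :
    (∃ c : ℝ, 1 ≤ c ∧ ¬ ANNSolvable (fun n d => d = logDim c n) ε) ∧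
    ∀ f : ℕ → ℕ, (fun n : ℕ => Real.log n) =o[atTop] (fun n : ℕ => (f n : ℝ)) →
      ¬ ANNSolvable (fun n d => d ≤ f n) ε := by
  have hδ : 0 < min ε 1 := lt_min hε one_pos
  -- The saving per call is capped at 1, as `ovSolvable_of_annSolvable` requires.
  obtain ⟨c, hc, hOV⟩ := hOVC (min ε 1 / 96) (by positivity)
  have hann : ¬ ANNSolvable (fun n d => d = logDim ((27 * (48 * ⌈c⌉₊) : ℕ) : ℝ) n) ε := fun h =>
    hOV (ovSolvable_of_annSolvable hc hδ (min_le_right _ _) (min_le_left _ _) h)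
  have hc' : 1 ≤ ((27 * (48 * ⌈c⌉₊) : ℕ) : ℝ) := by
    have : 0 < ⌈c⌉₊ := Nat.ceil_pos.2 (by linarith)
    exact_mod_cast (show 1 ≤ 27 * (48 * ⌈c⌉₊) by omega)
  refine ⟨⟨_, hc', hann⟩, fun f hf => ?_⟩
  rintro ⟨P, C, N, hP⟩
  obtain ⟨N', hN'⟩ := eventually_atTop.1 (eventually_logDim_le (by linarith : (0 : ℝ) <
    ((27 * (48 * ⌈c⌉₊) : ℕ) : ℝ)) hf)
  -- For large `n` the hard dimension is one of those up to `f n`, so the same program would serve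
  -- there.
  exact hann ⟨P, C, max N N', fun n d hn hd => hP n d (le_of_max_le_left hn)
    (hd ▸ hN' n (le_of_max_le_right hn))⟩
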